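/- **Setting.** Let $p\in(1,\infty)$. Let $\mu$ be a compactly supported mean-zero Borel probability measure on $\mathbb R^2$ that is invariant under the orthogonal transformations fixing $e_1$. Let $C_{ij}=\int x_ix_j\,d\mu$ and suppose that $C_{22}>0$ and $(C_{11}+C_{22}+1)/C_{22}=p$. For $v\in\mathbb R^2$ let $\mu_v$ be the image of $\mu$ under $|v|$ times an orthogonal transformation such that the resulting map takes $e_1$ to $v$. Let $\alpha=1+\inf\{R>0:\mu(B_R(0))=1\}$. For $\eta\in(0,2\pi)$ let $W_\eta=\{(r\cos\theta,r\sin\theta): r>0,\ |\theta|<\eta/2\}$. **The game.** Let $\varepsilon>0$. The tug-of-war in $W_\eta$ with noise $\mu$ and step size $\varepsilon$ starts at $x_0\in W_\eta$. At turn $k\ge 1$ a fair coin is tossed. If $\operatorname{dist}(x_{k-1},\partial W_\eta)>\alpha\varepsilon$, the winner of the toss chooses $v_k$ with $|v_k|\le\varepsilon$, and $x_k=x_{k-1}+v_k+z_k$, where $z_k$ is sampled from $\mu_{v_k}$. If $\operatorname{dist}(x_{k-1},\partial W_\eta)\le\alpha\varepsilon$, the winner chooses $x_k\in\partial W_\eta$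 with $|x_k-x_{k-1}|\le\alpha\varepsilon$, and the game ends; then $v_k=0$. A strategy is a sequence of Borel functions that give the player's choice as a function of the history $(x_0,v_1,x_1,\dots,v_k,x_k)$. Let $\tau=\inf\{k:x_k\in\partial W_\eta\}$ be the time to end the game. Two strategies and a starting point $x_0$ determine the law of the game; let $E_{x_0}$ be its expectation. Call $\eta\in(0,2\pi)$ *good* (for $\varepsilon$) if player II has a strategy such that $E_{x_0}[\tau]<\infty$ for all $x_0\in W_\eta$ and every strategy of player I. **Theorem 1.3.** For every such $p$ and $\mu$ there is a critical angle $\eta_p\in(0,2\pi)$ with the following properties for every $\varepsilon>0$. The set of good angles is nonempty, and $\eta_p$ is its supremum. Moreover: (i) If $0<\eta<\eta_p$, then there is a strategy for player II such that $E_{x_0}[\tau]<\infty$ for all $x_0\in W_\eta$, whatever the strategy of player I. (ii) If $\eta_p<\eta<2\pi$, then for each strategy of player II there is a strategy for player I such that $E_{x_0}[\tau]=\infty$ for all $x_0\in W_\eta$ with $\operatorname{dist}(x_0,\partial W_\eta)>\alpha\varepsilon$. -/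

import Mathlib

open MeasureTheory ProbabilityTheory Set
open scoped ENNReal

namespace TugOfWar

/-- The Euclidean plane. -/
abbrev Plane : Type := EuclideanSpace ℝ (Fin 2)

/-- The first basis vector of the plane. -/
noncomputable def e₁ : Plane := EuclideanSpace.single 0 1

/-- The open wedge of angle `η`, symmetric about the positive first axis, with apex at the origin,
in polar coordinates `(r, θ)`. -/
def wedge (η : ℝ) : Set Plane :=
  {x | ∃ r θ : ℝ, 0 < r ∧ -(η / 2) < θ ∧ θ < η / 2 ∧
    x 0 = r * Real.cos θ ∧ x 1 = r * Real.sin θ}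

/-! ### The noise -/

/-- `μ` (a probability measure) is a noise measure: it is compactly supported, has mean zero, and is
preserved by the orthogonal transformations that fix the first basis vector. -/
structure IsNoise (μ : Measure Plane) : Prop where
  compact_support : ∃ K : Set Plane, IsCompact K ∧ μ Kᶜ = 0
  mean_zero : ∫ z, z ∂μ = 0
  invariant : ∀ O : Plane ≃ₗᵢ[ℝ] Plane, O e₁ = e₁ → μ.map O = μ

/-- The entries of the covariance matrix of a mean zero measure. -/
noncomputable def cov (μ : Measure Plane) (i j : Fin 2) : ℝ := ∫ z, z i * z j ∂μ

/-- The exponent `p(μ) = (C₁₁ + C₂₂ + 1) / C₂₂` of a noise measure (indices start at `0` here).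
When `C₂₂ = 0` the quotient is `0` in Lean, so the condition `1 < exponent μ` excludes that case. -/
noncomputable def exponent (μ : Measure Plane) : ℝ := (cov μ 0 0 + cov μ 1 1 + 1) / cov μ 1 1

/-- The number `α = 1 + inf {R : μ (B_R(0)) = 1}`. -/
noncomputable def alpha (μ : Measure Plane) : ℝ :=
  1 + sInf {R : ℝ | 0 < R ∧ μ (Metric.ball 0 R) = 1}

/-- `|v|` times the rotation that takes the direction of `e₁` to the direction of `v`
(the zero map when `v = 0`). -/
noncomputable def similarity (v z : Plane) : Plane :=
  !₂[v 0 * z 0 - v 1 * z 1, v 1 * z 0 + v 0 * z 1]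

theorem similarity_e₁ (v : Plane) : similarity v e₁ = v := by
  ext i
  fin_cases i <;> simp [similarity, e₁]

theorem norm_similarity (v z : Plane) : ‖similarity v z‖ = ‖v‖ * ‖z‖ := by
  rw [EuclideanSpace.norm_eq, EuclideanSpace.norm_eq, EuclideanSpace.norm_eq,
    ← Real.sqrt_mul (by positivity)]
  congr 1
  simp [similarity, Fin.sum_univ_two]
  ring

theorem measurable_similarity : Measurable fun q : Plane × Plane => similarity q.1 q.2 := by
  have : Continuous fun q : Plane × Plane => similarity q.1 q.2 := by
    unfold similarity
    refine (PiLp.continuous_toLp 2 _).comp (continuous_pi fun i => ?_)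
    fin_cases i <;> simp <;> fun_prop
  exact this.measurable

/-- The law `μ_v` of the noise that is added after a tug by `v`: the image of `μ` under `|v|` times
an orthogonal transformation `Ψ` with `Ψ e₁ = v`. (By the invariance of `μ` the choice of the
orthogonal transformation does not matter.) -/
noncomputable def noiseAt (μ : Measure Plane) (v : Plane) : Measure Plane := μ.map (similarity v)

/-! ### Histories and strategies -/

/-- The history `(x₀, v₁, x₁, …, v_k, x_k)` up to step `k`, stored as the sequence of the pairs
`(v_i, x_i)`, `i ≤ k`, with the dummy entry `v₀ = 0`. -/
abbrev Hist (k : ℕ) : Type := (i : Finset.Iic k) → Plane × Plane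

/-- The current position `x_k` in a history up to step `k`. -/
def Hist.pos {k : ℕ} (h : Hist k) : Plane := (h ⟨k, by simp⟩).2

theorem Hist.measurable_pos {k : ℕ} : Measurable (Hist.pos (k := k)) :=
  measurable_snd.comp (measurable_pi_apply _)

/-- A strategy for either player in the game in `D` with step size `ε` and the constant `a` (which
is `α` in the game). At turn `k + 1`, given the history up to step `k`, the player, should he win
the coin toss, adds the vector `tug k h` of length at most `ε` to the position if the boundary is
at distance `> a * ε`, and otherwise ends the game at the boundary point `exit k h`, at distance
at most `a * ε` from the current position. Both choices are Borel functions of the history. -/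
structure Strategy (D : Set Plane) (a ε : ℝ) where
  tug : (k : ℕ) → Hist k → Plane
  measurable_tug : ∀ k, Measurable (tug k)
  norm_tug_le : ∀ k h, ‖tug k h‖ ≤ ε
  exit : (k : ℕ) → Hist k → Plane
  measurable_exit : ∀ k, Measurable (exit k)
  exit_mem : ∀ k h, h.pos ∈ D → Metric.infDist h.pos (frontier D) ≤ a * ε →
    exit k h ∈ frontier D ∧ dist (exit k h) h.pos ≤ a * ε

/-! ### The law of the game -/

section Law

variable {D : Set Plane} {ε : ℝ} {μ : Measure Plane}

open Classical in
/-- The law of `(v_{k+1}, x_{k+1})`, given the history up to step `k`, if the player with strategy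
`S` wins the toss. When the game is over, the position does not move any more and `v = 0`; by
convention also `v = 0` in the turn that ends the game. -/
noncomputable def moveLaw (μ : Measure Plane) (S : Strategy D (alpha μ) ε) (k : ℕ) (h : Hist k) :
    Measure (Plane × Plane) :=
  if h.pos ∈ frontier D then Measure.dirac (0, h.pos)
  else if alpha μ * ε < Metric.infDist h.pos (frontier D) then
    (noiseAt μ (S.tug k h)).map fun z => (S.tug k h, h.pos + S.tug k h + z)
  else Measure.dirac (0, S.exit k h)

open Classical in
theorem moveLaw_eq_map [IsProbabilityMeasure μ] (S : Strategy D (alpha μ) ε) (k : ℕ) (h : Hist k) :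
    moveLaw μ S k h = μ.map fun w =>
      if h.pos ∈ frontier D then (0, h.pos)
      else if alpha μ * ε < Metric.infDist h.pos (frontier D) then
        (S.tug k h, h.pos + S.tug k h + similarity (S.tug k h) w)
      else (0, S.exit k h) := by
  unfold moveLaw
  split_ifs
  · simp
  · rw [noiseAt, Measure.map_map (by fun_prop)]
    · rfl
    · exact measurable_similarity.comp measurable_prodMk_left
  · simp

theorem measurable_moveLaw [IsProbabilityMeasure μ] (S : Strategy D (alpha μ) ε) (k : ℕ) :
    Measurable (moveLaw μ S k) := by
  classical
  have hpos : Measurable fun q : Hist k × Plane => q.1.pos :=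
    Hist.measurable_pos.comp measurable_fst
  have htug : Measurable fun q : Hist k × Plane => S.tug k q.1 :=
    (S.measurable_tug k).comp measurable_fst
  have hexit : Measurable fun q : Hist k × Plane => S.exit k q.1 :=
    (S.measurable_exit k).comp measurable_fst
  have hout : Measurable fun q : Hist k × Plane =>
      if q.1.pos ∈ frontier D then ((0 : Plane), q.1.pos)
      else if alpha μ * ε < Metric.infDist q.1.pos (frontier D) then
        (S.tug k q.1, q.1.pos + S.tug k q.1 + similarity (S.tug k q.1) q.2)
      else (0, S.exit k q.1) := by
    refine Measurable.ite (hpos isClosed_frontier.measurableSet) (measurable_const.prodMk hpos) ?_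
    refine Measurable.ite ?_ ?_ (measurable_const.prodMk hexit)
    · exact measurableSet_lt measurable_const hpos.infDist
    · exact htug.prodMk ((hpos.add htug).add
        (measurable_similarity.comp (htug.prodMk measurable_snd)))
  have h1 : moveLaw μ S k = fun h => (Measure.dirac h |>.prod μ).map fun q : Hist k × Plane =>
      if q.1.pos ∈ frontier D then ((0 : Plane), q.1.pos)
      else if alpha μ * ε < Metric.infDist q.1.pos (frontier D) then
        (S.tug k q.1, q.1.pos + S.tug k q.1 + similarity (S.tug k q.1) q.2)
      else (0, S.exit k q.1) := by
    funext h
    rw [moveLaw_eq_map, Measure.dirac_prod, Measure.map_map hout measurable_prodMk_left]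
    rfl
  rw [h1]
  refine (Measure.measurable_map _ hout).comp ?_
  have h2 : (fun h : Hist k => (Measure.dirac h).prod μ) =
      fun h => (Kernel.id ×ₖ Kernel.const (Hist k) μ) h := by
    funext h
    simp [Kernel.prod_apply, Kernel.id_apply]
  rw [h2]
  exact Kernel.measurable _

theorem isProbabilityMeasure_moveLaw [IsProbabilityMeasure μ] (S : Strategy D (alpha μ) ε) (k : ℕ)
    (h : Hist k) : IsProbabilityMeasure (moveLaw μ S k h) := by
  unfold moveLaw
  split_ifs
  · infer_instance
  · have : IsProbabilityMeasure (noiseAt μ (S.tug k h)) :=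
      Measure.isProbabilityMeasure_map
        (measurable_similarity.comp measurable_prodMk_left).aemeasurable
    exact Measure.isProbabilityMeasure_map (by fun_prop)
  · infer_instance

/-- One turn of the game: a fair coin decides which of the two players moves. -/
noncomputable def turn (μ : Measure Plane) [IsProbabilityMeasure μ]
    (S₁ S₂ : Strategy D (alpha μ) ε) (k : ℕ) : Kernel (Hist k) (Plane × Plane) where
  toFun h := (2⁻¹ : ℝ≥0∞) • moveLaw μ S₁ k h + (2⁻¹ : ℝ≥0∞) • moveLaw μ S₂ k h
  measurable' := by
    refine Measure.measurable_of_measurable_coe _ fun s hs => ?_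
    simp only [Measure.coe_add, Measure.coe_smul, Pi.add_apply, Pi.smul_apply, smul_eq_mul]
    exact ((Measure.measurable_coe hs |>.comp (measurable_moveLaw S₁ k)).const_mul _).add
      ((Measure.measurable_coe hs |>.comp (measurable_moveLaw S₂ k)).const_mul _)

instance [IsProbabilityMeasure μ] (S₁ S₂ : Strategy D (alpha μ) ε) (k : ℕ) :
    IsMarkovKernel (turn μ S₁ S₂ k) where
  isProbabilityMeasure h := by
    have := isProbabilityMeasure_moveLaw S₁ k h
    have := isProbabilityMeasure_moveLaw S₂ k h
    constructor
    change ((2⁻¹ : ℝ≥0∞) • moveLaw μ S₁ k h + (2⁻¹ : ℝ≥0∞) • moveLaw μ S₂ k h) univ = 1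
    simp [ENNReal.inv_two_add_inv_two]

/-- The law on the space of complete histories `(x₀, v₁, x₁, v₂, x₂, …)` of the game in `D` with
noise `μ` and step size `ε`, started at `x`, in which player I uses the strategy `S₁` and player II
the strategy `S₂`. -/
noncomputable def gameLaw (μ : Measure Plane) [IsProbabilityMeasure μ]
    (S₁ S₂ : Strategy D (alpha μ) ε) (x : Plane) : Measure (ℕ → Plane × Plane) :=
  Kernel.traj (X := fun _ => Plane × Plane) (turn μ S₁ S₂) 0 fun _ => (0, x)

end Law

/-- The time to end the game in `D`: the first `k` with `x_k ∈ ∂D`, and `∞` if there is none. -/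
noncomputable def endTime (D : Set Plane) (ω : ℕ → Plane × Plane) : ℝ≥0∞ :=
  ⨅ (k : ℕ) (_ : (ω k).2 ∈ frontier D), (k : ℝ≥0∞)

theorem measurable_endTime (D : Set Plane) : Measurable (endTime D) := by
  classical
  unfold endTime
  refine Measurable.iInf fun k => ?_
  simp only [iInf_eq_if]
  refine Measurable.ite ?_ measurable_const measurable_const
  exact (measurable_snd.comp (measurable_pi_apply k)) isClosed_frontier.measurableSet

/-- The expectation `E_x[τ]` of the time to end the game in `D`. -/
noncomputable def expectedTime {D : Set Plane} {ε : ℝ} (μ : Measure Plane) [IsProbabilityMeasure μ]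
    (S₁ S₂ : Strategy D (alpha μ) ε) (x : Plane) : ℝ≥0∞ :=
  ∫⁻ ω, endTime D ω ∂(gameLaw μ S₁ S₂ x)

/-- The good angles: those `η ∈ (0, 2π)` for which player II has a strategy that makes the expected
time to end the game in the wedge of angle `η` finite, for every starting point and whatever the
strategy of player I. -/
def goodAngles (μ : Measure Plane) [IsProbabilityMeasure μ] (ε : ℝ) : Set ℝ :=
  {η | 0 < η ∧ η < 2 * Real.pi ∧
    ∃ S₂ : Strategy (wedge η) (alpha μ) ε, ∀ S₁ : Strategy (wedge η) (alpha μ) ε,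
      ∀ x₀ ∈ wedge η, expectedTime μ S₁ S₂ x₀ < ∞}

end TugOfWar

/-! Identify the plane with `ℂ`. A tug `v` together with its noise moves the position by `v *
tugFactor z`. Under `μ` this factor has mean `1`, mean squared modulus `p * C₂₂` and mean square `(p
- 2) * C₂₂`. So if the two players pull in opposite directions along the gradient of a function `u`,
the first order effects on the mean of `u` cancel. The second order effect has the sign of `|∇u|² Δu
+ (p - 2) ⟨D²u ∇u, ∇u⟩`, the `p`-Laplacian up to a positive factor. Time scales like the square of
the distance to the apex. The threshold is therefore the wedge that carries a solution `r ^ 2 * f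
θ`, positive inside and zero on the sides.

Such solutions are explicit: with the angle between gradient and radius as the parameter, the polar
angle becomes an integral (`polarAngle`), and `f` vanishes first when gradient and radius are
orthogonal. A small change of the right-hand side (`δ`) or of the degree (`k`) moves this zero only
a little. This yields strict supersolutions of degree `2` on every narrower sector
(`exists_superprofile`), and strict subsolutions of degree `k < 2` whose positivity sector lies
inside any given wider wedge (`exists_subprofile`).

Narrow wedge: player II pulls against the gradient of the supersolution. Whatever player I does, its
mean drops by a fixed amount per turn (`supersolution_step`), because degree `2` makes the second
order gain independent of the distance. A positive function with such a drop bounds the expected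
time (`expectedTime_le`). The wedge is first translated away from the apex, where the expansion is
not valid.

Wide wedge: player I knows the strategy of player II and almost cancels its tugs, with a bias of
order `1 / ‖x‖` along the gradient of the subsolution (`subsolution_step`). The excess of the
subsolution over a high level is then a submartingale, while the mean of `‖x‖ ^ 2` grows by at most
a constant per turn. If the expected time were finite, the mean square on survival would stay
bounded and the survival probability would tend to zero. The excess is of lower order than the
square, so its mean would tend to zero as well, although it starts positive and cannot decrease
(`expectedTime_eq_top`). A preliminary phase of pushes along the axis reaches the high region with
positive probability. -/

namespace TugOfWar

/-! ### The expected length of the game -/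

section Trajectories

variable {X : Type*} [MeasurableSpace X]

/-- The tower property over one step of a trajectory of a sequence of Markov kernels. -/
theorem lintegral_traj_step
    (κ : (n : ℕ) → Kernel ((i : Finset.Iic n) → X) X) [∀ n, IsMarkovKernel (κ n)]
    (x₀ : (i : Finset.Iic 0) → X) (n : ℕ) {F : ((i : Finset.Iic n) → X) → ℝ≥0∞}
    (hF : Measurable F) {φ : X → ℝ≥0∞} (hφ : Measurable φ) :
    ∫⁻ ω, F (Preorder.frestrictLe n ω) * φ (ω (n + 1))
        ∂(Kernel.traj (X := fun _ => X) κ 0 x₀) =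
      ∫⁻ ω, F (Preorder.frestrictLe n ω) * ∫⁻ y, φ y ∂(κ n (Preorder.frestrictLe n ω))
        ∂(Kernel.traj (X := fun _ => X) κ 0 x₀) := by
  have h1 := Kernel.partialTraj_compProd_eq_map_traj (X := fun _ => X) (κ := κ)
    (Nat.zero_le n) (x₀ := x₀)
  have hm : Measurable fun q : ((i : Finset.Iic n) → X) × X => F q.1 * φ q.2 :=
    (hF.comp measurable_fst).mul (hφ.comp measurable_snd)
  have h2 : ∫⁻ ω, F (Preorder.frestrictLe n ω) * φ (ω (n + 1))
        ∂(Kernel.traj (X := fun _ => X) κ 0 x₀) =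
      ∫⁻ q, F q.1 * φ q.2 ∂((Kernel.traj (X := fun _ => X) κ 0 x₀).map
        (fun x ↦ (Preorder.frestrictLe n x, x (n + 1)))) := by
    rw [lintegral_map hm (by fun_prop)]
  rw [h2, ← h1, Measure.lintegral_compProd hm]
  have h3 : Measurable fun a => ∫⁻ b, φ b ∂(κ n a) := hφ.lintegral_kernel
  rw [← Kernel.traj_map_frestrictLe_apply, lintegral_map]
  · refine lintegral_congr fun ω => ?_
    exact lintegral_const_mul (F (Preorder.frestrictLe n ω)) hφ
  · exact hm.lintegral_kernel_prod_right'
  · fun_prop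

theorem traj_zero_ae_eq
    (κ : (n : ℕ) → Kernel ((i : Finset.Iic n) → X) X) [∀ n, IsMarkovKernel (κ n)]
    (x₀ : (i : Finset.Iic 0) → X) {s : Set ((i : Finset.Iic 0) → X)} (hs : MeasurableSet s)
    (hx : x₀ ∈ s) :
    ∀ᵐ ω ∂(Kernel.traj (X := fun _ => X) κ 0 x₀), Preorder.frestrictLe (π := fun _ => X) 0 ω ∈ s := by
  have h := Kernel.traj_map_frestrictLe_apply (X := fun _ => X) (κ := κ) 0 0 x₀
  rw [Kernel.partialTraj_self, Kernel.id_apply] at h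
  have h2 : ∀ᵐ y ∂(Measure.dirac x₀), y ∈ s := (ae_dirac_iff hs).2 hx
  rw [← h] at h2
  exact ae_of_ae_map (by fun_prop) h2

end Trajectories

/-- Each index before the first visit to the boundary contributes `1`. Only an inequality holds,
since an arbitrary sequence may leave the boundary again. -/
theorem endTime_le_tsum (D : Set Plane) (ω : ℕ → Plane × Plane) :
    endTime D ω ≤ ∑' n, (frontier D)ᶜ.indicator 1 (ω n).2 := by
  classical
  by_cases h : ∃ k, (ω k).2 ∈ frontier D
  · calc endTime D ω ≤ (Nat.find h : ℝ≥0∞) :=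
        iInf₂_le (f := fun (k : ℕ) (_ : (ω k).2 ∈ frontier D) => (k : ℝ≥0∞)) _ (Nat.find_spec h)
      _ = ∑ n ∈ Finset.range (Nat.find h), (frontier D)ᶜ.indicator 1 (ω n).2 := by
        rw [Finset.sum_congr rfl (g := fun _ => (1 : ℝ≥0∞))]
        · simp
        · intro n hn
          have := Nat.find_min h (Finset.mem_range.1 hn)
          simp [this]
      _ ≤ _ := ENNReal.sum_le_tsum _
  · push Not at h
    have : ∀ n, (frontier D)ᶜ.indicator (1 : Plane → ℝ≥0∞) (ω n).2 = 1 := fun n => by simp [h n]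
    simp [this]

/-- The counterpart for lower bounds, meant for indicators of survival events, which vanish from the
first boundary visit on. -/
theorem tsum_le_endTime (D : Set Plane) (ω : ℕ → Plane × Plane) (f : ℕ → ℝ≥0∞) (hf : ∀ n, f n ≤ 1)
    (hfD : ∀ k n, k ≤ n → (ω k).2 ∈ frontier D → f n = 0) :
    ∑' n, f n ≤ endTime D ω := by
  refine le_iInf₂ fun k hk => ?_
  rw [tsum_eq_sum (s := Finset.range k)]
  · calc ∑ n ∈ Finset.range k, f n ≤ ∑ n ∈ Finset.range k, 1 := Finset.sum_le_sum fun n _ => hf n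
      _ = k := by simp
  · intro n hn
    exact hfD k n (by simpa using hn) hk

/-! ### Martingale criteria for finite and infinite expected time -/

section Bounds

variable {D : Set Plane} {ε : ℝ} {μ : Measure Plane} [IsProbabilityMeasure μ]

instance (S₁ S₂ : Strategy D (alpha μ) ε) (x : Plane) :
    IsProbabilityMeasure (gameLaw μ S₁ S₂ x) := by
  unfold gameLaw; infer_instance

theorem lintegral_gameLaw_step (S₁ S₂ : Strategy D (alpha μ) ε) (x : Plane) (n : ℕ)
    {F : Hist n → ℝ≥0∞} (hF : Measurable F) {φ : Plane → ℝ≥0∞} (hφ : Measurable φ) :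
    ∫⁻ ω, F (Preorder.frestrictLe n ω) * φ (ω (n + 1)).2 ∂(gameLaw μ S₁ S₂ x) =
      ∫⁻ ω, F (Preorder.frestrictLe n ω) *
        ∫⁻ y, φ y.2 ∂(turn μ S₁ S₂ n (Preorder.frestrictLe n ω)) ∂(gameLaw μ S₁ S₂ x) :=
  lintegral_traj_step (turn μ S₁ S₂) _ n hF (hφ.comp measurable_snd)

/-- A function which decreases on average by at least `1` in every turn before the end of the game
bounds the expected time to end the game. -/
theorem expectedTime_le (S₁ S₂ : Strategy D (alpha μ) ε) {U : Plane → ℝ≥0∞} (hU : Measurable U)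
    (h : ∀ n (h : Hist n), ∫⁻ y, U y.2 ∂(turn μ S₁ S₂ n h) + (frontier D)ᶜ.indicator 1 h.pos
      ≤ U h.pos) (x : Plane) :
    expectedTime μ S₁ S₂ x ≤ U x := by
  set P := gameLaw μ S₁ S₂ x
  have hind : Measurable ((frontier D)ᶜ.indicator (1 : Plane → ℝ≥0∞)) :=
    measurable_one.indicator isClosed_frontier.measurableSet.compl
  have hpos : ∀ n, Measurable fun ω : ℕ → Plane × Plane => (ω n).2 := fun n =>
    measurable_snd.comp (measurable_pi_apply n)
  have hstep : ∀ n, ∫⁻ ω, U (ω (n + 1)).2 ∂P + ∫⁻ ω, (frontier D)ᶜ.indicator 1 (ω n).2 ∂P ≤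
      ∫⁻ ω, U (ω n).2 ∂P := by
    intro n
    have h1 := lintegral_gameLaw_step S₁ S₂ x n (F := fun _ => 1) measurable_const hU
    simp only [one_mul] at h1
    rw [h1]
    refine (lintegral_add_right _ (hind.comp (hpos n))).symm.trans_le ?_
    exact lintegral_mono fun ω => h n (Preorder.frestrictLe n ω)
  have h0 : ∫⁻ ω, U (ω 0).2 ∂P = U x := by
    have := traj_zero_ae_eq (turn μ S₁ S₂) (fun _ => (0, x))
      (s := {g | U (g ⟨0, by simp⟩).2 = U x})
      ((hU.comp (measurable_snd.comp (measurable_pi_apply _))) (measurableSet_singleton _)) rfl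
    rw [lintegral_congr_ae (g := fun _ => U x)]
    · simp
    · exact this
  -- The drops telescope. The mean of `U` at time `N` is kept to close the induction and discarded
  -- only at the end.
  have hsum : ∀ N, ∑ n ∈ Finset.range N, ∫⁻ ω, (frontier D)ᶜ.indicator 1 (ω n).2 ∂P +
      ∫⁻ ω, U (ω N).2 ∂P ≤ U x := by
    intro N
    induction N with
    | zero => simp [h0]
    | succ N ih =>
      rw [Finset.sum_range_succ]
      refine le_trans (le_of_eq ?_) ((add_le_add_right (hstep N) _).trans ih)
      ring
  calc expectedTime μ S₁ S₂ x
      ≤ ∫⁻ ω, ∑' n, (frontier D)ᶜ.indicator 1 (ω n).2 ∂P :=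
        lintegral_mono fun ω => endTime_le_tsum D ω
    _ = ∑' n, ∫⁻ ω, (frontier D)ᶜ.indicator 1 (ω n).2 ∂P :=
        lintegral_tsum fun n => (hind.comp (hpos n)).aemeasurable
    _ ≤ U x := ENNReal.tsum_le_of_sum_range_le fun N => le_self_add.trans (hsum N)

open Filter in
/-- A criterion for the expected time to end the game to be infinite: with positive probability the
position runs through the sets `E 0, …, E N`, and while it stays in the sets `E n`, `n ≥ N`, the
process `φ` is a submartingale which is small compared to a process `V` whose mean grows by at most
a constant in every turn. -/
theorem expectedTime_eq_top (S₁ S₂ : Strategy D (alpha μ) ε) (x : Plane) (E : ℕ → Set Plane)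
    (N : ℕ) (hE : ∀ n, MeasurableSet (E n)) (hx : x ∈ E 0)
    (hfr : ∀ n, ∀ y ∈ E n, y ∉ frontier D) {β : ℝ≥0∞} (hβ : β ≠ 0)
    (hinit : ∀ n < N, ∀ h : Hist n, (∀ j : Finset.Iic n, (h j).2 ∈ E j) →
      β ≤ turn μ S₁ S₂ n h {y | y.2 ∈ E (n + 1)})
    {φ V : Plane → ℝ≥0∞} (hφm : Measurable φ) (hVm : Measurable V) {C C₀ : ℝ≥0∞}
    (hC : C ≠ ∞) (hC₀ : C₀ ≠ ∞)
    (hφ : ∀ n, N ≤ n → ∀ h : Hist n, (∀ j : Finset.Iic n, (h j).2 ∈ E j) →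
      φ h.pos ≤ ∫⁻ y, φ y.2 ∂(turn μ S₁ S₂ n h))
    (hφE : ∀ n, N ≤ n → ∀ y ∉ E (n + 1), φ y = 0) (hφN : ∀ y ∈ E N, φ y ≠ 0)
    (hV : ∀ n, N ≤ n → ∀ h : Hist n, (∀ j : Finset.Iic n, (h j).2 ∈ E j) →
      ∫⁻ y, V y.2 ∂(turn μ S₁ S₂ n h) ≤ V h.pos + C)
    (hVφ : ∀ δ : ℝ≥0∞, δ ≠ 0 → ∃ Cδ : ℝ≥0∞, Cδ ≠ ∞ ∧ ∀ n, N ≤ n → ∀ y ∈ E n, φ y ≤ δ * V y + Cδ)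
    (hVN : ∀ y ∈ E N, V y ≤ C₀) :
    expectedTime μ S₁ S₂ x = ∞ := by
  classical
  set P := gameLaw μ S₁ S₂ x with hP
  set A : (n : ℕ) → Set (Hist n) := fun n => {h | ∀ j : Finset.Iic n, (h j).2 ∈ E j} with hAdef
  have hA : ∀ n, MeasurableSet (A n) := by
    intro n
    have : A n = ⋂ j : Finset.Iic n, {h | (h j).2 ∈ E j} := by ext h; simp [A]
    rw [this]
    exact MeasurableSet.iInter fun j => (measurable_snd.comp (measurable_pi_apply j)) (hE j)
  have hind : ∀ n, Measurable ((A n).indicator (1 : Hist n → ℝ≥0∞)) := fun n =>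
    measurable_one.indicator (hA n)
  have hres : ∀ n, Measurable (Preorder.frestrictLe (π := fun _ => Plane × Plane) n) := fun n =>
    Preorder.measurable_frestrictLe (α := ℕ) (X := fun _ => Plane × Plane) n
  have hpos : ∀ n, Measurable fun ω : ℕ → Plane × Plane => (ω n).2 := fun n =>
    measurable_snd.comp (measurable_pi_apply n)
  have hir : ∀ n, Measurable fun ω : ℕ → Plane × Plane =>
      (A n).indicator (1 : Hist n → ℝ≥0∞) (Preorder.frestrictLe n ω) := fun n =>
    (hind n).comp (hres n)
  have hφr : ∀ n, Measurable fun ω : ℕ → Plane × Plane =>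
      (A n).indicator (1 : Hist n → ℝ≥0∞) (Preorder.frestrictLe n ω) * φ (ω n).2 := fun n =>
    (hir n).mul (hφm.comp (hpos n))
  have hVr : ∀ n, Measurable fun ω : ℕ → Plane × Plane =>
      (A n).indicator (1 : Hist n → ℝ≥0∞) (Preorder.frestrictLe n ω) * V (ω n).2 := fun n =>
    (hir n).mul (hVm.comp (hpos n))
  have hAs : ∀ n (ω : ℕ → Plane × Plane), Preorder.frestrictLe (n + 1) ω ∈ A (n + 1) ↔
      Preorder.frestrictLe n ω ∈ A n ∧ (ω (n + 1)).2 ∈ E (n + 1) := by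
    intro n ω
    constructor
    · intro h
      refine ⟨fun j => ?_, h ⟨n + 1, by simp⟩⟩
      exact h ⟨j, Finset.mem_Iic.2 ((Finset.mem_Iic.1 j.2).trans (Nat.le_succ n))⟩
    · rintro ⟨h1, h2⟩ ⟨j, hj⟩
      rcases Nat.lt_or_ge n j with h | h
      · have : j = n + 1 := le_antisymm (Finset.mem_Iic.1 hj) h
        subst this
        exact h2
      · exact h1 ⟨j, Finset.mem_Iic.2 h⟩
  -- Survival probability, and the means of `φ` and `V` restricted to survival. If the expected time
  -- is finite, `q` is summable, `b` is bounded, and `a` is nondecreasing from `N` on with `a N ≠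
  -- 0`; these facts are incompatible.
  set q : ℕ → ℝ≥0∞ := fun n => ∫⁻ ω, (A n).indicator 1 (Preorder.frestrictLe n ω) ∂P with hq
  set a : ℕ → ℝ≥0∞ :=
    fun n => ∫⁻ ω, (A n).indicator 1 (Preorder.frestrictLe n ω) * φ (ω n).2 ∂P with ha
  set b : ℕ → ℝ≥0∞ :=
    fun n => ∫⁻ ω, (A n).indicator 1 (Preorder.frestrictLe n ω) * V (ω n).2 ∂P with hb
  have hsum : ∑' n, q n ≤ expectedTime μ S₁ S₂ x := by
    rw [show ∑' n, q n = _ from (lintegral_tsum fun n => (hir n).aemeasurable).symm]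
    refine lintegral_mono fun ω => tsum_le_endTime D ω _ (fun n => ?_) fun k n hkn hk => ?_
    · by_cases h : Preorder.frestrictLe n ω ∈ A n <;> simp [h]
    · have : Preorder.frestrictLe n ω ∉ A n := fun h => hfr k _ (h ⟨k, by simpa using hkn⟩) hk
      simp [this]
  by_contra htop
  have hsum' : ∑' n, q n ≠ ∞ := ne_top_of_le_ne_top htop hsum
  have hqpos : ∀ n ≤ N, q n ≠ 0 := by
    intro n
    induction n with
    | zero =>
      intro _
      have := traj_zero_ae_eq (turn μ S₁ S₂) (fun _ => (0, x)) (s := A 0) (hA 0) (by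
        rintro ⟨j, hj⟩
        have : j = 0 := by simpa using hj
        subst this
        exact hx)
      have h1 : q 0 = 1 := by
        rw [hq]
        simp only
        rw [lintegral_congr_ae (g := fun _ => 1)]
        · simp
        · filter_upwards [this] with ω hω
          simp [hω]
      simp [h1]
    | succ n ih =>
      intro hn
      have h1 : β * q n ≤ q (n + 1) := by
        have h2 := lintegral_gameLaw_step S₁ S₂ x n (hind n)
          (measurable_one.indicator (hE (n + 1)) : Measurable ((E (n + 1)).indicator 1))
        have h3 : q (n + 1) = ∫⁻ ω, (A n).indicator 1 (Preorder.frestrictLe n ω) *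
            (E (n + 1)).indicator 1 (ω (n + 1)).2 ∂P := by
          refine lintegral_congr fun ω => ?_
          by_cases h4 : Preorder.frestrictLe n ω ∈ A n <;>
          by_cases h5 : (ω (n + 1)).2 ∈ E (n + 1) <;>
          simp [Set.indicator, hAs, h4, h5]
        rw [h3, h2, hq]
        simp only
        rw [← lintegral_const_mul _ (hir n)]
        refine lintegral_mono fun ω => ?_
        by_cases h4 : Preorder.frestrictLe n ω ∈ A n
        · simp only [h4, indicator_of_mem, Pi.one_apply, mul_one, one_mul]
          refine (hinit n (by omega) _ h4).trans (le_of_eq ?_)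
          exact (lintegral_indicator_one (measurable_snd (hE (n + 1)))).symm
        · simp [h4]
      intro h0
      rw [h0] at h1
      rcases mul_eq_zero.1 (le_antisymm h1 zero_le) with h | h
      · exact hβ h
      · exact ih (by omega) h
  have haN : a N ≠ 0 := by
    intro h0
    rw [ha] at h0
    simp only at h0
    rw [lintegral_eq_zero_iff (hφr N)] at h0
    refine hqpos N le_rfl ?_
    rw [hq]
    simp only
    rw [lintegral_eq_zero_iff (hir N)]
    filter_upwards [h0] with ω hω
    by_cases h4 : Preorder.frestrictLe N ω ∈ A N
    · simp only [Pi.zero_apply, h4, indicator_of_mem, Pi.one_apply, one_mul] at hω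
      exact absurd hω (hφN _ (h4 ⟨N, by simp⟩))
    · simp [h4]
  have hamono : ∀ n, N ≤ n → a N ≤ a n := by
    intro n hn
    induction n, hn using Nat.le_induction with
    | base => exact le_rfl
    | succ n hn ih =>
      refine ih.trans ?_
      have h2 := lintegral_gameLaw_step S₁ S₂ x n (hind n) hφm
      -- Since `φ` vanishes off `E (n + 1)`, paths that are lost at this turn contribute nothing,
      -- and survival up to time `n` is the only restriction that counts.
      have h3 : a (n + 1) = ∫⁻ ω, (A n).indicator 1 (Preorder.frestrictLe n ω) *
          φ (ω (n + 1)).2 ∂P := by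
        refine lintegral_congr fun ω => ?_
        by_cases h5 : (ω (n + 1)).2 ∈ E (n + 1)
        · by_cases h4 : Preorder.frestrictLe n ω ∈ A n <;> simp [Set.indicator, hAs, h4, h5]
        · simp [hφE n hn _ h5]
      rw [h3, h2]
      refine lintegral_mono fun ω => ?_
      by_cases h4 : Preorder.frestrictLe n ω ∈ A n
      · simp only [h4, indicator_of_mem, Pi.one_apply, one_mul]
        exact hφ n hn _ h4
      · simp [h4]
  have hb1 : ∀ n, N ≤ n → b (n + 1) ≤ b n + C * q n := by
    intro n hn
    have h2 := lintegral_gameLaw_step S₁ S₂ x n (hind n) hVm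
    calc b (n + 1) ≤ ∫⁻ ω, (A n).indicator 1 (Preorder.frestrictLe n ω) * V (ω (n + 1)).2 ∂P := by
          refine lintegral_mono fun ω => ?_
          by_cases h4 : Preorder.frestrictLe (n + 1) ω ∈ A (n + 1)
          · simp [h4, ((hAs n ω).1 h4).1]
          · simp [h4]
      _ ≤ ∫⁻ ω, ((A n).indicator 1 (Preorder.frestrictLe n ω) * V (ω n).2 +
          C * (A n).indicator 1 (Preorder.frestrictLe n ω)) ∂P := by
        rw [h2]
        refine lintegral_mono fun ω => ?_
        by_cases h4 : Preorder.frestrictLe n ω ∈ A n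
        · simp only [h4, indicator_of_mem, Pi.one_apply, one_mul, mul_one]
          exact hV n hn _ h4
        · simp [h4]
      _ = b n + C * q n := by
        rw [lintegral_add_right _ ((hir n).const_mul C),
          lintegral_const_mul _ (hir n)]
  have hbN : b N ≤ C₀ := by
    calc b N ≤ ∫⁻ ω, C₀ ∂P := by
          refine lintegral_mono fun ω => ?_
          by_cases h4 : Preorder.frestrictLe N ω ∈ A N
          · simp only [h4, indicator_of_mem, Pi.one_apply, one_mul]
            exact hVN _ (h4 ⟨N, by simp⟩)
          · simp [h4]
      _ = C₀ := by simp
  have hb2 : ∀ n, N ≤ n → b n ≤ C₀ + C * ∑ j ∈ Finset.range n, q j := by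
    intro n hn
    induction n, hn using Nat.le_induction with
    | base => exact hbN.trans le_self_add
    | succ n hn ih =>
      rw [Finset.sum_range_succ, mul_add, ← add_assoc]
      exact (hb1 n hn).trans (add_le_add_left ih _)
  set M : ℝ≥0∞ := C₀ + C * ∑' j, q j with hM
  have hMtop : M ≠ ∞ := ENNReal.add_ne_top.2 ⟨hC₀, ENNReal.mul_ne_top hC hsum'⟩
  have hbM : ∀ n, N ≤ n → b n ≤ M := fun n hn => (hb2 n hn).trans (by
    rw [hM]; gcongr; exact ENNReal.sum_le_tsum _)
  -- As `q n` tends to zero, the additive constant `Cδ` disappears in the limit and only the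
  -- multiple of `δ` remains.
  have hle : ∀ δ : ℝ≥0∞, δ ≠ 0 → a N ≤ δ * M := by
    intro δ hδ
    obtain ⟨Cδ, hCδ, h⟩ := hVφ δ hδ
    have h1 : ∀ n, N ≤ n → a N ≤ δ * M + Cδ * q n := by
      intro n hn
      calc a N ≤ a n := hamono n hn
        _ ≤ ∫⁻ ω, (δ * ((A n).indicator 1 (Preorder.frestrictLe n ω) * V (ω n).2) +
            Cδ * (A n).indicator 1 (Preorder.frestrictLe n ω)) ∂P := by
          refine lintegral_mono fun ω => ?_
          by_cases h4 : Preorder.frestrictLe n ω ∈ A n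
          · simp only [h4, indicator_of_mem, Pi.one_apply, one_mul, mul_one]
            exact h n hn _ (h4 ⟨n, by simp⟩)
          · simp [h4]
        _ = δ * b n + Cδ * q n := by
          rw [lintegral_add_right _ ((hir n).const_mul Cδ),
            lintegral_const_mul _ (hir n),
            lintegral_const_mul _ (hVr n)]
        _ ≤ δ * M + Cδ * q n := by gcongr; exact hbM n hn
    have h2 : Tendsto (fun n => δ * M + Cδ * q n) atTop (nhds (δ * M + Cδ * 0)) :=
      tendsto_const_nhds.add
        (ENNReal.Tendsto.const_mul (ENNReal.tendsto_atTop_zero_of_tsum_ne_top hsum') (Or.inr hCδ))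
    rw [mul_zero, add_zero] at h2
    exact ge_of_tendsto h2 (eventually_atTop.2 ⟨N, h1⟩)
  have haM : a N ≠ ∞ := ne_top_of_le_ne_top (ENNReal.mul_ne_top ENNReal.one_ne_top hMtop)
    (hle 1 one_ne_zero)
  -- This choice of `δ` forces `a N ≤ a N / 2`; the summand `1` avoids a zero denominator when `M =
  -- 0`.
  have hδ : a N / (2 * (M + 1)) ≠ 0 := by
    simp only [ne_eq, ENNReal.div_eq_zero_iff, haN, false_or]
    exact ENNReal.mul_ne_top (by simp) (by simp [hMtop])
  have h3 := hle _ hδ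
  have h4 : a N / (2 * (M + 1)) * M ≤ a N / 2 := by
    calc a N / (2 * (M + 1)) * M ≤ a N / (2 * (M + 1)) * (M + 1) := by gcongr; exact le_self_add
      _ = a N / 2 := by
        rw [div_eq_mul_inv, div_eq_mul_inv, ENNReal.mul_inv (by simp) (by simp), mul_assoc,
          mul_assoc, ENNReal.inv_mul_cancel (by simp) (by simp [hMtop]), mul_one]
  exact absurd (h3.trans h4) (not_le.2 (ENNReal.half_lt_self haN haM))

end Bounds

/-! ### Angular profiles of homogeneous functions -/

/-- The value of `|∇u|² Δu + (p - 2) ⟨D²u ∇u, ∇u⟩` on the unit circle for the homogeneous function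
`u = r ^ k * f θ`, in terms of the values of `f`, `f'` and `f''`. -/
def angularOperator (p k f f₁ f₂ : ℝ) : ℝ :=
  (k ^ 2 * f ^ 2 + f₁ ^ 2) * (k ^ 2 * f + f₂) +
    (p - 2) * (k ^ 3 * (k - 1) * f ^ 3 + 2 * k * (k - 1) * f * f₁ ^ 2 + f₁ ^ 2 * (k * f + f₂))

/-- The weight `|n_tan|² + (p - 1) |n_rad|²` as a function of the angle between the gradient and the
radius. -/
noncomputable def weight (p t : ℝ) : ℝ := 1 + (p - 2) * Real.sin t ^ 2

/-- The weight times the speed at which the angle between the gradient and the radius turns. -/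
noncomputable def turning (p k δ t : ℝ) : ℝ := (k - 1) * (p - 1) + weight p t - δ * Real.cos t

/-- The polar angle as a function of the angle between the gradient and the radius. -/
noncomputable def polarAngle (p k δ x : ℝ) : ℝ := ∫ t in (0 : ℝ)..x, weight p t / turning p k δ t

/-- The weight is the convex combination of `1` and `p - 1` with coefficients `cos² t` and `sin² t`.
-/
theorem weight_lower {p : ℝ} (t : ℝ) : min 1 (p - 1) ≤ weight p t := by
  unfold weight
  have h1 := Real.sin_sq_add_cos_sq t
  rcases le_total p 2 with h | h
  · refine (min_le_right _ _).trans ?_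
    nlinarith [sq_nonneg (Real.cos t)]
  · refine (min_le_left _ _).trans ?_
    nlinarith [sq_nonneg (Real.sin t)]

theorem weight_pos {p : ℝ} (hp : 1 < p) (t : ℝ) : 0 < weight p t :=
  (lt_min one_pos (by linarith)).trans_le (weight_lower t)

theorem turning_lower {p k δ : ℝ} (hp : 1 < p) (hk : 1 ≤ k) (t : ℝ) :
    min 1 (p - 1) - |δ| ≤ turning p k δ t := by
  have h1 := weight_lower (p := p) t
  have h2 : δ * Real.cos t ≤ |δ| := by
    calc δ * Real.cos t ≤ |δ * Real.cos t| := le_abs_self _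
      _ = |δ| * |Real.cos t| := abs_mul _ _
      _ ≤ |δ| * 1 := by gcongr; exact Real.abs_cos_le_one t
      _ = |δ| := mul_one _
  have h3 : 0 ≤ (k - 1) * (p - 1) := mul_nonneg (by linarith) (by linarith)
  unfold turning
  linarith

theorem continuous_weight (p : ℝ) : Continuous (weight p) := by unfold weight; fun_prop

theorem continuous_turning (p k δ : ℝ) : Continuous (turning p k δ) := by
  unfold turning weight; fun_prop

section Profile

variable {p k δ : ℝ}

theorem turning_pos (hp : 1 < p) (hk : 1 ≤ k) (hδ : |δ| < min 1 (p - 1)) (t : ℝ) :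
    0 < turning p k δ t :=
  (sub_pos.2 hδ).trans_le (turning_lower hp hk t)

theorem hasDerivAt_polarAngle (hp : 1 < p) (hk : 1 ≤ k) (hδ : |δ| < min 1 (p - 1)) (x : ℝ) :
    HasDerivAt (polarAngle p k δ) (weight p x / turning p k δ x) x := by
  have hc : Continuous fun t => weight p t / turning p k δ t :=
    (continuous_weight p).div (continuous_turning p k δ) fun t => (turning_pos hp hk hδ t).ne'
  exact (hc.integral_hasStrictDerivAt 0 x).hasDerivAt

theorem polarAngle_neg (x : ℝ) : polarAngle p k δ (-x) = -polarAngle p k δ x := by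
  unfold polarAngle
  have h := intervalIntegral.integral_comp_neg (a := 0) (b := x)
    (fun t => weight p t / turning p k δ t)
  rw [neg_zero] at h
  rw [intervalIntegral.integral_symm (-x) 0, ← h]
  congr 2
  funext t
  simp [weight, turning]

theorem strictMono_polarAngle (hp : 1 < p) (hk : 1 ≤ k) (hδ : |δ| < min 1 (p - 1)) :
    StrictMono (polarAngle p k δ) :=
  strictMono_of_hasDerivAt_pos (hasDerivAt_polarAngle hp hk hδ) fun x =>
    div_pos (weight_pos hp x) (turning_pos hp hk hδ x)

/-- The integrand is bounded below by a positive constant, so the integral grows at least linearly;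
oddness and the intermediate value theorem do the rest. -/
theorem surjective_polarAngle (hp : 1 < p) (hk : 1 ≤ k) (hδ : |δ| < min 1 (p - 1)) :
    Function.Surjective (polarAngle p k δ) := by
  have hcont : Continuous (polarAngle p k δ) :=
    continuous_iff_continuousAt.2 fun x => (hasDerivAt_polarAngle hp hk hδ x).continuousAt
  set m := min 1 (p - 1)
  have hm : 0 < m := lt_min one_pos (by linarith)
  set M := (k - 1) * (p - 1) + (1 + |p - 2|) + |δ| with hM
  have hturn : ∀ t, turning p k δ t ≤ M := by
    intro t
    have h1 : (p - 2) * Real.sin t ^ 2 ≤ |p - 2| := by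
      calc (p - 2) * Real.sin t ^ 2 ≤ |p - 2| * Real.sin t ^ 2 := by gcongr; exact le_abs_self _
        _ ≤ |p - 2| * 1 := by gcongr; exact Real.sin_sq_le_one t
        _ = |p - 2| := mul_one _
    have h2 : -(δ * Real.cos t) ≤ |δ| := by
      calc -(δ * Real.cos t) ≤ |δ * Real.cos t| := neg_le_abs _
        _ = |δ| * |Real.cos t| := abs_mul _ _
        _ ≤ |δ| * 1 := by gcongr; exact Real.abs_cos_le_one t
        _ = |δ| := mul_one _
    unfold turning weight
    linarith
  have hMpos : 0 < M := (turning_pos hp hk hδ 0).trans_le (hturn 0)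
  have hlow : ∀ t, m / M ≤ weight p t / turning p k δ t := fun t =>
    div_le_div₀ (weight_pos hp t).le (weight_lower t) (turning_pos hp hk hδ t) (hturn t)
  have hgrow : ∀ x, 0 ≤ x → m / M * x ≤ polarAngle p k δ x := by
    intro x hx
    have h := intervalIntegral.integral_mono_on (μ := volume) (f := fun _ => m / M)
      (g := fun t => weight p t / turning p k δ t) hx (by simp)
      (((continuous_weight p).div (continuous_turning p k δ)
        fun t => (turning_pos hp hk hδ t).ne').intervalIntegrable _ _) fun t _ => hlow t
    rw [intervalIntegral.integral_const, smul_eq_mul, sub_zero, mul_comm] at h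
    exact h
  have hpos : 0 < m / M := div_pos hm hMpos
  intro y
  have hy : |y| ≤ polarAngle p k δ (|y| / (m / M)) := by
    have := hgrow (|y| / (m / M)) (by positivity)
    rwa [mul_div_cancel₀ _ hpos.ne'] at this
  obtain ⟨x, -, hx⟩ := intermediate_value_Icc (a := -(|y| / (m / M))) (b := |y| / (m / M))
    (by have : 0 ≤ |y| / (m / M) := by positivity
        linarith) hcont.continuousOn (show y ∈ _ from ⟨by
      rw [polarAngle_neg]; linarith [neg_abs_le y], by linarith [le_abs_self y]⟩)
  exact ⟨x, hx⟩

/-- There are homogeneous functions `r ^ k * f θ` for which `|∇u|² Δu + (p - 2) ⟨D²u ∇u, ∇u⟩` has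
the sign of a small parameter `δ`, with an explicit formula for the first zero of `f`. -/
theorem exists_profile (hp : 1 < p) (hk : 1 ≤ k) (hδ : |δ| < min 1 (p - 1)) :
    ∃ f f₁ f₂ : ℝ → ℝ, (∀ θ, HasDerivAt f (f₁ θ) θ) ∧ (∀ θ, HasDerivAt f₁ (f₂ θ) θ) ∧
      Continuous f₂ ∧ (∀ θ, 0 < k ^ 2 * f θ ^ 2 + f₁ θ ^ 2) ∧
      (∀ θ, ∃ ρ > 0, angularOperator p k (f θ) (f₁ θ) (f₂ θ) = δ * ρ) ∧
      (∀ θ, |θ| < polarAngle p k δ (Real.pi / 2) → 0 < f θ) ∧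
      ∃ H > polarAngle p k δ (Real.pi / 2), ∀ θ,
        polarAngle p k δ (Real.pi / 2) ≤ |θ| → |θ| ≤ H → f θ ≤ 0 := by
  have hmono := strictMono_polarAngle hp hk hδ
  set e := hmono.orderIsoOfSurjective _ (surjective_polarAngle hp hk hδ) with he
  -- The inverse of the polar angle. The gradient on the unit circle will be `E * (cos Ψ, -sin Ψ)`
  -- in the polar frame, for some positive length `E`.
  set Ψ : ℝ → ℝ := fun θ => e.symm θ with hΨdef
  have hΨ : ∀ θ, polarAngle p k δ (Ψ θ) = θ := fun θ => e.apply_symm_apply θ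
  have hΨcont : Continuous Ψ := e.symm.continuous
  have hturn := turning_pos hp hk hδ
  have hw := weight_pos hp
  have hΨd : ∀ θ, HasDerivAt Ψ (turning p k δ (Ψ θ) / weight p (Ψ θ)) θ := by
    intro θ
    have h := (hasDerivAt_polarAngle hp hk hδ (Ψ θ)).of_local_left_inverse hΨcont.continuousAt
      (div_pos (hw _) (hturn _)).ne' (Filter.Eventually.of_forall hΨ)
    rwa [inv_div] at h
  -- `E * g` is the Laplacian on the unit circle. After division by `E ^ 3` the equation with
  -- right-hand side `δ` reads `g * weight + (p - 2) * (k - 1) * cos = δ`, which is solved here for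
  -- `g`.
  set g : ℝ → ℝ := fun t => (δ - (p - 2) * (k - 1) * Real.cos t) / weight p t with hg
  have hgw : ∀ t, g t * weight p t = δ - (p - 2) * (k - 1) * Real.cos t := fun t =>
    div_mul_cancel₀ _ (hw t).ne'
  have hgcont : Continuous g :=
    (by fun_prop : Continuous fun t => δ - (p - 2) * (k - 1) * Real.cos t).div
      (continuous_weight p) fun t => (hw t).ne'
  have hspeed : ∀ t, turning p k δ t / weight p t = k - Real.cos t * g t := by
    intro t
    rw [div_eq_iff (hw t).ne', sub_mul, mul_assoc, hgw]
    unfold turning weight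
    linear_combination -((k - 1) * (p - 2)) * Real.sin_sq_add_cos_sq t
  -- Compatibility of `f`, `f₁` and `f₂` requires `log E` to have derivative `-sin Ψ * g` in the
  -- polar angle. The last factor converts this to a derivative in the parameter `t`.
  set r : ℝ → ℝ := fun t => -Real.sin t * g t * (weight p t / turning p k δ t) with hr
  have hrcont : Continuous r := by
    refine ((Real.continuous_sin.neg).mul hgcont).mul ?_
    exact (continuous_weight p).div (continuous_turning p k δ) fun t => (hturn t).ne'
  set R : ℝ → ℝ := fun x => ∫ t in (0 : ℝ)..x, r t with hR
  have hRd : ∀ x, HasDerivAt R (r x) x := fun x =>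
    (hrcont.integral_hasStrictDerivAt 0 x).hasDerivAt
  have hkpos : 0 < k := by linarith
  have hE : ∀ θ, HasDerivAt (fun θ => Real.exp (R (Ψ θ)))
      (Real.exp (R (Ψ θ)) * (-Real.sin (Ψ θ) * g (Ψ θ))) θ := by
    intro θ
    convert! ((hRd (Ψ θ)).comp θ (hΨd θ)).exp using 2
    simp only [hr]
    have h1 := (hw (Ψ θ)).ne'
    have h2 := (hturn (Ψ θ)).ne'
    field_simp
  refine ⟨fun θ => Real.exp (R (Ψ θ)) * Real.cos (Ψ θ) / k,
    fun θ => Real.exp (R (Ψ θ)) * -Real.sin (Ψ θ),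
    fun θ => Real.exp (R (Ψ θ)) * (g (Ψ θ) - k * Real.cos (Ψ θ)), ?_, ?_, ?_, ?_, ?_, ?_, ?_⟩
  · intro θ
    have h := ((hE θ).mul (hΨd θ).cos).div_const k
    convert! h using 1
    rw [hspeed]
    field_simp
    ring
  · intro θ
    have h := (hE θ).mul (hΨd θ).sin.neg
    convert! h using 1
    rw [hspeed, Pi.neg_apply]
    linear_combination (-Real.exp (R (Ψ θ)) * g (Ψ θ)) * Real.sin_sq_add_cos_sq (Ψ θ)
  · have hRcont : Continuous R := continuous_iff_continuousAt.2 fun x => (hRd x).continuousAt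
    fun_prop
  · intro θ
    have h1 : k ^ 2 * (Real.exp (R (Ψ θ)) * Real.cos (Ψ θ) / k) ^ 2 +
        (Real.exp (R (Ψ θ)) * -Real.sin (Ψ θ)) ^ 2 = Real.exp (R (Ψ θ)) ^ 2 := by
      field_simp
      linear_combination Real.sin_sq_add_cos_sq (Ψ θ)
    rw [h1]
    positivity
  · intro θ
    refine ⟨Real.exp (R (Ψ θ)) ^ 3, by positivity, ?_⟩
    have h1 := hgw (Ψ θ)
    have h2 := Real.sin_sq_add_cos_sq (Ψ θ)
    unfold weight at h1
    unfold angularOperator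
    set c := Real.cos (Ψ θ)
    set s := Real.sin (Ψ θ)
    set E := Real.exp (R (Ψ θ))
    set y := g (Ψ θ)
    have h3 : k ^ 2 * (E * c / k) ^ 2 = E ^ 2 * c ^ 2 := by field_simp
    have h4 : k ^ 2 * (E * c / k) = k * E * c := by field_simp
    have h5 : k ^ 3 * (k - 1) * (E * c / k) ^ 3 = (k - 1) * E ^ 3 * c ^ 3 := by field_simp
    have h6 : 2 * k * (k - 1) * (E * c / k) = 2 * (k - 1) * E * c := by field_simp
    have h7 : k * (E * c / k) = E * c := by field_simp
    rw [h3, h4, h5, h6, h7]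
    linear_combination E ^ 3 * h1 + (E ^ 3 * y + E ^ 3 * (p - 2) * (k - 1) * c) * h2
  · intro θ hθ
    have h1 := abs_lt.1 hθ
    rw [← polarAngle_neg, ← hΨ θ, hmono.lt_iff_lt, hmono.lt_iff_lt] at h1
    have := Real.cos_pos_of_mem_Ioo h1
    positivity
  -- The cosine stays nonpositive for parameters between `π / 2` and `3 * π / 2`; by symmetry the
  -- same holds on the negative side.
  · refine ⟨polarAngle p k δ (Real.pi + Real.pi / 2), hmono (by linarith [Real.pi_pos]), ?_⟩
    intro θ h1 h2
    have h3 : Real.cos (Ψ θ) ≤ 0 := by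
      rcases abs_cases θ with ⟨h, -⟩ | ⟨h, -⟩
      · rw [h, ← hΨ θ, hmono.le_iff_le] at h1 h2
        exact Real.cos_nonpos_of_pi_div_two_le_of_le h1 h2
      · rw [h, ← hΨ θ, ← polarAngle_neg, hmono.le_iff_le] at h1 h2
        rw [← Real.cos_neg]
        exact Real.cos_nonpos_of_pi_div_two_le_of_le h1 h2
    exact div_nonpos_of_nonpos_of_nonneg
      (mul_nonpos_of_nonneg_of_nonpos (Real.exp_pos _).le h3) hkpos.le

end Profile

/-! ### The critical angle and profiles on either side of it -/

/-- Half of the critical angle. -/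
noncomputable def criticalHalfAngle (p : ℝ) : ℝ := polarAngle p 2 0 (Real.pi / 2)

theorem criticalHalfAngle_pos {p : ℝ} (hp : 1 < p) : 0 < criticalHalfAngle p := by
  have hδ : |(0 : ℝ)| < min 1 (p - 1) := by
    rw [abs_zero]; exact lt_min one_pos (by linarith)
  have h := strictMono_polarAngle hp one_le_two hδ
    (show (0 : ℝ) < Real.pi / 2 by linarith [Real.pi_pos])
  rwa [show polarAngle p 2 0 0 = 0 by simp [polarAngle]] at h

/-- Quantitative continuity of the first zero of the profile at degree `2` and `δ = 0`. The
difference of the integrands is the critical integrand, at most `1`, times the relative change of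
`turning`, whose denominator is at least `min 1 (p - 1) / 2`. -/
theorem abs_polarAngle_sub_le {p k δ : ℝ} (hp : 1 < p) (hk : 1 ≤ k) (hk2 : k ≤ 2)
    (hδ : |δ| ≤ min 1 (p - 1) / 2) :
    |polarAngle p k δ (Real.pi / 2) - criticalHalfAngle p| ≤
      ((2 - k) * (p - 1) + |δ|) / (min 1 (p - 1) / 2) * (Real.pi / 2) := by
  set m := min 1 (p - 1)
  have hm : 0 < m := lt_min one_pos (by linarith)
  have hδ' : |δ| < m := by linarith
  have h0 : |(0 : ℝ)| < m := by rwa [abs_zero]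
  have hc1 : Continuous fun t => weight p t / turning p k δ t :=
    (continuous_weight p).div (continuous_turning p k δ) fun t => (turning_pos hp hk hδ' t).ne'
  have hc2 : Continuous fun t => weight p t / turning p 2 0 t :=
    (continuous_weight p).div (continuous_turning p 2 0)
      fun t => (turning_pos hp one_le_two h0 t).ne'
  unfold criticalHalfAngle polarAngle
  rw [← intervalIntegral.integral_sub (hc1.intervalIntegrable _ _) (hc2.intervalIntegrable _ _)]
  have h := intervalIntegral.norm_integral_le_of_norm_le_const (a := 0) (b := Real.pi / 2)
    (f := fun t => weight p t / turning p k δ t - weight p t / turning p 2 0 t)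
    (C := ((2 - k) * (p - 1) + |δ|) / (m / 2)) (fun t _ => by
      have ht1 : m / 2 ≤ turning p k δ t :=
        le_trans (by linarith) (turning_lower hp hk t)
      have hw := weight_pos hp t
      have ht2 : weight p t ≤ turning p 2 0 t := by unfold turning; linarith
      have ht1p : 0 < turning p k δ t := by linarith
      have ht2p : 0 < turning p 2 0 t := by linarith
      have hdiff : |turning p 2 0 t - turning p k δ t| ≤ (2 - k) * (p - 1) + |δ| := by
        have : turning p 2 0 t - turning p k δ t = (2 - k) * (p - 1) + δ * Real.cos t := by
          unfold turning; ring
        rw [this]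
        refine (abs_add_le _ _).trans (add_le_add (le_of_eq (abs_of_nonneg
          (mul_nonneg (by linarith) (by linarith)))) ?_)
        rw [abs_mul]
        exact mul_le_of_le_one_right (abs_nonneg _) (Real.abs_cos_le_one t)
      have heq : weight p t / turning p k δ t - weight p t / turning p 2 0 t =
          (weight p t / turning p 2 0 t) *
            ((turning p 2 0 t - turning p k δ t) / turning p k δ t) := by
        field_simp
      rw [heq, Real.norm_eq_abs, abs_mul, abs_div (turning p 2 0 t - _), abs_of_pos ht1p,
        abs_of_pos (div_pos hw ht2p)]
      calc weight p t / turning p 2 0 t * (|turning p 2 0 t - turning p k δ t| / turning p k δ t)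
          ≤ 1 * (((2 - k) * (p - 1) + |δ|) / (m / 2)) := by
            refine mul_le_mul ((div_le_one ht2p).2 ht2) ?_ (by positivity) zero_le_one
            exact div_le_div₀ ((abs_nonneg _).trans hdiff) hdiff (by linarith) ht1
        _ = _ := one_mul _)
  rwa [Real.norm_eq_abs, sub_zero, abs_of_pos (by linarith [Real.pi_pos] : 0 < Real.pi / 2)] at h

/-- For degree `2` and `δ = 0` the denominator is `p - 1` plus the weight, so the integrand is at
most `1`. In particular every subcritical wedge has angle below `π`. -/
theorem criticalHalfAngle_le {p : ℝ} (hp : 1 < p) : criticalHalfAngle p ≤ Real.pi / 2 := by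
  have h0 : |(0 : ℝ)| < min 1 (p - 1) := by
    rw [abs_zero]; exact lt_min one_pos (by linarith)
  have h := intervalIntegral.norm_integral_le_of_norm_le_const (a := 0) (b := Real.pi / 2)
    (f := fun t => weight p t / turning p 2 0 t) (C := 1) (fun t _ => by
      have hw := weight_pos hp t
      have ht2 : weight p t ≤ turning p 2 0 t := by unfold turning; linarith
      rw [Real.norm_eq_abs, abs_of_pos (div_pos hw (hw.trans_le ht2))]
      exact (div_le_one (hw.trans_le ht2)).2 ht2)
  rw [Real.norm_eq_abs, sub_zero, abs_of_pos (by linarith [Real.pi_pos] : 0 < Real.pi / 2)] at h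
  rw [one_mul] at h
  exact (le_abs_self _).trans h

/-- For every angle below the critical one there is a strict supersolution of degree `2`. -/
theorem exists_superprofile {p h : ℝ} (hp : 1 < p) (hh : h < criticalHalfAngle p) :
    ∃ f f₁ f₂ : ℝ → ℝ, (∀ θ, HasDerivAt f (f₁ θ) θ) ∧ (∀ θ, HasDerivAt f₁ (f₂ θ) θ) ∧
      Continuous f₂ ∧ (∀ θ, 0 < (2 : ℝ) ^ 2 * f θ ^ 2 + f₁ θ ^ 2) ∧
      (∀ θ, angularOperator p 2 (f θ) (f₁ θ) (f₂ θ) < 0) ∧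
      ∃ h' > h, h' < Real.pi ∧ ∀ θ, |θ| ≤ h' → 0 < f θ := by
  set m := min 1 (p - 1) with hmdef
  have hm : 0 < m := lt_min one_pos (by linarith)
  set d := criticalHalfAngle p - h with hd
  have hdpos : 0 < d := sub_pos.2 hh
  have hπ := Real.pi_pos
  -- The first bound keeps `turning` positive; the second one moves the zero of the profile by at
  -- most half the gap `d`. The parameter is used as `-δ`, to make the operator negative.
  set δ := min (m / 2) (m / 2 * d / Real.pi) with hδ
  have hδpos : 0 < δ := lt_min (by linarith) (by positivity)
  have hδabs : |(-δ)| = δ := by rw [abs_neg, abs_of_pos hδpos]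
  have h1 := abs_polarAngle_sub_le hp one_le_two le_rfl (δ := -δ)
    (by rw [hδabs]; exact min_le_left _ _)
  rw [hδabs, sub_self, zero_mul, zero_add] at h1
  have h2 : δ / (m / 2) * (Real.pi / 2) ≤ d / 2 := by
    calc δ / (m / 2) * (Real.pi / 2) ≤ (m / 2 * d / Real.pi) / (m / 2) * (Real.pi / 2) := by
          gcongr; exact min_le_right _ _
      _ = d / 2 := by field_simp
  have hH : h < polarAngle p 2 (-δ) (Real.pi / 2) := by
    have := (abs_le.1 (h1.trans h2)).1
    linarith
  obtain ⟨f, f₁, f₂, hf, hf₁, hf₂, hpos, hG, hfpos, -⟩ := exists_profile hp one_le_two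
    (δ := -δ) (by rw [hδabs]; exact (min_le_left _ _).trans_lt (by linarith))
  obtain ⟨h', hh', hh''⟩ := exists_between (lt_min hH
    (show h < Real.pi by linarith [criticalHalfAngle_le hp]))
  refine ⟨f, f₁, f₂, hf, hf₁, hf₂, hpos, fun θ => ?_, h', hh', hh''.trans_le (min_le_right _ _),
    fun θ hθ => hfpos θ (hθ.trans_lt (hh''.trans_le (min_le_left _ _)))⟩
  obtain ⟨ρ, hρ, h3⟩ := hG θ
  rw [h3]
  nlinarith

/-- For every angle above the critical one there is a strict subsolution of degree below `2` which
is positive exactly in a slightly smaller sector. -/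
theorem exists_subprofile {p h : ℝ} (hp : 1 < p) (hh : criticalHalfAngle p < h) :
    ∃ (k : ℝ) (f f₁ f₂ : ℝ → ℝ), 1 ≤ k ∧ k < 2 ∧
      (∀ θ, HasDerivAt f (f₁ θ) θ) ∧ (∀ θ, HasDerivAt f₁ (f₂ θ) θ) ∧
      Continuous f₂ ∧ (∀ θ, 0 < k ^ 2 * f θ ^ 2 + f₁ θ ^ 2) ∧
      (∀ θ, 0 < angularOperator p k (f θ) (f₁ θ) (f₂ θ)) ∧
      ∃ h₀ h', 0 < h₀ ∧ h₀ < h' ∧ h' < h ∧ (∀ θ, |θ| < h₀ → 0 < f θ) ∧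
        ∀ θ, h₀ ≤ |θ| → |θ| ≤ h' → f θ ≤ 0 := by
  set m := min 1 (p - 1) with hmdef
  have hm : 0 < m := lt_min one_pos (by linarith)
  have hm1 : m ≤ 1 := min_le_left _ _
  have hm2 : m ≤ p - 1 := min_le_right _ _
  set d := h - criticalHalfAngle p with hd
  have hdpos : 0 < d := sub_pos.2 hh
  have hπ := Real.pi_pos
  -- One parameter serves twice: it lowers the degree to `2 - δ` and makes the operator positive.
  -- Together these change `turning` by at most `δ * p`, hence the factor `p` in the denominator.
  set δ := min (m / 2) (m / 2 * d / (Real.pi * p)) with hδ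
  have hδpos : 0 < δ := lt_min (by linarith) (by positivity)
  have hδm : δ ≤ m / 2 := min_le_left _ _
  have hδabs : |δ| = δ := abs_of_pos hδpos
  have hk : 1 ≤ 2 - δ := by linarith
  have h1 := abs_polarAngle_sub_le hp hk (by linarith) (δ := δ) (by rw [hδabs]; exact hδm)
  have h2 : ((2 - (2 - δ)) * (p - 1) + |δ|) / (m / 2) * (Real.pi / 2) ≤ d / 2 := by
    rw [hδabs]
    calc ((2 - (2 - δ)) * (p - 1) + δ) / (m / 2) * (Real.pi / 2)
        = δ * p / (m / 2) * (Real.pi / 2) := by ring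
      _ ≤ (m / 2 * d / (Real.pi * p)) * p / (m / 2) * (Real.pi / 2) := by
          gcongr; exact min_le_right _ _
      _ = d / 2 := by field_simp
  have hδ' : |δ| < m := by rw [hδabs]; linarith
  have hH : polarAngle p (2 - δ) δ (Real.pi / 2) < h := by
    have := (abs_le.1 (h1.trans h2)).2
    linarith
  obtain ⟨f, f₁, f₂, hf, hf₁, hf₂, hpos, hG, hfpos, H, hH1, hH2⟩ := exists_profile hp hk hδ'
  obtain ⟨h', hh', hh''⟩ := exists_between (lt_min hH hH1)
  refine ⟨2 - δ, f, f₁, f₂, hk, by linarith, hf, hf₁, hf₂, hpos, fun θ => ?_,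
    polarAngle p (2 - δ) δ (Real.pi / 2), h', ?_, hh', hh''.trans_le (min_le_left _ _), hfpos,
    fun θ h3 h4 => hH2 θ h3 (h4.trans (hh''.trans_le (min_le_right _ _)).le)⟩
  · obtain ⟨ρ, hρ, h3⟩ := hG θ
    rw [h3]
    positivity
  · have h := strictMono_polarAngle hp hk hδ' (show (0 : ℝ) < Real.pi / 2 by linarith)
    rwa [show polarAngle p (2 - δ) δ 0 = 0 by simp [polarAngle]] at h

/-! ### Second order expansion of homogeneous functions -/

/-- The function `r ^ k * f θ` on the complex plane. -/
noncomputable def homog (k : ℝ) (f : ℝ → ℝ) (x : ℂ) : ℝ :=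
  Real.exp (k * (Complex.log x).re) * f (Complex.log x).im

/-- The gradient of `r ^ k * f θ` on the unit circle, in the polar frame. -/
noncomputable def polarGrad (k : ℝ) (f f₁ : ℝ → ℝ) (θ : ℝ) : ℂ := ⟨k * f θ, f₁ θ⟩

/-- A real quadratic form on the complex plane. -/
noncomputable def quadForm (a : ℝ) (b y : ℂ) : ℝ := a * ‖y‖ ^ 2 + (b * y ^ 2).re

/-- The isotropic part of the Hessian of `r ^ k * f θ` on the unit circle. -/
noncomputable def hessIso (k : ℝ) (f f₂ : ℝ → ℝ) (θ : ℝ) : ℝ := (k ^ 2 * f θ + f₂ θ) / 2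

/-- The anisotropic part of the Hessian of `r ^ k * f θ` on the unit circle, in the polar frame. -/
noncomputable def hessAniso (k : ℝ) (f f₁ f₂ : ℝ → ℝ) (θ : ℝ) : ℂ :=
  ⟨(k * (k - 2) * f θ - f₂ θ) / 2, -((k - 1) * f₁ θ)⟩

theorem normSq_polarGrad (k : ℝ) (f f₁ : ℝ → ℝ) (θ : ℝ) :
    ‖polarGrad k f f₁ θ‖ ^ 2 = k ^ 2 * f θ ^ 2 + f₁ θ ^ 2 := by
  rw [← Complex.normSq_eq_norm_sq, Complex.normSq_apply]
  simp [polarGrad]; ring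

/-- The link between game and equation: averaging over the noise multiplies the isotropic and
anisotropic parts of the Hessian by `p` and `p - 2`, up to the factor `C₂₂`. At the gradient the
resulting form is the operator. -/
theorem quadForm_polarGrad (p k : ℝ) (f f₁ f₂ : ℝ → ℝ) (θ : ℝ) :
    quadForm (p * hessIso k f f₂ θ) ((p - 2 : ℝ) * hessAniso k f f₁ f₂ θ) (polarGrad k f f₁ θ) =
      angularOperator p k (f θ) (f₁ θ) (f₂ θ) := by
  unfold quadForm
  rw [normSq_polarGrad, sq (polarGrad k f f₁ θ)]
  simp only [hessIso, hessAniso, polarGrad, angularOperator, Complex.mul_re, Complex.mul_im,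
    Complex.ofReal_re, Complex.ofReal_im]
  ring

theorem quadForm_sub_le (a : ℝ) (b y z : ℂ) :
    |quadForm a b y - quadForm a b z| ≤ (|a| + ‖b‖) * (‖y - z‖ * (‖y‖ + ‖z‖)) := by
  have h1 : |a * ‖y‖ ^ 2 - a * ‖z‖ ^ 2| ≤ |a| * (‖y - z‖ * (‖y‖ + ‖z‖)) := by
    rw [← mul_sub, abs_mul]
    gcongr
    rw [sq_sub_sq, abs_mul, mul_comm, abs_of_nonneg (by positivity : 0 ≤ ‖y‖ + ‖z‖)]
    gcongr
    exact abs_norm_sub_norm_le y z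
  have h2 : |(b * y ^ 2).re - (b * z ^ 2).re| ≤ ‖b‖ * (‖y - z‖ * (‖y‖ + ‖z‖)) := by
    rw [← Complex.sub_re]
    refine (Complex.abs_re_le_norm _).trans ?_
    rw [show b * y ^ 2 - b * z ^ 2 = b * ((y - z) * (y + z)) by ring, norm_mul, norm_mul]
    gcongr
    exact norm_add_le y z
  unfold quadForm
  rw [add_sub_add_comm, add_mul]
  exact (abs_add_le _ _).trans (add_le_add h1 h2)

theorem quadForm_ofReal_mul (a : ℝ) (b y : ℂ) (t : ℝ) :
    quadForm a b (t * y) = t ^ 2 * quadForm a b y := by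
  unfold quadForm
  rw [norm_mul, mul_pow, mul_pow, Complex.norm_real, Real.norm_eq_abs, sq_abs, mul_add,
    show b * ((t : ℂ) ^ 2 * y ^ 2) = ((t ^ 2 : ℝ) : ℂ) * (b * y ^ 2) by push_cast; ring,
    Complex.re_ofReal_mul]
  ring

theorem quadForm_neg (a : ℝ) (b y : ℂ) : quadForm a b (-y) = quadForm a b y := by
  unfold quadForm
  rw [norm_neg, neg_sq]

theorem homog_ofReal_mul (k : ℝ) (f : ℝ → ℝ) {r : ℝ} (hr : 0 < r) {x : ℂ} (hx : x ≠ 0) :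
    homog k f (r * x) = Real.exp (k * Real.log r) * homog k f x := by
  unfold homog
  rw [Complex.log_ofReal_mul hr hx, Complex.add_re, Complex.add_im, Complex.ofReal_re,
    Complex.ofReal_im, zero_add, mul_add, Real.exp_add, mul_assoc]

section Taylor

variable {k : ℝ} {f f₁ f₂ : ℝ → ℝ}

/-- In the chart `Complex.log` the function is `exp (k * s) * f θ`, and the velocity along the line
is `w / (x + t * w)`, with radial and angular components as real and imaginary parts. -/
theorem hasDerivAt_homog_line (hf : ∀ θ, HasDerivAt f (f₁ θ) θ) (x w : ℂ) (t : ℝ)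
    (ht : x + t * w ∈ Complex.slitPlane) :
    HasDerivAt (fun s : ℝ => homog k f (x + s * w))
      (Real.exp (k * (Complex.log (x + t * w)).re) *
        (k * f (Complex.log (x + t * w)).im * (w / (x + t * w)).re +
          f₁ (Complex.log (x + t * w)).im * (w / (x + t * w)).im)) t := by
  have h1 : HasDerivAt (fun s : ℝ => x + s * w) w t := by
    have := ((Complex.ofRealCLM.hasDerivAt (x := t)).mul_const w).const_add x
    simpa using this
  have h2 := h1.clog_real ht
  have hre : HasDerivAt (fun s : ℝ => (Complex.log (x + s * w)).re) (w / (x + t * w)).re t :=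
    Complex.reCLM.hasFDerivAt.comp_hasDerivAt t h2
  have him : HasDerivAt (fun s : ℝ => (Complex.log (x + s * w)).im) (w / (x + t * w)).im t :=
    Complex.imCLM.hasFDerivAt.comp_hasDerivAt t h2
  have h3 := (hre.const_mul k).exp.mul ((hf _).comp t him)
  convert! h3 using 1
  simp only [Function.comp_apply]
  ring

/-- The velocity `ω = w / (x + t * w)` satisfies `ω' = -ω ^ 2`, so the product rule leaves only
quadratic terms in `ω`. Sorting them by `‖ω‖ ^ 2` and `ω ^ 2` gives the two parts of the Hessian. -/
theorem hasDerivAt_homog_line₂ (hf : ∀ θ, HasDerivAt f (f₁ θ) θ) (hf₁ : ∀ θ, HasDerivAt f₁ (f₂ θ) θ)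
    (x w : ℂ) (t : ℝ) (ht : x + t * w ∈ Complex.slitPlane) :
    HasDerivAt (fun s : ℝ => Real.exp (k * (Complex.log (x + s * w)).re) *
        (k * f (Complex.log (x + s * w)).im * (w / (x + s * w)).re +
          f₁ (Complex.log (x + s * w)).im * (w / (x + s * w)).im))
      (Real.exp (k * (Complex.log (x + t * w)).re) *
        quadForm (hessIso k f f₂ (Complex.log (x + t * w)).im)
          (hessAniso k f f₁ f₂ (Complex.log (x + t * w)).im) (w / (x + t * w))) t := by
  have h1 : HasDerivAt (fun s : ℝ => x + s * w) w t := by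
    have := ((Complex.ofRealCLM.hasDerivAt (x := t)).mul_const w).const_add x
    simpa using this
  have h2 := h1.clog_real ht
  have hre : HasDerivAt (fun s : ℝ => (Complex.log (x + s * w)).re) (w / (x + t * w)).re t :=
    Complex.reCLM.hasFDerivAt.comp_hasDerivAt t h2
  have him : HasDerivAt (fun s : ℝ => (Complex.log (x + s * w)).im) (w / (x + t * w)).im t :=
    Complex.imCLM.hasFDerivAt.comp_hasDerivAt t h2
  have hne : x + t * w ≠ 0 := Complex.slitPlane_ne_zero ht
  have hω : HasDerivAt (fun s : ℝ => w / (x + s * w)) (-(w / (x + t * w)) ^ 2) t := by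
    have := (hasDerivAt_const t w).div h1 hne
    convert! this using 1
    field_simp
    ring
  have hωre : HasDerivAt (fun s : ℝ => (w / (x + s * w)).re) (-(w / (x + t * w)) ^ 2).re t :=
    Complex.reCLM.hasFDerivAt.comp_hasDerivAt t hω
  have hωim : HasDerivAt (fun s : ℝ => (w / (x + s * w)).im) (-(w / (x + t * w)) ^ 2).im t :=
    Complex.imCLM.hasFDerivAt.comp_hasDerivAt t hω
  have h3 := (hre.const_mul k).exp.mul
    (((((hf _).comp t him).const_mul k).mul hωre).add (((hf₁ _).comp t him).mul hωim))
  convert! h3 using 1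
  simp only [Function.comp_apply, Pi.add_apply, Pi.mul_apply]
  unfold quadForm hessIso hessAniso
  rw [← Complex.normSq_eq_norm_sq, Complex.normSq_apply]
  simp only [sq, Complex.mul_re, Complex.mul_im, Complex.neg_re, Complex.neg_im]
  ring

/-- Compactness is the source of uniformity in the expansions; `h < π` keeps the arc off the branch
cut of the logarithm. -/
theorem isCompact_arc {h : ℝ} (hh : h < Real.pi) :
    IsCompact {x : ℂ | ‖x‖ = 1 ∧ |x.arg| ≤ h} ∧
      {x : ℂ | ‖x‖ = 1 ∧ |x.arg| ≤ h} ⊆ Complex.slitPlane := by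
  constructor
  · have h1 : {x : ℂ | ‖x‖ = 1 ∧ |x.arg| ≤ h} = (fun θ : ℝ => Complex.exp (θ * Complex.I)) ''
        Icc (-h) h := by
      ext x
      constructor
      · rintro ⟨h1, h2⟩
        refine ⟨x.arg, abs_le.1 h2, ?_⟩
        have := Complex.norm_mul_exp_arg_mul_I x
        rwa [h1, Complex.ofReal_one, one_mul] at this
      · rintro ⟨θ, hθ, rfl⟩
        refine ⟨Complex.norm_exp_ofReal_mul_I θ, ?_⟩
        rw [Complex.arg_exp_mul_I, (toIocMod_eq_self Real.two_pi_pos).2]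
        · exact abs_le.2 hθ
        · exact ⟨by linarith [hθ.1], by linarith [hθ.2]⟩
    rw [h1]
    exact isCompact_Icc.image (by fun_prop)
  · rintro x ⟨h1, h2⟩
    rw [Complex.mem_slitPlane_iff_arg]
    refine ⟨fun h3 => ?_, fun h3 => ?_⟩
    · rw [h3, abs_of_pos Real.pi_pos] at h2
      linarith
    · rw [h3, norm_zero] at h1
      exact zero_ne_one h1

theorem homog_taylor_arc (hf : ∀ θ, HasDerivAt f (f₁ θ) θ) (hf₁ : ∀ θ, HasDerivAt f₁ (f₂ θ) θ)
    (hf₂ : Continuous f₂) {h : ℝ} (hh : h < Real.pi) {κ : ℝ} (hκ : 0 < κ) :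
    ∃ δ > 0, ∀ x : ℂ, ‖x‖ = 1 → |x.arg| ≤ h → ∀ w : ℂ, ‖w‖ ≤ δ →
      |homog k f (x + w) - (homog k f x + (starRingEnd ℂ (polarGrad k f f₁ x.arg) * (w / x)).re +
        quadForm (hessIso k f f₂ x.arg) (hessAniso k f f₁ f₂ x.arg) (w / x) / 2)| ≤
        κ * ‖w‖ ^ 2 := by
  obtain ⟨hK, hKs⟩ := isCompact_arc hh
  set K := {x : ℂ | ‖x‖ = 1 ∧ |x.arg| ≤ h}
  have hfc : Continuous f := continuous_iff_continuousAt.2 fun θ => (hf θ).continuousAt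
  have hf₁c : Continuous f₁ := continuous_iff_continuousAt.2 fun θ => (hf₁ θ).continuousAt
  -- The second derivative along a line is `A * ‖w‖ ^ 2 + (B * w ^ 2).re`, with coefficients that
  -- depend on the base point only. Their uniform continuity near the arc bounds its oscillation by
  -- `κ * ‖w‖ ^ 2` for all directions at once.
  set A : ℂ → ℝ := fun y =>
    Real.exp (k * (Complex.log y).re) * hessIso k f f₂ (Complex.log y).im / ‖y‖ ^ 2 with hA
  set B : ℂ → ℂ := fun y =>
    Real.exp (k * (Complex.log y).re) * hessAniso k f f₁ f₂ (Complex.log y).im / y ^ 2 with hB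
  have hiso : Continuous (hessIso k f f₂) := by unfold hessIso; fun_prop
  have haniso : Continuous (hessAniso k f f₁ f₂) := by
    have : hessAniso k f f₁ f₂ = fun θ => (((k * (k - 2) * f θ - f₂ θ) / 2 : ℝ) : ℂ) +
        ((-((k - 1) * f₁ θ) : ℝ) : ℂ) * Complex.I := by
      funext θ
      exact Complex.mk_eq_add_mul_I _ _
    rw [this]
    fun_prop
  have hre : ∀ y ∈ Complex.slitPlane, ContinuousAt (fun y => (Complex.log y).re) y := fun y hy =>
    Complex.continuous_re.continuousAt.comp (continuousAt_clog hy)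
  have him : ∀ y ∈ Complex.slitPlane, ContinuousAt (fun y => (Complex.log y).im) y := fun y hy =>
    Complex.continuous_im.continuousAt.comp (continuousAt_clog hy)
  have hexp : ∀ y ∈ Complex.slitPlane,
      ContinuousAt (fun y => Real.exp (k * (Complex.log y).re)) y := fun y hy =>
    Real.continuous_exp.continuousAt.comp (continuousAt_const.mul (hre y hy))
  have hAc : ∀ y ∈ Complex.slitPlane, ContinuousAt A y := by
    intro y hy
    refine ((hexp y hy).mul (hiso.continuousAt.comp (him y hy))).div
      (by fun_prop) ?_
    exact pow_ne_zero _ (norm_ne_zero_iff.2 (Complex.slitPlane_ne_zero hy))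
  have hBc : ∀ y ∈ Complex.slitPlane, ContinuousAt B y := by
    intro y hy
    refine ((Complex.continuous_ofReal.continuousAt.comp (hexp y hy)).mul
      (haniso.continuousAt.comp (him y hy))).div (by fun_prop) ?_
    exact pow_ne_zero _ (Complex.slitPlane_ne_zero hy)
  have huA := hK.uniformContinuousAt_of_continuousAt A (fun y hy => hAc y (hKs hy))
    (Metric.dist_mem_uniformity (half_pos hκ))
  have huB := hK.uniformContinuousAt_of_continuousAt B (fun y hy => hBc y (hKs hy))
    (Metric.dist_mem_uniformity (half_pos hκ))
  obtain ⟨δA, hδA, hA'⟩ := Metric.mem_uniformity_dist.1 huA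
  obtain ⟨δB, hδB, hB'⟩ := Metric.mem_uniformity_dist.1 huB
  obtain ⟨δ₀, hδ₀, h0⟩ := hK.exists_thickening_subset_open Complex.isOpen_slitPlane hKs
  set δ := min δ₀ (min δA δB) / 2 with hδdef
  have hmin : 0 < min δ₀ (min δA δB) := lt_min hδ₀ (lt_min hδA hδB)
  have hδpos : 0 < δ := half_pos hmin
  have hδlt : δ < min δ₀ (min δA δB) := half_lt_self hmin
  refine ⟨δ, hδpos, fun x hx1 hx2 w hw => ?_⟩
  have hxK : x ∈ K := ⟨hx1, hx2⟩
  have hdist : ∀ t ∈ Icc (0 : ℝ) 1, dist x (x + t * w) < min δ₀ (min δA δB) := by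
    intro t ht
    rw [dist_self_add_right, norm_mul, Complex.norm_real, Real.norm_eq_abs, abs_of_nonneg ht.1]
    calc t * ‖w‖ ≤ 1 * ‖w‖ := by gcongr; exact ht.2
      _ ≤ δ := by rwa [one_mul]
      _ < _ := hδlt
  have hslit : ∀ t ∈ Icc (0 : ℝ) 1, x + t * w ∈ Complex.slitPlane := by
    intro t ht
    refine h0 (Metric.mem_thickening_iff.2 ⟨x, hxK, ?_⟩)
    rw [dist_comm]
    exact (hdist t ht).trans_le (min_le_left _ _)
  set g : ℝ → ℝ := fun s => homog k f (x + s * w) with hg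
  set g' : ℝ → ℝ := fun s => Real.exp (k * (Complex.log (x + s * w)).re) *
        (k * f (Complex.log (x + s * w)).im * (w / (x + s * w)).re +
          f₁ (Complex.log (x + s * w)).im * (w / (x + s * w)).im) with hg'
  set g'' : ℝ → ℝ := fun t => Real.exp (k * (Complex.log (x + t * w)).re) *
        quadForm (hessIso k f f₂ (Complex.log (x + t * w)).im)
          (hessAniso k f f₁ f₂ (Complex.log (x + t * w)).im) (w / (x + t * w)) with hg''
  have hgAB : ∀ t ∈ Icc (0 : ℝ) 1, g'' t = A (x + t * w) * ‖w‖ ^ 2 + (B (x + t * w) * w ^ 2).re := by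
    intro t ht
    have hne := Complex.slitPlane_ne_zero (hslit t ht)
    simp only [hg'', hA, hB, quadForm]
    rw [norm_div, div_pow, div_pow, mul_add, ← Complex.re_ofReal_mul (Real.exp _)]
    congr 1
    · ring
    · congr 1
      ring
  have hg''bd : ∀ t ∈ Icc (0 : ℝ) 1, |g'' t - g'' 0| ≤ κ * ‖w‖ ^ 2 := by
    intro t ht
    have h00 : (0 : ℝ) ∈ Icc (0 : ℝ) 1 := ⟨le_rfl, zero_le_one⟩
    have e1 : dist (A x) (A (x + t * w)) < κ / 2 :=
      hA' ((hdist t ht).trans_le ((min_le_right _ _).trans (min_le_left _ _))) hxK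
    have e2 : dist (B x) (B (x + t * w)) < κ / 2 :=
      hB' ((hdist t ht).trans_le ((min_le_right _ _).trans (min_le_right _ _))) hxK
    rw [hgAB t ht, hgAB 0 h00]
    simp only [Complex.ofReal_zero, zero_mul, add_zero]
    rw [add_sub_add_comm, ← sub_mul, ← Complex.sub_re, ← sub_mul]
    refine (abs_add_le _ _).trans ?_
    rw [abs_mul, abs_of_nonneg (by positivity : 0 ≤ ‖w‖ ^ 2)]
    have e3 : |A (x + t * w) - A x| ≤ κ / 2 := by
      rw [← Real.dist_eq, dist_comm]; exact e1.le
    have e4 : ‖B (x + t * w) - B x‖ ≤ κ / 2 := by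
      rw [← dist_eq_norm, dist_comm]; exact e2.le
    have e5 : |((B (x + t * w) - B x) * w ^ 2).re| ≤ κ / 2 * ‖w‖ ^ 2 := by
      refine (Complex.abs_re_le_norm _).trans ?_
      rw [norm_mul, norm_pow]
      gcongr
    calc _ ≤ κ / 2 * ‖w‖ ^ 2 + κ / 2 * ‖w‖ ^ 2 := by gcongr
      _ = _ := by ring
  have hconv : Convex ℝ (Icc (0 : ℝ) 1) := convex_Icc 0 1
  have h00 : (0 : ℝ) ∈ Icc (0 : ℝ) 1 := ⟨le_rfl, zero_le_one⟩
  have h11 : (1 : ℝ) ∈ Icc (0 : ℝ) 1 := ⟨zero_le_one, le_rfl⟩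
  -- The oscillation bound is integrated twice with the mean value inequality. The factor `1 / 2`
  -- that a sharper remainder would give is not needed.
  have hE' : ∀ t ∈ Icc (0 : ℝ) 1, |g' t - g' 0 - t * g'' 0| ≤ κ * ‖w‖ ^ 2 := by
    intro t ht
    have h1 := hconv.norm_image_sub_le_of_norm_hasDerivWithin_le (𝕜 := ℝ)
      (f := fun s => g' s - s * g'' 0) (f' := fun s => g'' s - 1 * g'' 0) (C := κ * ‖w‖ ^ 2)
      (fun s hs => (((hasDerivAt_homog_line₂ hf hf₁ x w s (hslit s hs))).sub
        ((hasDerivAt_id s).mul_const (g'' 0))).hasDerivWithinAt)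
      (fun s hs => by rw [one_mul]; exact hg''bd s hs) h00 ht
    simp only [zero_mul, sub_zero, Real.norm_eq_abs] at h1
    calc |g' t - g' 0 - t * g'' 0| = |g' t - t * g'' 0 - g' 0| := by ring_nf
      _ ≤ κ * ‖w‖ ^ 2 * |t| := h1
      _ ≤ κ * ‖w‖ ^ 2 * 1 := by gcongr; rw [abs_of_nonneg ht.1]; exact ht.2
      _ = _ := mul_one _
  have h1 := hconv.norm_image_sub_le_of_norm_hasDerivWithin_le (𝕜 := ℝ)
      (f := fun s => g s - s * g' 0 - s ^ 2 * (g'' 0 / 2))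
      (f' := fun s => g' s - g' 0 - s * g'' 0) (C := κ * ‖w‖ ^ 2)
      (fun s hs => by
        have := (((hasDerivAt_homog_line (k := k) hf x w s (hslit s hs))).sub
          ((hasDerivAt_id s).mul_const (g' 0))).sub ((hasDerivAt_pow 2 s).mul_const (g'' 0 / 2))
        refine HasDerivAt.hasDerivWithinAt ?_
        convert! this using 1
        simp only [hg']
        ring) hE' h00 h11
  have e1 : g 1 = homog k f (x + w) := by simp [hg]
  have e0 : g 0 = homog k f x := by simp [hg]
  have hlogre : (Complex.log x).re = 0 := by rw [Complex.log_re, hx1, Real.log_one]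
  have e2 : g' 0 = (starRingEnd ℂ (polarGrad k f f₁ x.arg) * (w / x)).re := by
    simp only [hg', Complex.ofReal_zero, zero_mul, add_zero, hlogre, mul_zero, Real.exp_zero,
      one_mul, Complex.log_im, polarGrad, Complex.mul_re, Complex.conj_re, Complex.conj_im]
    ring
  have e3 : g'' 0 = quadForm (hessIso k f f₂ x.arg) (hessAniso k f f₁ f₂ x.arg) (w / x) := by
    simp only [hg'', Complex.ofReal_zero, zero_mul, add_zero, hlogre, mul_zero, Real.exp_zero,
      one_mul, Complex.log_im]
  rw [e1, e0, e2, e3, Real.norm_eq_abs] at h1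
  simp only [sub_zero, mul_one, zero_mul, norm_one, one_mul, one_pow,
    ne_eq, OfNat.ofNat_ne_zero, not_false_eq_true, zero_pow] at h1
  calc _ = _ := by
        congr 1
        ring
    _ ≤ _ := h1

/-- Second order Taylor expansion of a homogeneous function, uniformly in a sector. -/
theorem homog_taylor (hf : ∀ θ, HasDerivAt f (f₁ θ) θ) (hf₁ : ∀ θ, HasDerivAt f₁ (f₂ θ) θ)
    (hf₂ : Continuous f₂) {h : ℝ} (hh : h < Real.pi) {κ : ℝ} (hκ : 0 < κ) :
    ∃ δ > 0, ∀ x : ℂ, x ≠ 0 → |x.arg| ≤ h → ∀ y : ℂ, ‖y‖ ≤ δ * ‖x‖ →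
      |homog k f (x + x / ‖x‖ * y) - (homog k f x + Real.exp (k * Real.log ‖x‖) *
        ((starRingEnd ℂ (polarGrad k f f₁ x.arg) * y).re / ‖x‖ +
        quadForm (hessIso k f f₂ x.arg) (hessAniso k f f₁ f₂ x.arg) y / ‖x‖ ^ 2 / 2))| ≤
        κ * (Real.exp (k * Real.log ‖x‖) * (‖y‖ ^ 2 / ‖x‖ ^ 2)) := by
  obtain ⟨δ₀, hδ₀, H⟩ := homog_taylor_arc (k := k) hf hf₁ hf₂ hh hκ
  -- The bound `1 / 2` keeps the displaced point away from the origin, where homogeneity fails.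
  refine ⟨min δ₀ (1 / 2), lt_min hδ₀ (by norm_num), fun x hx harg y hy => ?_⟩
  have hr : 0 < ‖x‖ := norm_pos_iff.2 hx
  have hrc : (‖x‖ : ℂ) ≠ 0 := Complex.ofReal_ne_zero.2 hr.ne'
  set e : ℂ := x / ‖x‖ with he
  have hxe : x = ‖x‖ * e := by rw [he, mul_div_cancel₀ _ hrc]
  have hen : ‖e‖ = 1 := by rw [he, norm_div, Complex.norm_real, norm_norm, div_self hr.ne']
  have he0 : e ≠ 0 := norm_ne_zero_iff.1 (by rw [hen]; exact one_ne_zero)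
  have hearg : e.arg = x.arg := by
    conv_rhs => rw [hxe, Complex.arg_real_mul _ hr]
  have hyn : ‖e * (y / ‖x‖)‖ = ‖y‖ / ‖x‖ := by
    rw [norm_mul, hen, one_mul, norm_div, Complex.norm_real, norm_norm]
  have hyle : ‖y‖ / ‖x‖ ≤ min δ₀ (1 / 2) := (div_le_iff₀ hr).2 hy
  have h1 := H e hen (by rw [hearg]; exact harg) (e * (y / ‖x‖))
    (by rw [hyn]; exact hyle.trans (min_le_left _ _))
  rw [hyn, hearg, mul_div_cancel_left₀ _ he0] at h1
  have hne : e + e * (y / ‖x‖) ≠ 0 := by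
    intro h0
    have h2 : ‖e‖ = ‖e * (y / ‖x‖)‖ :=
      (congrArg norm (eq_neg_of_add_eq_zero_left h0)).trans (norm_neg _)
    rw [hen, hyn] at h2
    have := hyle.trans (min_le_right _ _)
    linarith
  have h2 : x + e * y = ‖x‖ * (e + e * (y / ‖x‖)) := by
    conv_lhs => rw [hxe]
    field_simp
  have h3 : (starRingEnd ℂ (polarGrad k f f₁ x.arg) * (y / ‖x‖)).re =
      (starRingEnd ℂ (polarGrad k f f₁ x.arg) * y).re / ‖x‖ := by
    rw [← mul_div_assoc, Complex.div_ofReal_re]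
  have h4 : quadForm (hessIso k f f₂ x.arg) (hessAniso k f f₁ f₂ x.arg) (y / ‖x‖) =
      quadForm (hessIso k f f₂ x.arg) (hessAniso k f f₁ f₂ x.arg) y / ‖x‖ ^ 2 := by
    have : y / (‖x‖ : ℂ) = ((‖x‖⁻¹ : ℝ) : ℂ) * y := by
      rw [Complex.ofReal_inv]; field_simp
    rw [this, quadForm_ofReal_mul]
    field_simp
  rw [h3, h4] at h1
  have h5 : homog k f x = Real.exp (k * Real.log ‖x‖) * homog k f e := by
    conv_lhs => rw [hxe]
    exact homog_ofReal_mul k f hr he0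
  rw [h2, homog_ofReal_mul k f hr hne, h5, ← mul_add, ← mul_sub, abs_mul,
    abs_of_pos (Real.exp_pos _), mul_left_comm κ, ← div_pow]
  rw [← add_assoc]
  exact mul_le_mul_of_nonneg_left h1 (Real.exp_pos _).le

end Taylor

/-! ### The plane as the complex plane and the moments of the noise -/

/-- The identification of the plane with the complex plane. -/
noncomputable def toC : Plane ≃ₗᵢ[ℝ] ℂ := Complex.orthonormalBasisOneI.repr.symm

theorem toC_symm_apply (z : ℂ) : toC.symm z = !₂[z.re, z.im] := by
  ext i
  fin_cases i <;> simp [toC]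

@[simp] theorem toC_re (x : Plane) : (toC x).re = x 0 := by
  obtain ⟨z, rfl⟩ := toC.symm.surjective x
  rw [LinearIsometryEquiv.apply_symm_apply, toC_symm_apply]
  simp

@[simp] theorem toC_im (x : Plane) : (toC x).im = x 1 := by
  obtain ⟨z, rfl⟩ := toC.symm.surjective x
  rw [LinearIsometryEquiv.apply_symm_apply, toC_symm_apply]
  simp

/-- The reason for passing to `ℂ`: a scaled rotation is a multiplication, so a tug with its noise is
a product. -/
theorem toC_similarity (v z : Plane) : toC (similarity v z) = toC v * toC z := by
  apply Complex.ext <;> simp [similarity]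
  ring

theorem toC_e₁ : toC e₁ = 1 := by
  apply Complex.ext <;> simp [e₁]

/-- The factor by which a tug is multiplied, together with its noise. -/
noncomputable def tugFactor (z : Plane) : ℂ := 1 + toC z

theorem continuous_tugFactor : Continuous tugFactor := by
  unfold tugFactor
  exact continuous_const.add toC.continuous

theorem add_similarity (x v z : Plane) :
    x + v + similarity v z = toC.symm (toC x + toC v * tugFactor z) := by
  apply toC.injective
  rw [LinearIsometryEquiv.apply_symm_apply, map_add, map_add, toC_similarity, tugFactor]
  ring

/-! ### Moments of the noise and the mean effect of a tug -/

section Noise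

variable {μ : Measure Plane}

/-- The infimum in `alpha` need not be attained, as the balls are open. The closed bound follows
from countably many admissible radii decreasing to it. -/
theorem ae_norm_le_alpha [IsProbabilityMeasure μ]
    (hμ : IsNoise μ) : ∀ᵐ z ∂μ, ‖z‖ ≤ alpha μ - 1 := by
  set S := {R : ℝ | 0 < R ∧ μ (Metric.ball 0 R) = 1} with hS
  have hne : S.Nonempty := by
    obtain ⟨K, hK, hKμ⟩ := hμ.compact_support
    obtain ⟨R, hR, hKR⟩ := hK.isBounded.subset_ball_lt 0 0
    refine ⟨R, hR, ?_⟩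
    rw [prob_compl_eq_zero_iff hK.measurableSet] at hKμ
    exact le_antisymm prob_le_one (hKμ ▸ measure_mono hKR)
  have h1 : ∀ R ∈ S, ∀ᵐ z ∂μ, ‖z‖ < R := by
    rintro R ⟨-, hR⟩
    have := (prob_compl_eq_zero_iff Metric.isOpen_ball.measurableSet).2 hR
    filter_upwards [measure_eq_zero_iff_ae_notMem.1 this] with z hz
    simpa using hz
  have h2 : ∀ n : ℕ, ∀ᵐ z ∂μ, ‖z‖ < sInf S + 1 / ((n : ℝ) + 1) := by
    intro n
    obtain ⟨R, hRS, hR⟩ := exists_lt_of_csInf_lt hne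
      (lt_add_of_pos_right (sInf S) (by positivity : (0 : ℝ) < 1 / ((n : ℝ) + 1)))
    filter_upwards [h1 R hRS] with z hz
    exact hz.trans hR
  filter_upwards [ae_all_iff.2 h2] with z hz
  have h3 : alpha μ - 1 = sInf S := by unfold alpha; ring
  rw [h3]
  refine le_of_forall_pos_lt_add fun δ hδ => ?_
  obtain ⟨n, hn⟩ := exists_nat_one_div_lt hδ
  exact (hz n).trans (by linarith)

theorem one_le_alpha (μ : Measure Plane) : 1 ≤ alpha μ := by
  unfold alpha
  have : 0 ≤ sInf {R : ℝ | 0 < R ∧ μ (Metric.ball 0 R) = 1} :=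
    Real.sInf_nonneg fun R hR => hR.1.le
  linarith

theorem ae_norm_tugFactor_le [IsProbabilityMeasure μ]
    (hμ : IsNoise μ) : ∀ᵐ z ∂μ, ‖tugFactor z‖ ≤ alpha μ := by
  filter_upwards [ae_norm_le_alpha hμ] with z hz
  calc ‖tugFactor z‖ ≤ ‖(1 : ℂ)‖ + ‖toC z‖ := norm_add_le _ _
    _ ≤ 1 + (alpha μ - 1) := by
      rw [norm_one, LinearIsometryEquiv.norm_map]; gcongr
    _ = alpha μ := by ring

theorem integrable_of_continuous [IsProbabilityMeasure μ] (hμ : IsNoise μ) {E : Type*}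
    [NormedAddCommGroup E]
    {F : Plane → E} (hF : Continuous F) : Integrable F μ := by
  obtain ⟨K, hK, hKμ⟩ := hμ.compact_support
  have h := hF.continuousOn.integrableOn_compact (μ := μ) hK
  rwa [IntegrableOn, Measure.restrict_eq_self_of_ae_mem] at h
  filter_upwards [measure_eq_zero_iff_ae_notMem.1 hKμ] with z hz
  simpa using hz

theorem continuous_coord (i : Fin 2) : Continuous fun z : Plane => z i := by fun_prop

/-- Complex conjugation is an orthogonal transformation that fixes `e₁`, and it changes the sign of
the integrand. -/
theorem cov_offdiag (hμ : IsNoise μ) : cov μ 0 1 = 0 := by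
  set O : Plane ≃ₗᵢ[ℝ] Plane := (toC.trans Complex.conjLIE).trans toC.symm with hO
  have hOe : O e₁ = e₁ := by
    simp [hO, toC_e₁, LinearIsometryEquiv.symm_apply_eq]
  have hO0 : ∀ z, (O z) 0 = z 0 := fun z => by
    rw [← toC_re, hO]; simp
  have hO1 : ∀ z, (O z) 1 = -z 1 := fun z => by
    rw [← toC_im, hO]; simp
  have h := hμ.invariant O hOe
  have h1 : cov μ 0 1 = -cov μ 0 1 := by
    unfold cov
    have hc : Continuous fun z : Plane => z 0 * z 1 :=
      (continuous_coord 0).mul (continuous_coord 1)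
    conv_lhs => rw [← h]
    rw [integral_map O.continuous.measurable.aemeasurable hc.aestronglyMeasurable, ← integral_neg]
    refine integral_congr_ae (Filter.Eventually.of_forall fun z => ?_)
    simp only [hO0, hO1]
    ring
  linarith

theorem integral_coord [IsProbabilityMeasure μ] (hμ : IsNoise μ) (i : Fin 2) : ∫ z, z i ∂μ = 0 := by
  have h := (EuclideanSpace.proj (𝕜 := ℝ) (ι := Fin 2) i).integral_comp_comm
    (integrable_of_continuous hμ continuous_id)
  simp only [id] at h
  rw [hμ.mean_zero, map_zero] at h
  exact h

theorem cov_pos {p : ℝ} (hp : 1 < p) (hpμ : exponent μ = p) : 0 < cov μ 1 1 := by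
  have h0 : 0 ≤ cov μ 1 1 := integral_nonneg fun z => mul_self_nonneg _
  refine h0.lt_of_ne fun h => ?_
  unfold exponent at hpμ
  -- For `C₂₂ = 0` the quotient has the default value `0`, contrary to `1 < p`.
  rw [← h, div_zero] at hpμ
  linarith

theorem cov_sum {p : ℝ} (hp : 1 < p) (hpμ : exponent μ = p) :
    cov μ 0 0 + cov μ 1 1 + 1 = p * cov μ 1 1 := by
  have h := cov_pos hp hpμ
  rw [← hpμ, exponent, div_mul_cancel₀ _ h.ne']

theorem integral_tugFactor [IsProbabilityMeasure μ] (hμ : IsNoise μ) : ∫ z, tugFactor z ∂μ = 1 := by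
  unfold tugFactor
  rw [integral_add (integrable_const _) (integrable_of_continuous hμ toC.continuous)]
  have h : ∫ z, toC z ∂μ = toC (∫ z, z ∂μ) :=
    toC.toContinuousLinearEquiv.integral_comp_comm (fun z => z)
  rw [h, hμ.mean_zero]
  simp

/-- Since the mean is zero, the value is `1 + C₁₁ + C₂₂`, which the definition of the exponent turns
into `p * C₂₂`. -/
theorem integral_norm_tugFactor_sq [IsProbabilityMeasure μ] {p : ℝ} (hp : 1 < p) (hμ : IsNoise μ)
    (hpμ : exponent μ = p) :
    ∫ z, ‖tugFactor z‖ ^ 2 ∂μ = p * cov μ 1 1 := by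
  have h : ∀ z : Plane, ‖tugFactor z‖ ^ 2 = 1 + 2 * z 0 + (z 0 * z 0 + z 1 * z 1) := by
    intro z
    rw [← Complex.normSq_eq_norm_sq, Complex.normSq_apply]
    simp [tugFactor]
    ring
  simp only [h]
  have c0 := continuous_coord 0
  have c1 := continuous_coord 1
  rw [integral_add, integral_add, integral_add, integral_const_mul, integral_coord hμ,
    ← cov_sum hp hpμ]
  · simp [cov]; ring
  all_goals exact integrable_of_continuous hμ (by fun_prop)

/-- The real part is `1 + C₁₁ - C₂₂ = (p - 2) * C₂₂`; the imaginary part is a multiple of `C₁₂ = 0`.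
-/
theorem integral_tugFactor_sq [IsProbabilityMeasure μ] {p : ℝ} (hp : 1 < p) (hμ : IsNoise μ)
    (hpμ : exponent μ = p) :
    ∫ z, tugFactor z ^ 2 ∂μ = ((p - 2) * cov μ 1 1 : ℝ) := by
  have hint : Integrable (fun z => tugFactor z ^ 2) μ :=
    integrable_of_continuous hμ (continuous_tugFactor.pow 2)
  have c0 := continuous_coord 0
  have c1 := continuous_coord 1
  apply Complex.ext
  · have h1 := (Complex.reCLM.integral_comp_comm hint).symm
    simp only [Complex.reCLM_apply] at h1
    rw [h1]
    have h : ∀ z : Plane, (tugFactor z ^ 2).re = 1 + 2 * z 0 + (z 0 * z 0 - z 1 * z 1) := by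
      intro z
      simp [tugFactor, sq]
      ring
    simp only [h]
    rw [integral_add, integral_add, integral_sub, integral_const_mul, integral_coord hμ,
      Complex.ofReal_re, sub_mul, ← cov_sum hp hpμ]
    · simp [cov]; ring
    all_goals exact integrable_of_continuous hμ (by fun_prop)
  · have h1 := (Complex.imCLM.integral_comp_comm hint).symm
    simp only [Complex.imCLM_apply] at h1
    rw [h1]
    have h : ∀ z : Plane, (tugFactor z ^ 2).im = 2 * z 1 + 2 * (z 0 * z 1) := by
      intro z
      simp [tugFactor, sq]
      ring
    simp only [h]
    rw [integral_add, integral_const_mul, integral_const_mul, integral_coord hμ]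
    · have := cov_offdiag hμ
      unfold cov at this
      rw [this]; simp
    all_goals exact integrable_of_continuous hμ (by fun_prop)

/-- The mean of a homogeneous function after a tug. -/
theorem homog_step [IsProbabilityMeasure μ] {p k : ℝ} {f f₁ f₂ : ℝ → ℝ} (hp : 1 < p)
    (hμ : IsNoise μ)
    (hpμ : exponent μ = p) (hf : ∀ θ, HasDerivAt f (f₁ θ) θ) (hf₁ : ∀ θ, HasDerivAt f₁ (f₂ θ) θ)
    (hf₂ : Continuous f₂) {h ε κ : ℝ} (hh : h < Real.pi) (hε : 0 < ε) (hκ : 0 < κ) :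
    ∃ R > 0, ∀ x : ℂ, R ≤ ‖x‖ → |x.arg| ≤ h → ∀ y : ℂ, ‖y‖ ≤ ε →
      Integrable (fun z => homog k f (x + x / ‖x‖ * y * tugFactor z)) μ ∧
      |∫ z, homog k f (x + x / ‖x‖ * y * tugFactor z) ∂μ -
        (homog k f x + Real.exp (k * Real.log ‖x‖) *
        ((starRingEnd ℂ (polarGrad k f f₁ x.arg) * y).re / ‖x‖ +
        cov μ 1 1 * quadForm (p * hessIso k f f₂ x.arg)
          ((p - 2 : ℝ) * hessAniso k f f₁ f₂ x.arg) y / ‖x‖ ^ 2 / 2))| ≤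
        κ * (Real.exp (k * Real.log ‖x‖) * (‖y‖ ^ 2 / ‖x‖ ^ 2)) := by
  have hα : 0 < alpha μ := one_pos.trans_le (one_le_alpha μ)
  -- The modulus of `tugFactor` is almost surely at most `alpha μ`. This enters squared in the
  -- tolerance, and linearly in the radius beyond which every displacement is small relative to
  -- `‖x‖`.
  obtain ⟨δ, hδ, H⟩ := homog_taylor (k := k) hf hf₁ hf₂ hh
    (show 0 < κ / alpha μ ^ 2 by positivity)
  refine ⟨alpha μ * ε / δ, by positivity, fun x hx harg y hy => ?_⟩
  have hr : 0 < ‖x‖ := lt_of_lt_of_le (by positivity) hx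
  have hx0 : x ≠ 0 := norm_pos_iff.1 hr
  set E := Real.exp (k * Real.log ‖x‖) with hE
  have hEpos : 0 < E := Real.exp_pos _
  set a := hessIso k f f₂ x.arg
  set b := hessAniso k f f₁ f₂ x.arg
  set β := polarGrad k f f₁ x.arg
  set T : Plane → ℝ := fun z => homog k f x + E * ((starRingEnd ℂ β * (y * tugFactor z)).re / ‖x‖ +
      quadForm a b (y * tugFactor z) / ‖x‖ ^ 2 / 2) with hT
  have hct := continuous_tugFactor
  have hTc : Continuous T := by
    simp only [hT, quadForm]
    fun_prop
  have hTint : Integrable T μ := integrable_of_continuous hμ hTc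
  have hbd : ∀ᵐ z ∂μ, ‖homog k f (x + x / ‖x‖ * y * tugFactor z) - T z‖ ≤
      κ * (E * (‖y‖ ^ 2 / ‖x‖ ^ 2)) := by
    filter_upwards [ae_norm_tugFactor_le hμ] with z hz
    have h1 : ‖y * tugFactor z‖ ≤ δ * ‖x‖ := by
      rw [norm_mul]
      calc ‖y‖ * ‖tugFactor z‖ ≤ ε * alpha μ := by gcongr
        _ ≤ δ * ‖x‖ := by
          rw [div_le_iff₀ hδ] at hx
          linarith
    have h2 := H x hx0 harg (y * tugFactor z) h1
    rw [← mul_assoc] at h2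
    rw [Real.norm_eq_abs]
    refine h2.trans ?_
    rw [norm_mul, mul_pow]
    calc κ / alpha μ ^ 2 * (E * (‖y‖ ^ 2 * ‖tugFactor z‖ ^ 2 / ‖x‖ ^ 2))
        ≤ κ / alpha μ ^ 2 * (E * (‖y‖ ^ 2 * alpha μ ^ 2 / ‖x‖ ^ 2)) := by gcongr
      _ = κ * (E * (‖y‖ ^ 2 / ‖x‖ ^ 2)) := by field_simp
  have hlog : ∀ F : ℝ → ℝ, Continuous F → Measurable fun w : ℂ => F (Complex.log w).im :=
    fun F hF => hF.measurable.comp (Complex.measurable_im.comp Complex.measurable_log)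
  have hmeas : Measurable fun z => homog k f (x + x / ‖x‖ * y * tugFactor z) := by
    have h1 : Measurable (homog k f) := by
      unfold homog
      exact (Real.measurable_exp.comp
        ((Complex.measurable_re.comp Complex.measurable_log).const_mul k)).mul
        (hlog f (continuous_iff_continuousAt.2 fun θ => (hf θ).continuousAt))
    exact h1.comp (by fun_prop)
  have hdint : Integrable (fun z => homog k f (x + x / ‖x‖ * y * tugFactor z) - T z) μ :=
    Integrable.of_bound (hmeas.sub hTc.measurable).aestronglyMeasurable _ hbd
  have hint : Integrable (fun z => homog k f (x + x / ‖x‖ * y * tugFactor z)) μ := by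
    have := hdint.add hTint
    refine this.congr (Filter.Eventually.of_forall fun z => ?_)
    simp
  refine ⟨hint, ?_⟩
  have hTval : ∫ z, T z ∂μ = homog k f x + E * ((starRingEnd ℂ β * y).re / ‖x‖ +
        cov μ 1 1 * quadForm (p * a) ((p - 2 : ℝ) * b) y / ‖x‖ ^ 2 / 2) := by
    have e1 : ∀ c : ℂ, ∫ z, (c * tugFactor z).re ∂μ = c.re := by
      intro c
      have hc : Continuous fun z => c * tugFactor z := continuous_const.mul hct
      have h1 := Complex.reCLM.integral_comp_comm (integrable_of_continuous hμ hc)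
      simp only [Complex.reCLM_apply] at h1
      rw [h1, integral_const_mul, integral_tugFactor hμ, mul_one]
    have e2 : ∀ c : ℂ, ∫ z, (c * tugFactor z ^ 2).re ∂μ = (c * ((p - 2) * cov μ 1 1 : ℝ)).re := by
      intro c
      have hc : Continuous fun z => c * tugFactor z ^ 2 := continuous_const.mul (hct.pow 2)
      have h1 := Complex.reCLM.integral_comp_comm (integrable_of_continuous hμ hc)
      simp only [Complex.reCLM_apply] at h1
      rw [h1, integral_const_mul, integral_tugFactor_sq hp hμ hpμ]
    have e3 : ∀ z, T z = homog k f x + (E / ‖x‖ * (starRingEnd ℂ β * y * tugFactor z).re +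
        (E / ‖x‖ ^ 2 / 2 * (a * ‖y‖ ^ 2) * ‖tugFactor z‖ ^ 2 +
          E / ‖x‖ ^ 2 / 2 * (b * y ^ 2 * tugFactor z ^ 2).re)) := by
      intro z
      simp only [hT, quadForm]
      rw [norm_mul, mul_pow, mul_pow, ← mul_assoc, ← mul_assoc]
      ring_nf
    simp only [e3]
    rw [integral_add, integral_add, integral_add, integral_const_mul, integral_const_mul,
      integral_const_mul, e1, e2, integral_norm_tugFactor_sq hp hμ hpμ, integral_const,
      Complex.re_mul_ofReal]
    · unfold quadForm
      rw [show ((p - 2 : ℝ) : ℂ) * b * y ^ 2 = ((p - 2 : ℝ) : ℂ) * (b * y ^ 2) by ring,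
        Complex.re_ofReal_mul]
      simp
      ring
    all_goals exact integrable_of_continuous hμ (by fun_prop)
  rw [← hTval, ← integral_sub hint hTint]
  have := norm_integral_le_of_norm_le_const hbd
  simpa using this

end Noise

/-! ### The effect of the strategies on homogeneous functions -/

/-- The direction of the gradient of `r ^ k * f θ`. -/
noncomputable def gradDir (k : ℝ) (f f₁ : ℝ → ℝ) (x : ℂ) : ℂ :=
  x / ‖x‖ * (polarGrad k f f₁ x.arg / ‖polarGrad k f f₁ x.arg‖)

/-- The tug that almost cancels the opposing tug `v`, with a bias of order `L / ‖x‖` in the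
direction
of the gradient. -/
noncomputable def pushBack (k : ℝ) (f f₁ : ℝ → ℝ) (L : ℝ) (x v : ℂ) : ℂ :=
  -v + (min 1 (L / ‖x‖) : ℝ) * (v + ‖v‖ * gradDir k f f₁ x)

theorem norm_div_norm_le_one (x : ℂ) : ‖x / (‖x‖ : ℂ)‖ ≤ 1 := by
  rw [norm_div, Complex.norm_real, norm_norm]
  exact div_self_le_one _

theorem norm_gradDir_le (k : ℝ) (f f₁ : ℝ → ℝ) (x : ℂ) : ‖gradDir k f f₁ x‖ ≤ 1 := by
  unfold gradDir
  rw [norm_mul]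
  exact mul_le_one₀ (norm_div_norm_le_one _) (norm_nonneg _) (norm_div_norm_le_one _)

/-- The response is a convex combination of `-v` and `‖v‖` times the gradient direction, hence an
admissible tug. -/
theorem norm_pushBack_le (k : ℝ) (f f₁ : ℝ → ℝ) {L : ℝ} (hL : 0 ≤ L) (x v : ℂ) :
    ‖pushBack k f f₁ L x v‖ ≤ ‖v‖ := by
  unfold pushBack
  set t := min 1 (L / ‖x‖) with ht
  have ht0 : 0 ≤ t := le_min zero_le_one (by positivity)
  have ht1 : t ≤ 1 := min_le_left _ _
  have h1 : -v + (t : ℂ) * (v + ‖v‖ * gradDir k f f₁ x) =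
      -(((1 - t : ℝ) : ℂ) * v) + ((t * ‖v‖ : ℝ) : ℂ) * gradDir k f f₁ x := by
    push_cast; ring
  rw [h1]
  refine (norm_add_le _ _).trans ?_
  rw [norm_neg, norm_mul, norm_mul, Complex.norm_real, Complex.norm_real, Real.norm_eq_abs,
    Real.norm_eq_abs, abs_of_nonneg (by linarith), abs_of_nonneg (by positivity)]
  calc (1 - t) * ‖v‖ + t * ‖v‖ * ‖gradDir k f f₁ x‖ ≤ (1 - t) * ‖v‖ + t * ‖v‖ * 1 := by
        gcongr; exact norm_gradDir_le _ _ _ _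
    _ = ‖v‖ := by ring

/-- The two tugs cancel up to order `1 / ‖x‖`, which is what bounds the growth of the mean square of
the position. -/
theorem norm_add_pushBack_le (k : ℝ) (f f₁ : ℝ → ℝ) {L : ℝ} (hL : 0 ≤ L) (x v : ℂ) :
    ‖x‖ * ‖v + pushBack k f f₁ L x v‖ ≤ 2 * L * ‖v‖ := by
  rcases eq_or_ne x 0 with rfl | hx
  · rw [norm_zero, zero_mul]; positivity
  have hr : 0 < ‖x‖ := norm_pos_iff.2 hx
  unfold pushBack
  set t := min 1 (L / ‖x‖) with ht
  have ht0 : 0 ≤ t := le_min zero_le_one (by positivity)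
  have ht1 : t ≤ L / ‖x‖ := min_le_right _ _
  rw [add_neg_cancel_left, norm_mul, Complex.norm_real, Real.norm_eq_abs, abs_of_nonneg ht0]
  have h1 : ‖v + ‖v‖ * gradDir k f f₁ x‖ ≤ 2 * ‖v‖ := by
    refine (norm_add_le _ _).trans ?_
    rw [norm_mul, Complex.norm_real, norm_norm]
    calc ‖v‖ + ‖v‖ * ‖gradDir k f f₁ x‖ ≤ ‖v‖ + ‖v‖ * 1 := by
          gcongr; exact norm_gradDir_le _ _ _ _
      _ = 2 * ‖v‖ := by ring
  calc ‖x‖ * (t * ‖v + ‖v‖ * gradDir k f f₁ x‖) ≤ ‖x‖ * (L / ‖x‖ * (2 * ‖v‖)) := by gcongr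
    _ = 2 * L * ‖v‖ := by field_simp

theorem measurable_gradDir {k : ℝ} {f f₁ : ℝ → ℝ} (hf : Continuous f) (hf₁ : Continuous f₁) :
    Measurable (gradDir k f f₁) := by
  have h1 : Measurable fun x : ℂ => polarGrad k f f₁ x.arg := by
    have : (fun x : ℂ => polarGrad k f f₁ x.arg) =
        fun x : ℂ => ((k * f x.arg : ℝ) : ℂ) + ((f₁ x.arg : ℝ) : ℂ) * Complex.I := by
      funext x
      exact Complex.mk_eq_add_mul_I _ _
    rw [this]
    have ha := Complex.measurable_arg
    have h2 := (hf.measurable.comp ha).const_mul k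
    have h3 := hf₁.measurable.comp ha
    exact (Complex.measurable_ofReal.comp h2).add
      ((Complex.measurable_ofReal.comp h3).mul_const _)
  unfold gradDir
  fun_prop

theorem measurable_homog {k : ℝ} {f : ℝ → ℝ} (hf : Continuous f) : Measurable (homog k f) := by
  unfold homog
  exact (Real.measurable_exp.comp
    ((Complex.measurable_re.comp Complex.measurable_log).const_mul k)).mul
    (hf.measurable.comp (Complex.measurable_im.comp Complex.measurable_log))

theorem norm_sub_mul_sq {n : ℂ} (hn : ‖n‖ = 1) (y : ℂ) (t : ℝ) :
    ‖y - t * n‖ ^ 2 = ‖y‖ ^ 2 + t ^ 2 - 2 * t * (starRingEnd ℂ n * y).re := by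
  have h : n.re * n.re + n.im * n.im = 1 := by
    rw [← Complex.normSq_apply, Complex.normSq_eq_norm_sq, hn, one_pow]
  rw [← Complex.normSq_eq_norm_sq, ← Complex.normSq_eq_norm_sq, Complex.normSq_apply,
    Complex.normSq_apply]
  simp only [Complex.sub_re, Complex.sub_im, Complex.mul_im, Complex.ofReal_re, Complex.ofReal_im,
    Complex.mul_re, Complex.conj_re, Complex.conj_im]
  linear_combination t ^ 2 * h

theorem norm_ofReal_mul {n : ℂ} (hn : ‖n‖ = 1) (t : ℝ) : ‖(t : ℂ) * n‖ = |t| := by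
  rw [norm_mul, hn, Complex.norm_real, Real.norm_eq_abs, mul_one]

/-- Used with `D` the deviation of the opponent from the worst tug: the first order gain is
quadratic in `D` and absorbs the second order loss, which is linear in `D`. -/
theorem quadratic_nonneg {A B C : ℝ} (hA : 0 < A) (h : B ^ 2 ≤ 4 * A * C) (D : ℝ) :
    0 ≤ A * D ^ 2 - B * D + C := by
  have h1 : 0 ≤ 4 * A * (A * D ^ 2 - B * D + C) := by nlinarith [sq_nonneg (2 * A * D - B)]
  exact nonneg_of_mul_nonneg_right h1 (by positivity)

/-! ### Drift of super- and subsolutions under the two strategies -/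

section

variable {p k : ℝ} {f f₁ f₂ : ℝ → ℝ}

theorem continuous_polarGrad (hf : Continuous f) (hf₁ : Continuous f₁) :
    Continuous (polarGrad k f f₁) := by
  have : polarGrad k f f₁ = fun θ => ((k * f θ : ℝ) : ℂ) + ((f₁ θ : ℝ) : ℂ) * Complex.I := by
    funext θ
    exact Complex.mk_eq_add_mul_I _ _
  rw [this]
  fun_prop

/-- Uniform bounds for the coefficients of the expansion in a sector. -/
theorem exists_coefficient_bounds (hf : Continuous f) (hf₁ : Continuous f₁) (hf₂ : Continuous f₂)
    (hpos : ∀ θ, 0 < k ^ 2 * f θ ^ 2 + f₁ θ ^ 2) {σ : ℝ}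
    (hG : ∀ θ, 0 < σ * angularOperator p k (f θ) (f₁ θ) (f₂ θ)) (h : ℝ) :
    ∃ ρ > 0, ∃ c > 0, ∃ C > 0, ∀ θ, |θ| ≤ h → ρ ≤ ‖polarGrad k f f₁ θ‖ ∧
      c ≤ σ * quadForm (p * hessIso k f f₂ θ) ((p - 2 : ℝ) * hessAniso k f f₁ f₂ θ)
        (polarGrad k f f₁ θ / ‖polarGrad k f f₁ θ‖) ∧
      |p * hessIso k f f₂ θ| + ‖((p - 2 : ℝ) : ℂ) * hessAniso k f f₁ f₂ θ‖ ≤ C := by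
  have hβ := continuous_polarGrad (k := k) hf hf₁
  have hβpos : ∀ θ, 0 < ‖polarGrad k f f₁ θ‖ := fun θ => by
    have := hpos θ
    rw [← normSq_polarGrad] at this
    exact (norm_nonneg _).lt_of_ne fun h0 => by simp [← h0] at this
  have hK : IsCompact (Icc (-h) h) := isCompact_Icc
  obtain ⟨ρ, hρ, h1⟩ := hK.exists_forall_le' (f := fun θ => ‖polarGrad k f f₁ θ‖)
    hβ.norm.continuousOn fun θ _ => hβpos θ
  have hq : ∀ θ, σ * quadForm (p * hessIso k f f₂ θ) ((p - 2 : ℝ) * hessAniso k f f₁ f₂ θ)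
        (polarGrad k f f₁ θ / ‖polarGrad k f f₁ θ‖) =
      σ * angularOperator p k (f θ) (f₁ θ) (f₂ θ) / ‖polarGrad k f f₁ θ‖ ^ 2 := by
    intro θ
    rw [div_eq_inv_mul (polarGrad k f f₁ θ), ← Complex.ofReal_inv, quadForm_ofReal_mul,
      quadForm_polarGrad]
    field_simp
  obtain ⟨c, hc, h2⟩ := hK.exists_forall_le' (a := 0)
    (f := fun θ => σ * angularOperator p k (f θ) (f₁ θ) (f₂ θ) / ‖polarGrad k f f₁ θ‖ ^ 2)
    (by
      refine Continuous.continuousOn (Continuous.div ?_ (hβ.norm.pow 2)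
        fun θ => (pow_pos (hβpos θ) 2).ne')
      unfold angularOperator
      fun_prop)
    fun θ _ => div_pos (hG θ) (pow_pos (hβpos θ) 2)
  have haniso : Continuous (hessAniso k f f₁ f₂) := by
    have : hessAniso k f f₁ f₂ = fun θ => (((k * (k - 2) * f θ - f₂ θ) / 2 : ℝ) : ℂ) +
        ((-((k - 1) * f₁ θ) : ℝ) : ℂ) * Complex.I := by
      funext θ
      exact Complex.mk_eq_add_mul_I _ _
    rw [this]
    fun_prop
  have hiso : Continuous (hessIso k f f₂) := by unfold hessIso; fun_prop
  obtain ⟨C, h3⟩ := hK.exists_bound_of_continuousOn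
    (f := fun θ => |p * hessIso k f f₂ θ| + ‖((p - 2 : ℝ) : ℂ) * hessAniso k f f₁ f₂ θ‖)
    (by fun_prop)
  refine ⟨ρ, hρ, c, hc, max C 1, by positivity, fun θ hθ => ⟨h1 θ (abs_le.1 hθ), ?_, ?_⟩⟩
  · rw [hq]
    exact h2 θ (abs_le.1 hθ)
  · exact ((le_abs_self _).trans (h3 θ (abs_le.1 hθ))).trans (le_max_left _ _)

variable {μ : Measure Plane} [IsProbabilityMeasure μ]

/-- If one player pulls in the direction opposite to the gradient of a strict supersolution of
degree `2`, then its mean decreases at least by a constant, whatever the other player does. -/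
theorem supersolution_step (hp : 1 < p) (hμ : IsNoise μ) (hpμ : exponent μ = p)
    (hf : ∀ θ, HasDerivAt f (f₁ θ) θ) (hf₁ : ∀ θ, HasDerivAt f₁ (f₂ θ) θ) (hf₂ : Continuous f₂)
    (hpos : ∀ θ, 0 < (2 : ℝ) ^ 2 * f θ ^ 2 + f₁ θ ^ 2)
    (hG : ∀ θ, angularOperator p 2 (f θ) (f₁ θ) (f₂ θ) < 0) {h ε : ℝ} (hh : h < Real.pi)
    (hε : 0 < ε) :
    ∃ R > 0, ∃ c > 0, ∀ x : ℂ, R ≤ ‖x‖ → |x.arg| ≤ h → ∀ v : ℂ, ‖v‖ ≤ ε →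
      Integrable (fun z => homog 2 f (x + v * tugFactor z)) μ ∧
      Integrable (fun z => homog 2 f (x + -(ε * gradDir 2 f f₁ x) * tugFactor z)) μ ∧
      (∫ z, homog 2 f (x + v * tugFactor z) ∂μ) / 2 +
        (∫ z, homog 2 f (x + -(ε * gradDir 2 f f₁ x) * tugFactor z) ∂μ) / 2 ≤
          homog 2 f x - c := by
  have hfc : Continuous f := continuous_iff_continuousAt.2 fun θ => (hf θ).continuousAt
  have hf₁c : Continuous f₁ := continuous_iff_continuousAt.2 fun θ => (hf₁ θ).continuousAt
  obtain ⟨ρ, hρ, c, hc, C, hC, hcoef⟩ := exists_coefficient_bounds (p := p) (σ := -1) hfc hf₁c hf₂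
    hpos (fun θ => by linarith [hG θ]) h
  set s := cov μ 1 1 with hs
  have hspos : 0 < s := cov_pos hp hpμ
  obtain ⟨R, hR, hstep⟩ := homog_step (k := 2) hp hμ hpμ hf hf₁ hf₂ hh hε
    (show 0 < s * c / 8 by positivity)
  -- The second radius is the discriminant condition in `hquad`. Before averaging the two tugs, the
  -- gain `s * ε ^ 2 * c` loses one quarter to the Taylor errors and one quarter to the linear term
  -- in `D`; half of the remainder is the drop.
  refine ⟨max R (2 * s * C ^ 2 * ε / (ρ * c)), by positivity, s * ε ^ 2 * c / 4, by positivity,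
    fun x hx harg v hv => ?_⟩
  have hxR : R ≤ ‖x‖ := (le_max_left _ _).trans hx
  have hxR' : 2 * s * C ^ 2 * ε / (ρ * c) ≤ ‖x‖ := (le_max_right _ _).trans hx
  obtain ⟨hβρ, hqc, hab⟩ := hcoef x.arg harg
  set r := ‖x‖ with hrdef
  have hr : 0 < r := hR.trans_le hxR
  have hrc : (r : ℂ) ≠ 0 := Complex.ofReal_ne_zero.2 hr.ne'
  have hx0 : x ≠ 0 := norm_pos_iff.1 hr
  set β := polarGrad 2 f f₁ x.arg with hβ
  set a := p * hessIso 2 f f₂ x.arg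
  set b := ((p - 2 : ℝ) : ℂ) * hessAniso 2 f f₁ f₂ x.arg
  have hβpos : 0 < ‖β‖ := hρ.trans_le hβρ
  set n := β / ‖β‖ with hn
  have hβc : (‖β‖ : ℂ) ≠ 0 := Complex.ofReal_ne_zero.2 hβpos.ne'
  have hnn : ‖n‖ = 1 := by rw [hn, norm_div, Complex.norm_real, norm_norm, div_self hβpos.ne']
  have hβn : β = ‖β‖ * n := by rw [hn, mul_div_cancel₀ _ hβc]
  have hre : ∀ y : ℂ, (starRingEnd ℂ β * y).re = ‖β‖ * (starRingEnd ℂ n * y).re := by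
    intro y
    conv_lhs => rw [hβn]
    rw [map_mul, Complex.conj_ofReal, mul_assoc, Complex.re_ofReal_mul]
  have hE : Real.exp (2 * Real.log r) = r ^ 2 := by
    rw [mul_comm, Real.exp_mul, Real.exp_log hr]; norm_num
  have key : ∀ y : ℂ, ‖y‖ ≤ ε → Integrable (fun z => homog 2 f (x + x / r * y * tugFactor z)) μ ∧
      ∫ z, homog 2 f (x + x / r * y * tugFactor z) ∂μ ≤
        homog 2 f x + r * (‖β‖ * (starRingEnd ℂ n * y).re) + s * quadForm a b y / 2 +
          s * c / 8 * ε ^ 2 := by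
    intro y hy
    obtain ⟨h1, h2⟩ := hstep x hxR harg y hy
    refine ⟨h1, ?_⟩
    have h3 := (abs_le.1 h2).2
    rw [hE, hre] at h3
    have e1 : r ^ 2 * (‖β‖ * (starRingEnd ℂ n * y).re / r + s * quadForm a b y / r ^ 2 / 2) =
        r * (‖β‖ * (starRingEnd ℂ n * y).re) + s * quadForm a b y / 2 := by field_simp
    have e2 : s * c / 8 * (r ^ 2 * (‖y‖ ^ 2 / r ^ 2)) ≤ s * c / 8 * ε ^ 2 := by
      rw [mul_div_cancel₀ _ (by positivity)]
      gcongr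
    rw [e1] at h3
    linarith
  set y := r / x * v with hy
  have hyv : x / r * y = v := by rw [hy]; field_simp
  have hyn : ‖y‖ ≤ ε := by
    rw [hy, norm_mul, norm_div, Complex.norm_real, Real.norm_eq_abs, abs_of_pos hr, hrdef,
      div_self (norm_ne_zero_iff.2 hx0), one_mul]
    exact hv
  obtain ⟨i1, k1⟩ := key y hyn
  rw [hyv] at i1 k1
  have hgrad : x / r * (((-ε : ℝ) : ℂ) * n) = -(ε * gradDir 2 f f₁ x) := by
    rw [gradDir, ← hβ, ← hn, ← hrdef]; push_cast; ring
  obtain ⟨i2, k2⟩ := key (((-ε : ℝ) : ℂ) * n)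
    (by rw [norm_ofReal_mul hnn, abs_neg, abs_of_pos hε])
  rw [hgrad] at i2 k2
  refine ⟨i1, i2, ?_⟩
  have hnre : (starRingEnd ℂ n * (((-ε : ℝ) : ℂ) * n)).re = -ε := by
    rw [mul_left_comm, Complex.re_ofReal_mul, Complex.conj_mul', hnn]
    simp
  rw [hnre, quadForm_ofReal_mul, neg_sq] at k2
  -- `y` is the opponent's tug in the polar frame at `x`, `n` the gradient direction. The worst tug
  -- is `ε * n`; missing it by `D` loses at least `D ^ 2 / (2 * ε)` of the component along `n`.
  set D := ‖y - ε * n‖ with hD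
  have hD2 : D ^ 2 ≤ 2 * ε ^ 2 - 2 * ε * (starRingEnd ℂ n * y).re := by
    rw [hD, norm_sub_mul_sq hnn]
    have : ‖y‖ ^ 2 ≤ ε ^ 2 := by gcongr
    linarith
  have hreD : (starRingEnd ℂ n * y).re ≤ ε - D ^ 2 / (2 * ε) := by
    rw [le_sub_iff_add_le, ← le_sub_iff_add_le', div_le_iff₀ (by positivity)]
    linarith
  have hqD : quadForm a b y ≤ ε ^ 2 * quadForm a b n + 2 * C * ε * D := by
    have h1 := (abs_le.1 (quadForm_sub_le a b y (ε * n))).2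
    rw [quadForm_ofReal_mul, ← hD, norm_ofReal_mul hnn, abs_of_pos hε] at h1
    have h2 : (|a| + ‖b‖) * (D * (‖y‖ + ε)) ≤ C * (D * (ε + ε)) := by gcongr
    linarith
  have hqn : quadForm a b n ≤ -c := by linarith
  have hquad := quadratic_nonneg (A := r * ρ / (4 * ε)) (B := s * C * ε / 2)
    (C := s * ε ^ 2 * c / 8) (by positivity) (by
      rw [div_le_iff₀ (by positivity)] at hxR'
      have e1 : 4 * (r * ρ / (4 * ε)) * (s * ε ^ 2 * c / 8) = s * ε / 8 * (r * (ρ * c)) := by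
        field_simp
      rw [e1]
      calc (s * C * ε / 2) ^ 2 = s * ε / 8 * (2 * s * C ^ 2 * ε) := by ring
        _ ≤ _ := by gcongr) D
  have t1 : r * (‖β‖ * (starRingEnd ℂ n * y).re) + r * (‖β‖ * -ε) ≤
      -(2 * (r * ρ / (4 * ε) * D ^ 2)) := by
    calc r * (‖β‖ * (starRingEnd ℂ n * y).re) + r * (‖β‖ * -ε)
        = r * ‖β‖ * ((starRingEnd ℂ n * y).re - ε) := by ring
      _ ≤ r * ‖β‖ * (-(D ^ 2 / (2 * ε))) := by gcongr; linarith
      _ = -(r * ‖β‖ * (D ^ 2 / (2 * ε))) := by ring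
      _ ≤ -(r * ρ * (D ^ 2 / (2 * ε))) := by gcongr
      _ = _ := by field_simp; ring
  have t2 : s * quadForm a b y / 2 + s * (ε ^ 2 * quadForm a b n) / 2 ≤
      -(s * ε ^ 2 * c) + s * C * ε * D := by
    have h1 : quadForm a b y + ε ^ 2 * quadForm a b n ≤ 2 * (ε ^ 2 * -c) + 2 * C * ε * D := by
      have : ε ^ 2 * quadForm a b n ≤ ε ^ 2 * -c := by gcongr
      linarith
    calc s * quadForm a b y / 2 + s * (ε ^ 2 * quadForm a b n) / 2
        = s / 2 * (quadForm a b y + ε ^ 2 * quadForm a b n) := by ring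
      _ ≤ s / 2 * (2 * (ε ^ 2 * -c) + 2 * C * ε * D) := by gcongr
      _ = _ := by ring
  linarith

/-- If one player pushes back against the other one, with a small bias in the direction of the
gradient of a strict subsolution, then its mean does not decrease. -/
theorem subsolution_step (hp : 1 < p) (hμ : IsNoise μ) (hpμ : exponent μ = p)
    (hf : ∀ θ, HasDerivAt f (f₁ θ) θ) (hf₁ : ∀ θ, HasDerivAt f₁ (f₂ θ) θ) (hf₂ : Continuous f₂)
    (hpos : ∀ θ, 0 < k ^ 2 * f θ ^ 2 + f₁ θ ^ 2)
    (hG : ∀ θ, 0 < angularOperator p k (f θ) (f₁ θ) (f₂ θ)) {h ε : ℝ} (hh : h < Real.pi)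
    (hε : 0 < ε) :
    ∃ R > 0, ∃ L > 0, ∀ x : ℂ, R ≤ ‖x‖ → |x.arg| ≤ h → ∀ v : ℂ, ‖v‖ ≤ ε →
      Integrable (fun z => homog k f (x + v * tugFactor z)) μ ∧
      Integrable (fun z => homog k f (x + pushBack k f f₁ L x v * tugFactor z)) μ ∧
      homog k f x ≤ (∫ z, homog k f (x + pushBack k f f₁ L x v * tugFactor z) ∂μ) / 2 +
        (∫ z, homog k f (x + v * tugFactor z) ∂μ) / 2 := by
  have hfc : Continuous f := continuous_iff_continuousAt.2 fun θ => (hf θ).continuousAt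
  have hf₁c : Continuous f₁ := continuous_iff_continuousAt.2 fun θ => (hf₁ θ).continuousAt
  obtain ⟨ρ, hρ, c, hc, C, hC, hcoef⟩ := exists_coefficient_bounds (p := p) (σ := 1) hfc hf₁c hf₂
    hpos (fun θ => by linarith [hG θ]) h
  set s := cov μ 1 1 with hs
  have hspos : 0 < s := cov_pos hp hpμ
  obtain ⟨R, hR, hstep⟩ := homog_step (k := k) hp hμ hpμ hf hf₁ hf₂ hh hε
    (show 0 < s * c / 4 by positivity)
  -- With this `L` the discriminant in `hquad` vanishes: the bias contributes at least `L * ρ / (2 *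
  -- ε) * D ^ 2`, and the Hessian terms lose at most `3 * s * C * Y * D`.
  set L := 9 * s * C ^ 2 * ε / (ρ * c) with hL
  have hLpos : 0 < L := by positivity
  refine ⟨max R L, by positivity, L, hLpos, fun x hx harg v hv => ?_⟩
  have hxR : R ≤ ‖x‖ := (le_max_left _ _).trans hx
  have hxL : L ≤ ‖x‖ := (le_max_right _ _).trans hx
  obtain ⟨hβρ, hqc, hab⟩ := hcoef x.arg harg
  have hvI := norm_pushBack_le k f f₁ hLpos.le x v
  set r := ‖x‖ with hrdef
  have hr : 0 < r := hR.trans_le hxR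
  have hrc : (r : ℂ) ≠ 0 := Complex.ofReal_ne_zero.2 hr.ne'
  have hx0 : x ≠ 0 := norm_pos_iff.1 hr
  set β := polarGrad k f f₁ x.arg with hβ
  set a := p * hessIso k f f₂ x.arg
  set b := ((p - 2 : ℝ) : ℂ) * hessAniso k f f₁ f₂ x.arg
  have hβpos : 0 < ‖β‖ := hρ.trans_le hβρ
  set n := β / ‖β‖ with hn
  have hβc : (‖β‖ : ℂ) ≠ 0 := Complex.ofReal_ne_zero.2 hβpos.ne'
  have hnn : ‖n‖ = 1 := by rw [hn, norm_div, Complex.norm_real, norm_norm, div_self hβpos.ne']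
  have hβn : β = ‖β‖ * n := by rw [hn, mul_div_cancel₀ _ hβc]
  have hre : ∀ y : ℂ, (starRingEnd ℂ β * y).re = ‖β‖ * (starRingEnd ℂ n * y).re := by
    intro y
    conv_lhs => rw [hβn]
    rw [map_mul, Complex.conj_ofReal, mul_assoc, Complex.re_ofReal_mul]
  set E := Real.exp (k * Real.log r) with hE
  have hEpos : 0 < E := Real.exp_pos _
  have key : ∀ y : ℂ, ‖y‖ ≤ ‖v‖ → Integrable (fun z => homog k f (x + x / r * y * tugFactor z)) μ ∧
      homog k f x + E / r ^ 2 * (r * (‖β‖ * (starRingEnd ℂ n * y).re) + s * quadForm a b y / 2 -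
          s * c / 4 * ‖v‖ ^ 2) ≤ ∫ z, homog k f (x + x / r * y * tugFactor z) ∂μ := by
    intro y hy
    obtain ⟨h1, h2⟩ := hstep x hxR harg y (hy.trans hv)
    refine ⟨h1, ?_⟩
    have h3 := (abs_le.1 h2).1
    rw [hre] at h3
    have e1 : E * (‖β‖ * (starRingEnd ℂ n * y).re / r + s * quadForm a b y / r ^ 2 / 2) =
        E / r ^ 2 * (r * (‖β‖ * (starRingEnd ℂ n * y).re) + s * quadForm a b y / 2) := by
      field_simp
    have e2 : s * c / 4 * (E * (‖y‖ ^ 2 / r ^ 2)) ≤ E / r ^ 2 * (s * c / 4 * ‖v‖ ^ 2) := by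
      calc s * c / 4 * (E * (‖y‖ ^ 2 / r ^ 2)) = E / r ^ 2 * (s * c / 4 * ‖y‖ ^ 2) := by ring
        _ ≤ _ := by gcongr
    rw [e1] at h3
    rw [mul_sub]
    linarith
  set y := r / x * v with hy
  have hyv : x / r * y = v := by rw [hy]; field_simp
  have hyn : ‖y‖ = ‖v‖ := by
    rw [hy, norm_mul, norm_div, Complex.norm_real, Real.norm_eq_abs, abs_of_pos hr, hrdef,
      div_self (norm_ne_zero_iff.2 hx0), one_mul]
  obtain ⟨i1, k1⟩ := key y hyn.le
  rw [hyv] at i1 k1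
  set t := L / r with ht
  have ht0 : 0 ≤ t := by positivity
  have ht1 : t ≤ 1 := (div_le_one hr).2 hxL
  have htr : r * t = L := by rw [ht]; field_simp
  -- The deviation from the worst tug `-‖v‖ * n`. It vanishes when the opponent pulls exactly
  -- against the gradient; then the response is `-v` and the strict subsolution property alone
  -- suffices.
  set d := y + ‖v‖ * n with hd
  have hpush : x / r * (-y + t * d) = pushBack k f f₁ L x v := by
    have h1 : pushBack k f f₁ L x v = -v + (t : ℂ) * (v + ‖v‖ * (x / r * n)) := by
      unfold pushBack gradDir
      rw [← hrdef, min_eq_right ht1]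
    rw [h1, ← hyv, hd]
    have : ‖x / ↑r * y‖ = ‖y‖ := by rw [hyv, hyn]
    rw [hyn] at this
    rw [this]
    ring
  have hyI : ‖-y + t * d‖ ≤ ‖v‖ := by
    rw [← hpush, norm_mul, norm_div, Complex.norm_real, Real.norm_eq_abs, abs_of_pos hr, hrdef,
      div_self (norm_ne_zero_iff.2 hx0), one_mul] at hvI
    exact hvI
  obtain ⟨i2, k2⟩ := key _ hyI
  rw [hpush] at i2 k2
  refine ⟨i1, i2, ?_⟩
  set Y := ‖v‖ with hY
  have hY0 : 0 ≤ Y := norm_nonneg _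
  set D := ‖d‖ with hD
  have hD0 : 0 ≤ D := norm_nonneg _
  have hD2 : D ^ 2 = 2 * Y * (Y + (starRingEnd ℂ n * y).re) := by
    have := norm_sub_mul_sq hnn y (-Y)
    rw [hD, hd]
    rw [show y - ((-Y : ℝ) : ℂ) * n = y + Y * n by push_cast; ring, hyn] at this
    rw [this]
    ring
  have hDre : D ^ 2 / (2 * ε) ≤ Y + (starRingEnd ℂ n * y).re := by
    have h0 : 0 ≤ Y + (starRingEnd ℂ n * y).re := by
      have h1 := Complex.abs_re_le_norm (starRingEnd ℂ n * y)
      rw [norm_mul, RCLike.norm_conj, hnn, one_mul, hyn] at h1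
      linarith [(abs_le.1 h1).1]
    rw [div_le_iff₀ (by positivity), hD2]
    nlinarith
  have hq1 : Y ^ 2 * quadForm a b n - 2 * C * Y * D ≤ quadForm a b y := by
    have h1 := (abs_le.1 (quadForm_sub_le a b y (((-Y : ℝ) : ℂ) * n))).1
    rw [quadForm_ofReal_mul, neg_sq, norm_ofReal_mul hnn, abs_neg, abs_of_nonneg hY0, hyn,
      show y - ((-Y : ℝ) : ℂ) * n = d by rw [hd]; push_cast; ring] at h1
    have h2 : (|a| + ‖b‖) * (D * (Y + Y)) ≤ C * (D * (Y + Y)) := by gcongr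
    linarith
  have hq2 : quadForm a b y - 2 * C * Y * D ≤ quadForm a b (-y + t * d) := by
    have h1 := (abs_le.1 (quadForm_sub_le a b (-y + t * d) (-y))).1
    rw [quadForm_neg, add_sub_cancel_left, norm_neg, hyn, norm_mul (t : ℂ) d, Complex.norm_real,
      Real.norm_eq_abs, abs_of_nonneg ht0] at h1
    have h2 : (|a| + ‖b‖) * (t * D * (‖-y + t * d‖ + Y)) ≤ C * (1 * D * (Y + Y)) := by
      gcongr
    linarith
  have hqn : c ≤ quadForm a b n := by linarith
  have hrI : (starRingEnd ℂ n * (-y + t * d)).re =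
      -(starRingEnd ℂ n * y).re + t * (Y + (starRingEnd ℂ n * y).re) := by
    have h1 : starRingEnd ℂ n * (-y + t * d) =
        -(starRingEnd ℂ n * y) + t * (starRingEnd ℂ n * y + Y * (starRingEnd ℂ n * n)) := by
      rw [hd]; ring
    rw [h1, Complex.conj_mul', hnn]
    simp only [Complex.ofReal_one, one_pow, mul_one, Complex.add_re, Complex.neg_re,
      Complex.re_ofReal_mul, Complex.ofReal_re]
    ring
  rw [hrI] at k2
  have hquad := quadratic_nonneg (A := L * ρ / (2 * ε)) (B := 3 * s * C * Y)
    (C := s * c / 2 * Y ^ 2) (by positivity) (by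
      have e1 : 4 * (L * ρ / (2 * ε)) * (s * c / 2 * Y ^ 2) = 9 * (s * C * Y) ^ 2 := by
        rw [hL]; field_simp
        ring
      rw [e1]
      exact le_of_eq (by ring)) D
  have t1 : L * ρ / (2 * ε) * D ^ 2 ≤ r * (‖β‖ * (starRingEnd ℂ n * y).re) +
      r * (‖β‖ * (-(starRingEnd ℂ n * y).re + t * (Y + (starRingEnd ℂ n * y).re))) := by
    calc L * ρ / (2 * ε) * D ^ 2 = L * ρ * (D ^ 2 / (2 * ε)) := by ring
      _ ≤ L * ‖β‖ * (Y + (starRingEnd ℂ n * y).re) := by gcongr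
      _ = _ := by rw [← htr]; ring
  have t2 : s * c * Y ^ 2 - 3 * s * C * Y * D ≤
      s * quadForm a b y / 2 + s * quadForm a b (-y + t * d) / 2 := by
    have h1 : 2 * (Y ^ 2 * c) - 6 * C * Y * D ≤ quadForm a b y + quadForm a b (-y + t * d) := by
      have : Y ^ 2 * c ≤ Y ^ 2 * quadForm a b n := by gcongr
      linarith
    calc s * c * Y ^ 2 - 3 * s * C * Y * D = s / 2 * (2 * (Y ^ 2 * c) - 6 * C * Y * D) := by ring
      _ ≤ s / 2 * (quadForm a b y + quadForm a b (-y + t * d)) := by gcongr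
      _ = _ := by ring
  have hsum : 0 ≤ (r * (‖β‖ * (starRingEnd ℂ n * y).re) + s * quadForm a b y / 2 -
          s * c / 4 * Y ^ 2) +
      (r * (‖β‖ * (-(starRingEnd ℂ n * y).re + t * (Y + (starRingEnd ℂ n * y).re))) +
        s * quadForm a b (-y + t * d) / 2 - s * c / 4 * Y ^ 2) := by
    linarith
  have hsum' := mul_nonneg (show 0 ≤ E / r ^ 2 by positivity) hsum
  rw [mul_add] at hsum'
  linarith

end

/-! ### The geometry of wedges -/

/-- The signed distance to the line that contains the upper side of the wedge. -/
noncomputable def upperForm (η : ℝ) (x : Plane) : ℝ :=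
  x 0 * Real.sin (η / 2) - x 1 * Real.cos (η / 2)

/-- The signed distance to the line that contains the lower side of the wedge. -/
noncomputable def lowerForm (η : ℝ) (x : Plane) : ℝ :=
  x 0 * Real.sin (η / 2) + x 1 * Real.cos (η / 2)

section Wedge

variable {η : ℝ}

theorem mem_wedge_iff (hη : η < 2 * Real.pi) (x : Plane) :
    x ∈ wedge η ↔ x ≠ 0 ∧ |(toC x).arg| < η / 2 := by
  constructor
  · rintro ⟨r, θ, hr, h1, h2, h3, h4⟩
    have hx : toC x = r * (Complex.cos θ + Complex.sin θ * Complex.I) := by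
      rw [← Complex.ofReal_cos, ← Complex.ofReal_sin]
      apply Complex.ext <;> simp [h3, h4, -Complex.ofReal_cos, -Complex.ofReal_sin]
    have harg : (toC x).arg = θ := by
      rw [hx]
      exact Complex.arg_mul_cos_add_sin_mul_I hr ⟨by linarith, by linarith⟩
    refine ⟨fun h0 => ?_, ?_⟩
    · have h5 := Real.sin_sq_add_cos_sq θ
      simp only [h0, PiLp.zero_apply] at h3 h4
      have h6 : Real.cos θ = 0 := (mul_eq_zero.1 h3.symm).resolve_left hr.ne'
      have h7 : Real.sin θ = 0 := (mul_eq_zero.1 h4.symm).resolve_left hr.ne'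
      rw [h6, h7] at h5
      norm_num at h5
    · rw [harg]
      exact abs_lt.2 ⟨h1, h2⟩
  · rintro ⟨h0, h1⟩
    have h2 := abs_lt.1 h1
    refine ⟨‖toC x‖, (toC x).arg, ?_, h2.1, h2.2, ?_, ?_⟩
    · rw [LinearIsometryEquiv.norm_map]
      exact norm_pos_iff.2 h0
    · rw [Complex.norm_mul_cos_arg, toC_re]
    · rw [Complex.norm_mul_sin_arg, toC_im]

theorem upperForm_eq (x : Plane) :
    upperForm η x = ‖x‖ * Real.sin (η / 2 - (toC x).arg) := by
  rw [Real.sin_sub, ← LinearIsometryEquiv.norm_map toC x, upperForm, ← toC_re, ← toC_im,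
    ← Complex.norm_mul_cos_arg, ← Complex.norm_mul_sin_arg]
  ring

theorem lowerForm_eq (x : Plane) :
    lowerForm η x = ‖x‖ * Real.sin (η / 2 + (toC x).arg) := by
  rw [Real.sin_add, ← LinearIsometryEquiv.norm_map toC x, lowerForm, ← toC_re, ← toC_im,
    ← Complex.norm_mul_cos_arg, ← Complex.norm_mul_sin_arg]
  ring

/-- A wedge of angle at most `π` is an intersection of two half planes; beyond `π` it becomes a
union, hence the separate lemma `mem_wedge_iff_or`. -/
theorem mem_wedge_iff_and (h0 : 0 < η) (hη : η ≤ Real.pi) (x : Plane) :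
    x ∈ wedge η ↔ 0 < upperForm η x ∧ 0 < lowerForm η x := by
  have hπ := Real.pi_pos
  have hs : 0 < Real.sin (η / 2) := Real.sin_pos_of_pos_of_lt_pi (by linarith) (by linarith)
  rw [mem_wedge_iff (by linarith)]
  constructor
  · rintro ⟨hx, h⟩
    have h2 := abs_lt.1 h
    have hr : 0 < ‖x‖ := norm_pos_iff.2 hx
    rw [upperForm_eq, lowerForm_eq]
    exact ⟨mul_pos hr (Real.sin_pos_of_pos_of_lt_pi (by linarith) (by linarith)),
      mul_pos hr (Real.sin_pos_of_pos_of_lt_pi (by linarith) (by linarith))⟩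
  · rintro ⟨h1, h2⟩
    have hx0 : 0 < x 0 := by
      have h3 : 0 < 2 * Real.sin (η / 2) * x 0 := by
        unfold upperForm at h1; unfold lowerForm at h2; linarith
      exact pos_of_mul_pos_right h3 (by positivity)
    have hx : x ≠ 0 := fun h => by simp [h] at hx0
    refine ⟨hx, ?_⟩
    have hr : 0 < ‖x‖ := norm_pos_iff.2 hx
    rw [← toC_re, ← Complex.norm_mul_cos_arg, LinearIsometryEquiv.norm_map] at hx0
    have harg : |(toC x).arg| < Real.pi / 2 := by
      rw [Complex.abs_arg_lt_pi_div_two_iff, ← Complex.norm_mul_cos_arg,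
        LinearIsometryEquiv.norm_map]
      exact Or.inl hx0
    have harg2 := abs_lt.1 harg
    rw [upperForm_eq] at h1
    rw [lowerForm_eq] at h2
    rw [abs_lt]
    constructor
    · by_contra! h3
      have := Real.sin_nonpos_of_nonpos_of_neg_pi_le (x := η / 2 + (toC x).arg) (by linarith)
        (by linarith)
      exact absurd (mul_nonpos_of_nonneg_of_nonpos hr.le this) (not_le.2 h2)
    · by_contra! h3
      have := Real.sin_nonpos_of_nonpos_of_neg_pi_le (x := η / 2 - (toC x).arg) (by linarith)
        (by linarith)
      exact absurd (mul_nonpos_of_nonneg_of_nonpos hr.le this) (not_le.2 h1)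

theorem sin_nonpos_of_pi_le {t : ℝ} (h1 : Real.pi ≤ t) (h2 : t ≤ 2 * Real.pi) :
    Real.sin t ≤ 0 := by
  rw [← Real.sin_sub_two_pi]
  exact Real.sin_nonpos_of_nonpos_of_neg_pi_le (by linarith) (by linarith)

theorem mem_wedge_iff_or (hη : Real.pi ≤ η) (hη2 : η < 2 * Real.pi) (x : Plane) :
    x ∈ wedge η ↔ 0 < upperForm η x ∨ 0 < lowerForm η x := by
  have hπ := Real.pi_pos
  rw [mem_wedge_iff hη2]
  constructor
  · rintro ⟨hx, h⟩
    have h2 := abs_lt.1 h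
    have hr : 0 < ‖x‖ := norm_pos_iff.2 hx
    rw [upperForm_eq, lowerForm_eq]
    rcases le_total 0 (toC x).arg with h3 | h3
    · exact Or.inl (mul_pos hr (Real.sin_pos_of_pos_of_lt_pi (by linarith) (by linarith)))
    · exact Or.inr (mul_pos hr (Real.sin_pos_of_pos_of_lt_pi (by linarith) (by linarith)))
  · intro h
    have hx : x ≠ 0 := by
      rintro rfl
      simp [upperForm, lowerForm] at h
    refine ⟨hx, ?_⟩
    by_contra! h1
    have hr : 0 ≤ ‖x‖ := norm_nonneg x
    rw [upperForm_eq, lowerForm_eq] at h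
    have hle := Complex.arg_le_pi (toC x)
    have hge := Complex.neg_pi_lt_arg (toC x)
    have h4 : Real.sin (η / 2 - (toC x).arg) ≤ 0 ∧ Real.sin (η / 2 + (toC x).arg) ≤ 0 := by
      rcases le_abs.1 h1 with h3 | h3
      · exact ⟨Real.sin_nonpos_of_nonpos_of_neg_pi_le (by linarith) (by linarith),
          sin_nonpos_of_pi_le (by linarith) (by linarith)⟩
      · exact ⟨sin_nonpos_of_pi_le (by linarith) (by linarith),
          Real.sin_nonpos_of_nonpos_of_neg_pi_le (by linarith) (by linarith)⟩
    rcases h with h | h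
    · exact absurd (mul_nonpos_of_nonneg_of_nonpos hr h4.1) (not_le.2 h)
    · exact absurd (mul_nonpos_of_nonneg_of_nonpos hr h4.2) (not_le.2 h)

theorem continuous_upperForm : Continuous (upperForm η) := by unfold upperForm; fun_prop

theorem continuous_lowerForm : Continuous (lowerForm η) := by unfold lowerForm; fun_prop

theorem isOpen_wedge (h0 : 0 < η) (hη : η < 2 * Real.pi) : IsOpen (wedge η) := by
  have h1 := isOpen_lt continuous_const (continuous_upperForm (η := η)) (f := fun _ => (0 : ℝ))
  have h2 := isOpen_lt continuous_const (continuous_lowerForm (η := η)) (f := fun _ => (0 : ℝ))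
  rcases le_total η Real.pi with h | h
  · convert! h1.inter h2 using 1
    ext x
    exact mem_wedge_iff_and h0 h x
  · convert! h1.union h2 using 1
    ext x
    exact mem_wedge_iff_or h hη x

theorem sin_half_pos (h0 : 0 < η) (hη : η < 2 * Real.pi) : 0 < Real.sin (η / 2) :=
  Real.sin_pos_of_pos_of_lt_pi (by linarith) (by linarith)

theorem abs_forms_le (x : Plane) : |upperForm η x| ≤ ‖x‖ ∧ |lowerForm η x| ≤ ‖x‖ := by
  constructor
  · rw [upperForm_eq, abs_mul, abs_of_nonneg (norm_nonneg x)]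
    exact mul_le_of_le_one_right (norm_nonneg x) (Real.abs_sin_le_one _)
  · rw [lowerForm_eq, abs_mul, abs_of_nonneg (norm_nonneg x)]
    exact mul_le_of_le_one_right (norm_nonneg x) (Real.abs_sin_le_one _)

theorem forms_smul_add (t : ℝ) (y : Plane) :
    t * Real.sin (η / 2) - ‖y‖ ≤ upperForm η (t • e₁ + y) ∧
      t * Real.sin (η / 2) - ‖y‖ ≤ lowerForm η (t • e₁ + y) := by
  have h1 : upperForm η (t • e₁ + y) = t * Real.sin (η / 2) + upperForm η y := by
    simp [upperForm, e₁]; ring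
  have h2 : lowerForm η (t • e₁ + y) = t * Real.sin (η / 2) + lowerForm η y := by
    simp [lowerForm, e₁]; ring
  obtain ⟨h3, h4⟩ := abs_forms_le (η := η) y
  rw [h1, h2]
  constructor
  · linarith [(abs_le.1 h3).1]
  · linarith [(abs_le.1 h4).1]

theorem upperForm_add (x y : Plane) : upperForm η (x + y) = upperForm η x + upperForm η y := by
  simp [upperForm]; ring

theorem lowerForm_add (x y : Plane) : lowerForm η (x + y) = lowerForm η x + lowerForm η y := by
  simp [lowerForm]; ring

/-- The wedge contains a cone around the first axis. -/
theorem smul_add_mem_wedge (h0 : 0 < η) (hη : η < 2 * Real.pi) {t : ℝ} {y : Plane}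
    (hy : ‖y‖ < t * Real.sin (η / 2)) : t • e₁ + y ∈ wedge η := by
  obtain ⟨h1, h2⟩ := forms_smul_add (η := η) t y
  rcases le_total η Real.pi with h | h
  · rw [mem_wedge_iff_and h0 h]; constructor <;> linarith
  · rw [mem_wedge_iff_or h hη]; left; linarith

/-- The wedge is invariant under the translations by a cone around the first axis. -/
theorem add_mem_wedge (h0 : 0 < η) (hη : η < 2 * Real.pi) {x : Plane} (hx : x ∈ wedge η) {t : ℝ}
    {y : Plane} (hy : ‖y‖ < t * Real.sin (η / 2)) : x + (t • e₁ + y) ∈ wedge η := by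
  obtain ⟨h1, h2⟩ := forms_smul_add (η := η) t y
  rcases le_total η Real.pi with h | h
  · rw [mem_wedge_iff_and h0 h] at hx ⊢
    rw [upperForm_add, lowerForm_add]
    constructor <;> linarith [hx.1, hx.2]
  · rw [mem_wedge_iff_or h hη] at hx ⊢
    rw [upperForm_add, lowerForm_add]
    rcases hx with hx | hx
    · left; linarith
    · right; linarith

theorem zero_mem_frontier_wedge (h0 : 0 < η) (hη : η < 2 * Real.pi) :
    (0 : Plane) ∈ frontier (wedge η) := by
  rw [(isOpen_wedge h0 hη).frontier_eq]
  refine ⟨?_, fun h => ((mem_wedge_iff hη 0).1 h).1 rfl⟩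
  have h1 : Filter.Tendsto (fun t : ℝ => t • e₁) (nhdsWithin 0 (Ioi 0)) (nhds (0 : Plane)) := by
    have : Continuous fun t : ℝ => t • e₁ := by fun_prop
    have h2 := this.tendsto 0
    rw [zero_smul] at h2
    exact h2.mono_left nhdsWithin_le_nhds
  refine mem_closure_of_tendsto h1 ?_
  filter_upwards [self_mem_nhdsWithin] with t ht
  have := smul_add_mem_wedge h0 hη (t := t) (y := 0)
    (by rw [norm_zero]; exact mul_pos ht (sin_half_pos h0 hη))
  rwa [add_zero] at this

/-- The ball is connected and misses the frontier, so it cannot meet both `D` and the exterior. -/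
theorem ball_subset_of_le_infDist {D : Set Plane} (hD : IsOpen D) {x : Plane} (hx : x ∈ D) {ρ : ℝ}
    (hρ : ρ ≤ Metric.infDist x (frontier D)) : Metric.ball x ρ ⊆ D := by
  rcases le_or_gt ρ 0 with h0 | h0
  · rw [Metric.ball_eq_empty.2 h0]
    exact empty_subset _
  refine IsPreconnected.subset_left_of_subset_union hD isClosed_closure.isOpen_compl
    (disjoint_compl_right_iff_subset.2 subset_closure) (fun y hy => ?_)
    ⟨x, Metric.mem_ball_self h0, hx⟩ (convex_ball x ρ).isPreconnected
  by_contra h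
  simp only [mem_union, mem_compl_iff, not_or, not_not] at h
  have h1 : y ∈ frontier D := by
    rw [hD.frontier_eq]
    exact ⟨h.2, h.1⟩
  have h2 := Metric.infDist_le_dist_of_mem (x := x) h1
  rw [Metric.mem_ball, dist_comm] at hy
  linarith

theorem le_infDist_wedge (h0 : 0 < η) (hη : η < 2 * Real.pi) {x : Plane} {ρ : ℝ}
    (hρ : Metric.ball x ρ ⊆ wedge η) : ρ ≤ Metric.infDist x (frontier (wedge η)) := by
  -- The apex shows that the frontier is nonempty; the distance to the empty set would be `0` by
  -- default.
  rw [Metric.le_infDist ⟨0, zero_mem_frontier_wedge h0 hη⟩]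
  intro y hy
  by_contra! h
  rw [(isOpen_wedge h0 hη).frontier_eq] at hy
  exact hy.2 (hρ (by rwa [Metric.mem_ball, dist_comm]))

theorem infDist_smul_add_wedge (h0 : 0 < η) (hη : η < 2 * Real.pi) (t : ℝ) (y : Plane) :
    t * Real.sin (η / 2) - ‖y‖ ≤ Metric.infDist (t • e₁ + y) (frontier (wedge η)) := by
  refine le_infDist_wedge h0 hη fun z hz => ?_
  have h1 : z = t • e₁ + (z - t • e₁) := by abel
  rw [h1]
  refine smul_add_mem_wedge h0 hη ?_
  rw [Metric.mem_ball, dist_eq_norm] at hz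
  calc ‖z - t • e₁‖ = ‖(z - (t • e₁ + y)) + y‖ := by congr 1; abel
    _ ≤ ‖z - (t • e₁ + y)‖ + ‖y‖ := norm_add_le _ _
    _ < _ := by linarith

theorem infDist_add_wedge (h0 : 0 < η) (hη : η < 2 * Real.pi) {x : Plane} (hx : x ∈ wedge η) {t : ℝ}
    {y : Plane} (hy : ‖y‖ < t * Real.sin (η / 2)) :
    Metric.infDist x (frontier (wedge η)) ≤
      Metric.infDist (x + (t • e₁ + y)) (frontier (wedge η)) := by
  refine le_infDist_wedge h0 hη fun z hz => ?_
  have h1 : z = (z - (t • e₁ + y)) + (t • e₁ + y) := by abel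
  rw [h1]
  refine add_mem_wedge h0 hη ?_ hy
  refine ball_subset_of_le_infDist (isOpen_wedge h0 hη) hx le_rfl ?_
  rw [Metric.mem_ball, dist_eq_norm] at hz ⊢
  calc ‖z - (t • e₁ + y) - x‖ = ‖z - (x + (t • e₁ + y))‖ := by congr 1; abel
    _ < _ := hz

/-- The points of a smaller sector are far from the boundary of the wedge. -/
theorem exists_infDist_sector (h0 : 0 < η) (hη : η < 2 * Real.pi) {h : ℝ} (hh : h < η / 2) :
    ∃ δ > 0, ∀ x : Plane, |(toC x).arg| ≤ h →
      δ * ‖x‖ ≤ Metric.infDist x (frontier (wedge η)) := by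
  obtain ⟨hK, -⟩ := isCompact_arc (h := h) (by linarith)
  have hopen : IsOpen (toC.symm ⁻¹' wedge η) :=
    (isOpen_wedge h0 hη).preimage toC.symm.continuous
  have hmem : ∀ z : ℂ, toC.symm z ∈ wedge η ↔ z ≠ 0 ∧ |z.arg| < η / 2 := by
    intro z
    rw [mem_wedge_iff hη, LinearIsometryEquiv.apply_symm_apply]
    simp
  obtain ⟨δ, hδ, hsub⟩ := hK.exists_thickening_subset_open hopen (by
    rintro z ⟨h1, h2⟩
    refine (hmem z).2 ⟨fun h => ?_, h2.trans_lt hh⟩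
    rw [h, norm_zero] at h1
    exact zero_ne_one h1)
  refine ⟨δ, hδ, fun x hx => ?_⟩
  rcases eq_or_ne x 0 with rfl | hx0
  · rw [norm_zero, mul_zero]; exact Metric.infDist_nonneg
  have hr : 0 < ‖x‖ := norm_pos_iff.2 hx0
  refine le_infDist_wedge h0 hη fun y hy => ?_
  have h1 : ((‖x‖⁻¹ : ℝ) : ℂ) * toC y ∈ toC.symm ⁻¹' wedge η := by
    refine hsub (Metric.mem_thickening_iff.2 ⟨((‖x‖⁻¹ : ℝ) : ℂ) * toC x, ⟨?_, ?_⟩, ?_⟩)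
    · rw [norm_mul, Complex.norm_real, LinearIsometryEquiv.norm_map, Real.norm_eq_abs,
        abs_of_pos (inv_pos.2 hr), inv_mul_cancel₀ hr.ne']
    · rwa [Complex.arg_real_mul _ (inv_pos.2 hr)]
    · rw [dist_eq_norm, ← mul_sub, norm_mul, Complex.norm_real, Real.norm_eq_abs,
        abs_of_pos (inv_pos.2 hr), ← map_sub, LinearIsometryEquiv.norm_map, ← dist_eq_norm,
        inv_mul_lt_iff₀ hr, mul_comm]
      exact hy
  rw [mem_preimage, hmem, Complex.arg_real_mul _ (inv_pos.2 hr)] at h1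
  rw [mem_wedge_iff hη]
  refine ⟨fun h => ?_, h1.2⟩
  rw [h, map_zero, mul_zero] at h1
  exact h1.1 rfl

end Wedge

/-! ### Ending the game at a nearby boundary point -/

section Exit

variable {η : ℝ}

/-- The projection to the ray spanned by the unit vector `u`. -/
noncomputable def rayProj (u : ℂ) (x : Plane) : Plane :=
  toC.symm ((max 0 (starRingEnd ℂ u * toC x).re : ℝ) * u)

theorem continuous_rayProj (u : ℂ) : Continuous (rayProj u) := by
  unfold rayProj
  have := toC.continuous
  have h2 := toC.symm.continuous
  fun_prop

theorem dist_rayProj_le {u : ℂ} (hu : ‖u‖ = 1) (x : Plane) {t : ℝ} (ht : 0 ≤ t) :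
    dist (rayProj u x) x ≤ dist x (toC.symm (t * u)) := by
  have h1 : ∀ s : ℝ, dist x (toC.symm (s * u)) = ‖toC x - s * u‖ := by
    intro s
    rw [dist_eq_norm, ← LinearIsometryEquiv.norm_map toC, map_sub,
      LinearIsometryEquiv.apply_symm_apply]
  unfold rayProj
  rw [dist_comm, h1, h1]
  refine (sq_le_sq₀ (norm_nonneg _) (norm_nonneg _)).1 ?_
  rw [norm_sub_mul_sq hu, norm_sub_mul_sq hu]
  set a := (starRingEnd ℂ u * toC x).re
  rcases le_total 0 a with h | h
  · rw [max_eq_right h]; nlinarith [sq_nonneg (t - a)]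
  · rw [max_eq_left h]; nlinarith [mul_nonneg ht (neg_nonneg.2 h)]

/-- The directions of the sides of the wedge. -/
noncomputable def sideDir (t : ℝ) : ℂ := ⟨Real.cos t, Real.sin t⟩

theorem norm_sideDir (t : ℝ) : ‖sideDir t‖ = 1 := by
  have : ‖sideDir t‖ ^ 2 = 1 := by
    rw [← Complex.normSq_eq_norm_sq, Complex.normSq_apply, sideDir]
    linear_combination Real.sin_sq_add_cos_sq t
  exact (pow_eq_one_iff_of_nonneg (norm_nonneg _) two_ne_zero).1 this

theorem coe_mul_sideDir (s t : ℝ) :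
    (toC.symm (s * sideDir t)) 0 = s * Real.cos t ∧
      (toC.symm (s * sideDir t)) 1 = s * Real.sin t := by
  simp [toC_symm_apply, sideDir]

theorem side_mem_frontier (h0 : 0 < η) (hη : η < Real.pi) {s t : ℝ} (hs : 0 ≤ s)
    (ht : t = η / 2 ∨ t = -(η / 2)) : toC.symm (s * sideDir t) ∈ frontier (wedge η) := by
  have hπ := Real.pi_pos
  have hη2 : η < 2 * Real.pi := by linarith
  have hsin := sin_half_pos h0 hη2
  have hcos : 0 < Real.cos (η / 2) := Real.cos_pos_of_mem_Ioo ⟨by linarith, by linarith⟩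
  obtain ⟨e0, e1⟩ := coe_mul_sideDir s t
  have hform : (upperForm η (toC.symm (s * sideDir t)) = 0 ∧
      0 ≤ lowerForm η (toC.symm (s * sideDir t))) ∨
      (lowerForm η (toC.symm (s * sideDir t)) = 0 ∧
      0 ≤ upperForm η (toC.symm (s * sideDir t))) := by
    rcases ht with rfl | rfl
    · left
      unfold upperForm lowerForm
      rw [e0, e1]
      exact ⟨by ring, by positivity⟩
    · right
      unfold upperForm lowerForm
      rw [e0, e1, Real.cos_neg, Real.sin_neg]
      refine ⟨by ring, ?_⟩
      have : 0 ≤ s * Real.cos (η / 2) * Real.sin (η / 2) := by positivity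
      linarith
  set y := toC.symm (s * sideDir t)
  rw [(isOpen_wedge h0 hη2).frontier_eq]
  constructor
  · have h1 : Filter.Tendsto (fun r : ℝ => y + r • e₁) (nhdsWithin 0 (Ioi 0)) (nhds y) := by
      have : Continuous fun r : ℝ => y + r • e₁ := by fun_prop
      have h2 := this.tendsto 0
      rw [zero_smul, add_zero] at h2
      exact h2.mono_left nhdsWithin_le_nhds
    refine mem_closure_of_tendsto h1 ?_
    filter_upwards [self_mem_nhdsWithin] with r hr
    obtain ⟨h3, h4⟩ := forms_smul_add (η := η) r 0
    rw [norm_zero, sub_zero, add_zero] at h3 h4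
    have h5 := mul_pos (show 0 < r from hr) hsin
    rw [mem_wedge_iff_and h0 hη.le, upperForm_add, lowerForm_add]
    rcases hform with ⟨h6, h7⟩ | ⟨h6, h7⟩ <;> constructor <;> linarith
  · intro h
    rw [mem_wedge_iff_and h0 hη.le] at h
    rcases hform with ⟨h6, h7⟩ | ⟨h6, h7⟩ <;> linarith [h.1, h.2]

theorem exists_side_of_mem_frontier (h0 : 0 < η) (hη : η < Real.pi) {y : Plane}
    (hy : y ∈ frontier (wedge η)) :
    ∃ s : ℝ, 0 ≤ s ∧ (y = toC.symm (s * sideDir (η / 2)) ∨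
      y = toC.symm (s * sideDir (-(η / 2)))) := by
  have hπ := Real.pi_pos
  have hη2 : η < 2 * Real.pi := by linarith
  have hsin := sin_half_pos h0 hη2
  have hcos : 0 < Real.cos (η / 2) := Real.cos_pos_of_mem_Ioo ⟨by linarith, by linarith⟩
  rw [(isOpen_wedge h0 hη2).frontier_eq] at hy
  obtain ⟨h1, h2⟩ := hy
  have hclosed : IsClosed {x : Plane | 0 ≤ upperForm η x ∧ 0 ≤ lowerForm η x} :=
    (isClosed_le continuous_const continuous_upperForm).inter
      (isClosed_le continuous_const continuous_lowerForm)
  have h3 : 0 ≤ upperForm η y ∧ 0 ≤ lowerForm η y :=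
    closure_minimal (fun x hx => by
      rw [mem_wedge_iff_and h0 hη.le] at hx
      exact ⟨hx.1.le, hx.2.le⟩) hclosed h1
  rw [mem_wedge_iff_and h0 hη.le, not_and_or, not_lt, not_lt] at h2
  have hy0 : 0 ≤ y 0 := by
    have : 0 ≤ 2 * Real.sin (η / 2) * y 0 := by
      unfold upperForm lowerForm at h3
      linarith [h3.1, h3.2]
    exact nonneg_of_mul_nonneg_right this (by positivity)
  refine ⟨y 0 / Real.cos (η / 2), by positivity, ?_⟩
  rcases h2 with h2 | h2
  · left
    have h4 : y 0 * Real.sin (η / 2) = y 1 * Real.cos (η / 2) := by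
      unfold upperForm at h2 h3; linarith [h3.1]
    obtain ⟨e0, e1⟩ := coe_mul_sideDir (y 0 / Real.cos (η / 2)) (η / 2)
    ext i
    fin_cases i
    · change y 0 = (toC.symm _) 0
      rw [e0]; field_simp
    · change y 1 = (toC.symm _) 1
      rw [e1]; field_simp; linarith
  · right
    have h4 : y 0 * Real.sin (η / 2) = -(y 1 * Real.cos (η / 2)) := by
      unfold lowerForm at h2 h3; linarith [h3.2]
    obtain ⟨e0, e1⟩ := coe_mul_sideDir (y 0 / Real.cos (η / 2)) (-(η / 2))
    rw [Real.cos_neg] at e0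
    rw [Real.sin_neg] at e1
    ext i
    fin_cases i
    · change y 0 = (toC.symm _) 0
      rw [e0]; field_simp
    · change y 1 = (toC.symm _) 1
      rw [e1]; field_simp; linarith

/-- A measurable choice of a boundary point at minimal distance. -/
theorem exists_measurable_exit (h0 : 0 < η) (hη : η < Real.pi) (ρ : ℝ) :
    ∃ P : Plane → Plane, Measurable P ∧ ∀ x, Metric.infDist x (frontier (wedge η)) ≤ ρ →
      P x ∈ frontier (wedge η) ∧ dist (P x) x ≤ ρ := by
  classical
  set P₁ := rayProj (sideDir (η / 2))
  set P₂ := rayProj (sideDir (-(η / 2)))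
  have hc₁ : Continuous P₁ := continuous_rayProj _
  have hc₂ : Continuous P₂ := continuous_rayProj _
  refine ⟨fun x => if dist (P₁ x) x ≤ ρ then P₁ x else P₂ x, ?_, fun x hx => ?_⟩
  · exact Measurable.ite (measurableSet_le (hc₁.dist continuous_id).measurable measurable_const)
      hc₁.measurable hc₂.measurable
  · have hm₁ : P₁ x ∈ frontier (wedge η) := side_mem_frontier h0 hη (le_max_left _ _) (Or.inl rfl)
    have hm₂ : P₂ x ∈ frontier (wedge η) := side_mem_frontier h0 hη (le_max_left _ _) (Or.inr rfl)
    -- A nearest boundary point lies on one of the two sides, and the projection to that side is at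
    -- least as near.
    obtain ⟨y, hy, hxy⟩ := isClosed_frontier.exists_infDist_eq_dist ⟨P₁ x, hm₁⟩ x
    obtain ⟨s, hs, h⟩ := exists_side_of_mem_frontier h0 hη hy
    simp only
    split_ifs with hd
    · exact ⟨hm₁, hd⟩
    · refine ⟨hm₂, ?_⟩
      rcases h with h | h
      · refine absurd ?_ hd
        rw [hxy, h] at hx
        exact (dist_rayProj_le (norm_sideDir _) x hs).trans hx
      · rw [hxy, h] at hx
        exact (dist_rayProj_le (norm_sideDir _) x hs).trans hx

end Exit

/-! ### Integrals over one turn -/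

section Turn

variable {D : Set Plane} {ε : ℝ} {μ : Measure Plane}

theorem lintegral_turn [IsProbabilityMeasure μ] (S₁ S₂ : Strategy D (alpha μ) ε) (k : ℕ)
    (h : Hist k)
    (Φ : Plane × Plane → ℝ≥0∞) :
    ∫⁻ y, Φ y ∂(turn μ S₁ S₂ k h) =
      2⁻¹ * ∫⁻ y, Φ y ∂(moveLaw μ S₁ k h) + 2⁻¹ * ∫⁻ y, Φ y ∂(moveLaw μ S₂ k h) := by
  change ∫⁻ y, Φ y ∂((2⁻¹ : ℝ≥0∞) • moveLaw μ S₁ k h + (2⁻¹ : ℝ≥0∞) • moveLaw μ S₂ k h) = _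
  rw [lintegral_add_measure, lintegral_smul_measure, lintegral_smul_measure]
  rfl

theorem lintegral_moveLaw_frontier (S : Strategy D (alpha μ) ε) (k : ℕ) (h : Hist k)
    (hf : h.pos ∈ frontier D) {Φ : Plane → ℝ≥0∞} (hΦ : Measurable Φ) :
    ∫⁻ y, Φ y.2 ∂(moveLaw μ S k h) = Φ h.pos := by
  rw [moveLaw, if_pos hf]
  exact lintegral_dirac' (0, h.pos) (hΦ.comp measurable_snd)

theorem lintegral_moveLaw_shallow (S : Strategy D (alpha μ) ε) (k : ℕ) (h : Hist k)
    (hf : h.pos ∉ frontier D) (hd : Metric.infDist h.pos (frontier D) ≤ alpha μ * ε)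
    {Φ : Plane → ℝ≥0∞} (hΦ : Measurable Φ) :
    ∫⁻ y, Φ y.2 ∂(moveLaw μ S k h) = Φ (S.exit k h) := by
  rw [moveLaw, if_neg hf, if_neg (not_lt.2 hd)]
  exact lintegral_dirac' (0, S.exit k h) (hΦ.comp measurable_snd)

theorem lintegral_moveLaw_deep (S : Strategy D (alpha μ) ε) (k : ℕ) (h : Hist k)
    (hf : h.pos ∉ frontier D) (hd : alpha μ * ε < Metric.infDist h.pos (frontier D))
    {Φ : Plane → ℝ≥0∞} (hΦ : Measurable Φ) :
    ∫⁻ y, Φ y.2 ∂(moveLaw μ S k h) =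
      ∫⁻ z, Φ (toC.symm (toC h.pos + toC (S.tug k h) * tugFactor z)) ∂μ := by
  have hs : Measurable (similarity (S.tug k h)) := measurable_similarity.comp measurable_prodMk_left
  rw [moveLaw, if_neg hf, if_pos hd, noiseAt, Measure.map_map (by fun_prop) hs]
  refine (lintegral_map (f := fun y : Plane × Plane => Φ y.2) (hΦ.comp measurable_snd)
    (Measurable.comp (by fun_prop) hs)).trans ?_
  simp only [Function.comp_apply, add_similarity]

/-- After a tug the position stays in the domain. -/
theorem ae_mem_of_deep [IsProbabilityMeasure μ] (hμ : IsNoise μ) (hD : IsOpen D) (hε : 0 < ε)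
    {x v : Plane} (hx : x ∈ D)
    (hd : alpha μ * ε < Metric.infDist x (frontier D)) (hv : ‖v‖ ≤ ε) :
    ∀ᵐ z ∂μ, toC.symm (toC x + toC v * tugFactor z) ∈ D := by
  filter_upwards [ae_norm_tugFactor_le hμ] with z hz
  refine ball_subset_of_le_infDist hD hx le_rfl ?_
  rw [Metric.mem_ball, dist_eq_norm, ← LinearIsometryEquiv.norm_map toC, map_sub,
    LinearIsometryEquiv.apply_symm_apply, add_sub_cancel_left, norm_mul,
    LinearIsometryEquiv.norm_map]
  calc ‖v‖ * ‖tugFactor z‖ ≤ ε * alpha μ := by gcongr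
    _ < _ := by rwa [mul_comm]

end Turn

/-! ### Ending the game in a narrow wedge -/

section Narrow

variable {η p ε : ℝ} {μ : Measure Plane}

theorem toC_smul_e₁ (t : ℝ) : toC (t • e₁) = (t : ℂ) := by
  rw [map_smul, toC_e₁, Complex.real_smul, mul_one]

theorem shift_mem_wedge (h0 : 0 < η) (hη : η ≤ Real.pi) {x : Plane} (hx : x ∈ wedge η) {M : ℝ}
    (hM : 0 < M) :
    M * Real.sin (η / 2) ≤ ‖toC x + (M : ℂ)‖ ∧ |(toC x + (M : ℂ)).arg| < η / 2 := by
  have hπ := Real.pi_pos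
  have hη2 : η < 2 * Real.pi := by linarith
  have hs := sin_half_pos h0 hη2
  have hxM : toC x + (M : ℂ) = toC (x + M • e₁) := by rw [map_add, toC_smul_e₁]
  rw [hxM]
  constructor
  · rw [LinearIsometryEquiv.norm_map]
    refine le_trans ?_ ((le_abs_self _).trans (abs_forms_le (η := η) (x + M • e₁)).1)
    have h1 := (forms_smul_add (η := η) M 0).1
    rw [norm_zero, sub_zero, add_zero] at h1
    rw [upperForm_add]
    linarith [((mem_wedge_iff_and h0 hη x).1 hx).1]
  · have := add_mem_wedge h0 hη2 hx (t := M) (y := 0) (by rw [norm_zero]; positivity)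
    rw [add_zero] at this
    exact ((mem_wedge_iff hη2 _).1 this).2

theorem half_ofReal_add_half_ofReal_add_one_le {A B C : ℝ} (hA : 0 ≤ A) (hB : 0 ≤ B)
    (h : A / 2 + B / 2 + 1 ≤ C) :
    2⁻¹ * ENNReal.ofReal A + 2⁻¹ * ENNReal.ofReal B + 1 ≤ ENNReal.ofReal C := by
  have h2 : (2⁻¹ : ℝ≥0∞) = ENNReal.ofReal 2⁻¹ := by
    rw [ENNReal.ofReal_inv_of_pos two_pos, ENNReal.ofReal_ofNat]
  rw [h2, ← ENNReal.ofReal_mul (by norm_num), ← ENNReal.ofReal_mul (by norm_num),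
    ← ENNReal.ofReal_add (by positivity) (by positivity), ← ENNReal.ofReal_one,
    ← ENNReal.ofReal_add (by positivity) zero_le_one]
  exact ENNReal.ofReal_le_ofReal (by linarith)

open Classical in
/-- A nonnegative function on `D`, extended by zero to the boundary and by `∞` elsewhere. -/
noncomputable def barrier (D : Set Plane) (G : Plane → ℝ) (x : Plane) : ℝ≥0∞ :=
  if x ∈ D then ENNReal.ofReal (G x) else if x ∈ frontier D then 0 else ∞

theorem measurable_barrier {D : Set Plane} (hD : IsOpen D) {G : Plane → ℝ} (hG : Measurable G) :
    Measurable (barrier D G) := by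
  classical
  exact Measurable.ite hD.measurableSet hG.ennreal_ofReal
    (Measurable.ite isClosed_frontier.measurableSet measurable_const measurable_const)

theorem notMem_of_mem_frontier {D : Set Plane} (hD : IsOpen D) {x : Plane} (hx : x ∈ frontier D) :
    x ∉ D := by
  rw [hD.frontier_eq] at hx
  exact hx.2

theorem barrier_of_mem {D : Set Plane} {G : Plane → ℝ} {x : Plane} (hx : x ∈ D) :
    barrier D G x = ENNReal.ofReal (G x) := if_pos hx

theorem barrier_of_frontier {D : Set Plane} (hD : IsOpen D) {G : Plane → ℝ} {x : Plane}
    (hx : x ∈ frontier D) : barrier D G x = 0 := by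
  rw [barrier, if_neg (notMem_of_mem_frontier hD hx), if_pos hx]

/-- If the average of `G` over a turn from a deep position drops by one, then `G` bounds the
expected time to end the game. -/
theorem expectedTime_le_of_drop [IsProbabilityMeasure μ] (hμ : IsNoise μ) {D : Set Plane}
    (hD : IsOpen D) (hε : 0 < ε) (S₁ S₂ : Strategy D (alpha μ) ε) {G : Plane → ℝ}
    (hG : Measurable G) (hG1 : ∀ x ∈ D, 1 ≤ G x)
    (hstep : ∀ n (h : Hist n), h.pos ∈ D →
      Integrable (fun z => G (toC.symm (toC h.pos + toC (S₁.tug n h) * tugFactor z))) μ ∧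
      Integrable (fun z => G (toC.symm (toC h.pos + toC (S₂.tug n h) * tugFactor z))) μ ∧
      (∫ z, G (toC.symm (toC h.pos + toC (S₁.tug n h) * tugFactor z)) ∂μ) / 2 +
        (∫ z, G (toC.symm (toC h.pos + toC (S₂.tug n h) * tugFactor z)) ∂μ) / 2 + 1 ≤ G h.pos)
    {x : Plane} (hx : x ∈ D) : expectedTime μ S₁ S₂ x ≤ ENNReal.ofReal (G x) := by
  rw [← barrier_of_mem (G := G) hx]
  have hU := measurable_barrier hD hG
  refine expectedTime_le S₁ S₂ hU (fun n h => ?_) x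
  rw [lintegral_turn]
  by_cases hf : h.pos ∈ frontier D
  · rw [lintegral_moveLaw_frontier S₁ n h hf hU, lintegral_moveLaw_frontier S₂ n h hf hU,
      barrier_of_frontier hD hf]
    simp [hf]
  by_cases hx : h.pos ∈ D
  swap
  · rw [barrier, if_neg hx, if_neg hf]
    exact le_top
  rw [indicator_of_mem (by exact hf), Pi.one_apply, barrier_of_mem hx]
  rcases le_or_gt (Metric.infDist h.pos (frontier D)) (alpha μ * ε) with hd | hd
  -- Both players end the game, so the next value of the barrier is `0` and `1 ≤ G` pays for this
  -- last turn.
  · rw [lintegral_moveLaw_shallow S₁ n h hf hd hU, lintegral_moveLaw_shallow S₂ n h hf hd hU,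
      barrier_of_frontier hD (S₁.exit_mem n h hx hd).1,
      barrier_of_frontier hD (S₂.exit_mem n h hx hd).1, mul_zero, zero_add, zero_add,
      ← ENNReal.ofReal_one]
    exact ENNReal.ofReal_le_ofReal (hG1 _ hx)
  · obtain ⟨i1, i2, hle⟩ := hstep n h hx
    have key : ∀ S : Strategy D (alpha μ) ε,
        Integrable (fun z => G (toC.symm (toC h.pos + toC (S.tug n h) * tugFactor z))) μ →
        ∫⁻ y, barrier D G y.2 ∂(moveLaw μ S n h) =
          ENNReal.ofReal (∫ z, G (toC.symm (toC h.pos + toC (S.tug n h) * tugFactor z)) ∂μ) ∧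
        0 ≤ ∫ z, G (toC.symm (toC h.pos + toC (S.tug n h) * tugFactor z)) ∂μ := by
      intro S hi
      have hae := ae_mem_of_deep hμ hD hε hx hd (S.norm_tug_le n h)
      have hnn : 0 ≤ᵐ[μ] fun z => G (toC.symm (toC h.pos + toC (S.tug n h) * tugFactor z)) := by
        filter_upwards [hae] with z hz
        exact zero_le_one.trans (hG1 _ hz)
      refine ⟨?_, integral_nonneg_of_ae hnn⟩
      rw [lintegral_moveLaw_deep S n h hf hd hU, ofReal_integral_eq_lintegral_ofReal hi hnn]
      refine lintegral_congr_ae ?_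
      filter_upwards [hae] with z hz
      exact barrier_of_mem hz
    obtain ⟨e1, n1⟩ := key S₁ i1
    obtain ⟨e2, n2⟩ := key S₂ i2
    rw [e1, e2]
    exact half_ofReal_add_half_ofReal_add_one_le n1 n2 hle

/-- In a wedge narrower than the critical angle, player II can end the game in finite expected
time. -/
theorem exists_fast_strategy [IsProbabilityMeasure μ] (hp : 1 < p) (hμ : IsNoise μ)
    (hpμ : exponent μ = p) (h0 : 0 < η) (hη : η < 2 * criticalHalfAngle p) (hε : 0 < ε) :
    ∃ S₂ : Strategy (wedge η) (alpha μ) ε, ∀ S₁ : Strategy (wedge η) (alpha μ) ε,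
      ∀ x₀ ∈ wedge η, expectedTime μ S₁ S₂ x₀ < ⊤ := by
  have hπ := Real.pi_pos
  have hηπ : η < Real.pi := by linarith [criticalHalfAngle_le hp]
  have hη2 : η < 2 * Real.pi := by linarith
  have hs := sin_half_pos h0 hη2
  obtain ⟨f, f₁, f₂, hf, hf₁, hf₂, hpos, hG, h', hh', hh'π, hfpos⟩ :=
    exists_superprofile (h := η / 2) hp (by linarith)
  obtain ⟨R, hR, c, hc, hstep⟩ := supersolution_step hp hμ hpμ hf hf₁ hf₂ hpos hG hh'π hε
  have hfc : Continuous f := continuous_iff_continuousAt.2 fun θ => (hf θ).continuousAt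
  have hfc₁ : Continuous f₁ := continuous_iff_continuousAt.2 fun θ => (hf₁ θ).continuousAt
  -- After translation by `M` along the axis, the whole wedge lies at distance at least `R` from the
  -- origin and inside the same sector.
  set M := R / Real.sin (η / 2) with hM
  have hM0 : 0 < M := by positivity
  have hMs : M * Real.sin (η / 2) = R := div_mul_cancel₀ _ hs.ne'
  obtain ⟨P, hP, hP2⟩ := exists_measurable_exit h0 hηπ (alpha μ * ε)
  set T : ℂ → ℂ := fun X => -(ε * gradDir 2 f f₁ X)
  have hshift : ∀ x ∈ wedge η, R ≤ ‖toC x + (M : ℂ)‖ ∧ |(toC x + (M : ℂ)).arg| ≤ h' ∧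
      0 < homog 2 f (toC x + M) := by
    intro x hx
    obtain ⟨h1, h2⟩ := shift_mem_wedge h0 hηπ.le hx hM0
    rw [hMs] at h1
    have h3 : |(toC x + (M : ℂ)).arg| ≤ h' := by linarith
    exact ⟨h1, h3, mul_pos (Real.exp_pos _) (hfpos _ (by rwa [Complex.log_im]))⟩
  have htoC : Continuous toC := toC.continuous
  have htoCs : Continuous toC.symm := toC.symm.continuous
  have hTm : Measurable T := ((measurable_gradDir hfc hfc₁).const_mul _).neg
  have hTn : ∀ X, ‖T X‖ ≤ ε := by
    intro X
    rw [norm_neg, norm_mul, Complex.norm_real, Real.norm_eq_abs, abs_of_pos hε]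
    exact mul_le_of_le_one_right hε.le (norm_gradDir_le _ _ _ _)
  have hpm : ∀ k, Measurable fun h : Hist k => h.pos := fun k => Hist.measurable_pos
  let S₂ : Strategy (wedge η) (alpha μ) ε :=
    { tug := fun k h => toC.symm (T (toC h.pos + M))
      measurable_tug := fun k => htoCs.measurable.comp
        (hTm.comp ((htoC.measurable.comp (hpm k)).add_const _))
      norm_tug_le := fun k h => by rw [LinearIsometryEquiv.norm_map]; exact hTn _
      exit := fun k h => P h.pos
      measurable_exit := fun k => hP.comp (hpm k)
      exit_mem := fun k h _ hd => hP2 _ hd }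
  refine ⟨S₂, fun S₁ x₀ hx₀ => ?_⟩
  -- Dividing by `c` normalizes the drop per turn to `1`; the summand `1` gives the lower bound
  -- needed for the turn that ends the game.
  set G : Plane → ℝ := fun x => homog 2 f (toC x + M) / c + 1
  refine (expectedTime_le_of_drop hμ (isOpen_wedge h0 hη2) hε S₁ S₂ (G := G) ?_ ?_ ?_ hx₀).trans_lt
    ENNReal.ofReal_lt_top
  · exact (((measurable_homog hfc).comp (htoC.measurable.add_const _)).div_const _).add_const _
  · intro x hx
    have := (hshift x hx).2.2
    have h2 : 0 < homog 2 f (toC x + M) / c := by positivity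
    change 1 ≤ homog 2 f (toC x + M) / c + 1
    linarith
  · intro n h hx
    obtain ⟨h1, h2, -⟩ := hshift _ hx
    obtain ⟨i1, i2, h3⟩ := hstep _ h1 h2 (toC (S₁.tug n h))
      (by rw [LinearIsometryEquiv.norm_map]; exact S₁.norm_tug_le n h)
    have hGe : ∀ v : ℂ, (fun z => G (toC.symm (toC h.pos + v * tugFactor z))) =
        fun z => homog 2 f (toC h.pos + M + v * tugFactor z) / c + 1 := by
      intro v
      funext z
      change homog 2 f (toC (toC.symm _) + M) / c + 1 = _
      rw [LinearIsometryEquiv.apply_symm_apply, add_right_comm]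
    have hS : toC (S₂.tug n h) = -(ε * gradDir 2 f f₁ (toC h.pos + M)) :=
      LinearIsometryEquiv.apply_symm_apply _ _
    have hint : ∀ v : ℂ,
        Integrable (fun z => homog 2 f (toC h.pos + M + v * tugFactor z)) μ →
        ∫ z, (homog 2 f (toC h.pos + M + v * tugFactor z) / c + 1) ∂μ =
          (∫ z, homog 2 f (toC h.pos + M + v * tugFactor z) ∂μ) / c + 1 := by
      intro v hv
      rw [integral_add (hv.div_const c) (integrable_const _), integral_div]
      simp
    rw [hS, hGe, hGe, hint _ i1, hint _ i2]
    refine ⟨(i1.div_const c).add (integrable_const _), (i2.div_const c).add (integrable_const _),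
      ?_⟩
    change _ ≤ homog 2 f (toC h.pos + M) / c + 1
    have h4 := div_le_div_of_nonneg_right h3 hc.le
    rw [sub_div, div_self hc.ne', add_div, div_right_comm, div_right_comm _ 2 c] at h4
    linarith

end Narrow

/-! ### Escaping in a wide wedge -/

section Escape

variable {μ : Measure Plane} {k K B : ℝ} {f f₁ : ℝ → ℝ}

/-- Some tug moves the position, with positive probability, nearly by a fixed positive amount in the
direction of the first axis. -/
theorem exists_push [IsProbabilityMeasure μ] (hμ : IsNoise μ) {ε : ℝ} (hε : 0 < ε) :
    ∃ (v : ℂ) (c : ℝ), ‖v‖ ≤ ε ∧ 0 < c ∧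
      ∀ δ > 0, μ {z | ‖v * tugFactor z - c‖ ≤ δ} ≠ 0 := by
  have h1 : μ {z | tugFactor z ≠ 0} ≠ 0 := by
    intro h
    have h2 : ∫ z, tugFactor z ∂μ = 0 := integral_eq_zero_of_ae (by exact h)
    rw [integral_tugFactor hμ] at h2
    exact one_ne_zero h2
  -- A point of the support of `μ` where the factor is nonzero; `v` rotates the factor there to the
  -- positive axis.
  obtain ⟨z₀, hz₀, hpos⟩ := exists_mem_forall_mem_nhdsWithin_pos_measure h1
  have hn : 0 < ‖tugFactor z₀‖ := norm_pos_iff.2 hz₀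
  have hn' : ((‖tugFactor z₀‖ : ℝ) : ℂ) ≠ 0 := by exact_mod_cast hn.ne'
  set v : ℂ := ε * starRingEnd ℂ (tugFactor z₀) / ‖tugFactor z₀‖
  have hv : v * tugFactor z₀ = ((ε * ‖tugFactor z₀‖ : ℝ) : ℂ) := by
    have : starRingEnd ℂ (tugFactor z₀) * tugFactor z₀ = (‖tugFactor z₀‖ : ℂ) ^ 2 :=
      Complex.conj_mul' _
    simp only [v]
    rw [div_mul_eq_mul_div, mul_assoc, this]
    push_cast
    field_simp
  refine ⟨v, ε * ‖tugFactor z₀‖, ?_, by positivity, fun δ hδ => ?_⟩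
  · simp only [v, norm_div, norm_mul, Complex.norm_real, RCLike.norm_conj,
      Real.norm_eq_abs, abs_of_pos hε, abs_of_pos hn]
    rw [mul_div_assoc, div_self hn.ne', mul_one]
  · refine (hpos _ (mem_nhdsWithin_of_mem_nhds ?_)).ne'
    have hc : Continuous fun z => ‖v * tugFactor z - ((ε * ‖tugFactor z₀‖ : ℝ) : ℂ)‖ := by
      have := continuous_tugFactor
      fun_prop
    have h2 := hc.tendsto z₀
    rw [hv, sub_self, norm_zero] at h2
    exact h2.eventually (Iic_mem_nhds hδ)

theorem exists_bound_arg (hf : Continuous f) : ∃ B > 0, ∀ x : ℂ, |f x.arg| ≤ B := by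
  obtain ⟨B, hB⟩ := (isCompact_Icc (a := -Real.pi) (b := Real.pi)).exists_bound_of_continuousOn
    hf.continuousOn
  refine ⟨max B 1, by positivity, fun x => (hB x.arg ?_).trans (le_max_left _ _)⟩
  exact ⟨(Complex.neg_pi_lt_arg x).le, Complex.arg_le_pi x⟩

theorem homog_le (hB : ∀ x : ℂ, |f x.arg| ≤ B) (x : ℂ) :
    homog k f x ≤ Real.exp (k * Real.log ‖x‖) * B := by
  rw [homog, Complex.log_re, Complex.log_im]
  gcongr
  exact (le_abs_self _).trans (hB x)

theorem le_norm_of_lt_homog (hk : 0 ≤ k) (hB : ∀ x : ℂ, |f x.arg| ≤ B) {R : ℝ} (hR : 1 ≤ R) {x : ℂ}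
    (h : Real.exp (k * Real.log R) * B < homog k f x) : R ≤ ‖x‖ := by
  by_contra! h1
  have hB0 : 0 ≤ B := (abs_nonneg _).trans (hB 0)
  have h2 : Real.log ‖x‖ ≤ Real.log R := by
    -- At the origin `Real.log 0 = 0` by default, so `homog` does not vanish there; the hypothesis
    -- `1 ≤ R` covers this case.
    rcases eq_or_ne x 0 with rfl | hx
    · rw [norm_zero, Real.log_zero]
      exact Real.log_nonneg hR
    · exact Real.log_le_log (norm_pos_iff.2 hx) h1.le
  have h3 : Real.exp (k * Real.log ‖x‖) * B ≤ Real.exp (k * Real.log R) * B := by gcongr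
  linarith [homog_le (k := k) hB x]

/-- A power of order less than two is eventually dominated by any multiple of the square. -/
theorem exists_power_le (hk0 : 0 ≤ k) (hk : k < 2) (hB : 0 < B) {δ : ℝ} (hδ : 0 < δ) :
    ∃ C, 0 ≤ C ∧ ∀ r : ℝ, 0 < r → Real.exp (k * Real.log r) * B ≤ δ * r ^ 2 + C := by
  -- `exp t` is the radius at which the power and the square balance. Beyond it the square
  -- dominates; below it the power is at most the constant.
  set t := Real.log (B / δ) / (2 - k)
  have ht : t * (2 - k) = Real.log (B / δ) := div_mul_cancel₀ _ (by linarith)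
  refine ⟨Real.exp (k * t) * B, by positivity, fun r hr => ?_⟩
  rcases le_total (Real.log r) t with h | h
  · have h1 : Real.exp (k * Real.log r) * B ≤ Real.exp (k * t) * B := by gcongr
    nlinarith [mul_nonneg hδ.le (sq_nonneg r)]
  · have h1 : Real.log (B / δ) + k * Real.log r ≤ 2 * Real.log r := by nlinarith
    have h2 := Real.exp_le_exp.2 h1
    rw [Real.exp_add, Real.exp_log (by positivity), two_mul, Real.exp_add, Real.exp_log hr,
      div_mul_eq_mul_div, div_le_iff₀ hδ] at h2
    have h3 : 0 ≤ Real.exp (k * t) * B := by positivity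
    nlinarith

/-- Points close to a sector lie in a larger sector. -/
theorem exists_sector_stable {h h' : ℝ} (h0 : 0 < h') (hh : h < h') (hh' : h' < Real.pi) :
    ∃ δ > 0, ∀ x y : ℂ, |x.arg| ≤ h → ‖y‖ < δ * ‖x‖ → |(x + y).arg| < h' := by
  obtain ⟨δ, hδ, H⟩ := exists_infDist_sector (η := 2 * h') (h := h) (by linarith) (by linarith)
    (by linarith)
  refine ⟨δ, hδ, fun x y hx hy => ?_⟩
  have h1 := H (toC.symm x) (by rwa [LinearIsometryEquiv.apply_symm_apply])
  rw [LinearIsometryEquiv.norm_map] at h1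
  have hx0 : x ≠ 0 := by
    rintro rfl
    rw [norm_zero, mul_zero] at hy
    exact absurd (norm_nonneg y) (not_le.2 hy)
  have h2 : toC.symm (x + y) ∈ wedge (2 * h') := by
    refine ball_subset_of_le_infDist (isOpen_wedge (by linarith) (by linarith)) ?_ h1 ?_
    · rw [mem_wedge_iff (by linarith), LinearIsometryEquiv.apply_symm_apply]
      exact ⟨by simpa using hx0, by linarith⟩
    · rwa [Metric.mem_ball, dist_eq_norm, ← map_sub, add_sub_cancel_left,
        LinearIsometryEquiv.norm_map]
  rw [mem_wedge_iff (by linarith), LinearIsometryEquiv.apply_symm_apply] at h2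
  linarith [h2.2]

theorem ofReal_integral_le {α : Type*} [MeasurableSpace α] {ν : Measure α} {g : α → ℝ}
    (hg : Integrable g ν) : ENNReal.ofReal (∫ z, g z ∂ν) ≤ ∫⁻ z, ENNReal.ofReal (g z) ∂ν := by
  rw [integral_eq_lintegral_pos_part_sub_lintegral_neg_part hg]
  refine (ENNReal.ofReal_le_ofReal (sub_le_self _ ENNReal.toReal_nonneg)).trans ?_
  exact ENNReal.ofReal_toReal_le

/-- The part of the sector of half angle `h` where `homog k f` exceeds `K`. -/
def highRegion (k : ℝ) (f : ℝ → ℝ) (h K : ℝ) : Set ℂ := {x | |x.arg| < h ∧ K < homog k f x}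

/-- The excess of `homog k f` over `K` on the high region. -/
noncomputable def excess (k : ℝ) (f : ℝ → ℝ) (h K : ℝ) : ℂ → ℝ≥0∞ :=
  (highRegion k f h K).indicator fun x => ENNReal.ofReal (homog k f x - K)

theorem measurableSet_highRegion (hf : Continuous f) (h K : ℝ) :
    MeasurableSet (highRegion k f h K) :=
  (measurableSet_lt (Complex.measurable_arg.norm) measurable_const).inter
    (measurableSet_lt measurable_const (measurable_homog hf))

theorem measurable_excess (hf : Continuous f) (h K : ℝ) : Measurable (excess k f h K) :=
  ((measurable_homog hf).sub_const K).ennreal_ofReal.indicator (measurableSet_highRegion hf h K)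

/-- The profile is nonpositive between the half angles `h` and `h'`, so cutting the excess off at
`h` loses nothing as long as the position stays within `h'`. -/
theorem le_excess {h h' : ℝ} (hK : 0 ≤ K) (hf : ∀ θ, h ≤ |θ| → |θ| ≤ h' → f θ ≤ 0) {x : ℂ}
    (hx : |x.arg| ≤ h') : ENNReal.ofReal (homog k f x - K) ≤ excess k f h K x := by
  by_cases hm : x ∈ highRegion k f h K
  · rw [excess, indicator_of_mem hm]
  · rw [excess, indicator_of_notMem hm, nonpos_iff_eq_zero, ENNReal.ofReal_eq_zero, sub_nonpos]
    by_cases h1 : |x.arg| < h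
    · exact not_lt.1 fun h2 => hm ⟨h1, h2⟩
    · rw [homog, Complex.log_im]
      exact (mul_nonpos_of_nonneg_of_nonpos (Real.exp_pos _).le (hf _ (not_lt.1 h1) hx)).trans hK

/-- The excess does not decrease on average over a turn in which `homog k f` does not. -/
theorem excess_le_average [IsProbabilityMeasure μ] {h h' : ℝ} (hK : 0 ≤ K)
    (hf : ∀ θ, h ≤ |θ| → |θ| ≤ h' → f θ ≤ 0) {x w v : ℂ}
    (hw : Integrable (fun z => homog k f (x + w * tugFactor z)) μ)
    (hv : Integrable (fun z => homog k f (x + v * tugFactor z)) μ)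
    (hle : homog k f x ≤ (∫ z, homog k f (x + w * tugFactor z) ∂μ) / 2 +
      (∫ z, homog k f (x + v * tugFactor z) ∂μ) / 2)
    (haw : ∀ᵐ z ∂μ, |(x + w * tugFactor z).arg| ≤ h')
    (hav : ∀ᵐ z ∂μ, |(x + v * tugFactor z).arg| ≤ h') :
    excess k f h K x ≤ 2⁻¹ * ∫⁻ z, excess k f h K (x + w * tugFactor z) ∂μ +
      2⁻¹ * ∫⁻ z, excess k f h K (x + v * tugFactor z) ∂μ := by
  have key : ∀ u : ℂ, Integrable (fun z => homog k f (x + u * tugFactor z)) μ →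
      (∀ᵐ z ∂μ, |(x + u * tugFactor z).arg| ≤ h') →
      ENNReal.ofReal (∫ z, homog k f (x + u * tugFactor z) ∂μ - K) ≤
        ∫⁻ z, excess k f h K (x + u * tugFactor z) ∂μ := by
    intro u hu ha
    have h1 : ∫ z, homog k f (x + u * tugFactor z) ∂μ - K =
        ∫ z, (homog k f (x + u * tugFactor z) - K) ∂μ := by
      rw [integral_sub hu (integrable_const _)]
      simp
    rw [h1]
    refine (ofReal_integral_le (hu.sub (integrable_const _))).trans (lintegral_mono_ae ?_)
    filter_upwards [ha] with z hz
    exact le_excess hK hf hz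
  refine (indicator_le_self _ _ x).trans ?_
  have h2 : (2⁻¹ : ℝ≥0∞) = ENNReal.ofReal 2⁻¹ := by
    rw [ENNReal.ofReal_inv_of_pos two_pos, ENNReal.ofReal_ofNat]
  calc ENNReal.ofReal (homog k f x - K)
      ≤ ENNReal.ofReal (2⁻¹ * (∫ z, homog k f (x + w * tugFactor z) ∂μ - K) +
        2⁻¹ * (∫ z, homog k f (x + v * tugFactor z) ∂μ - K)) :=
        ENNReal.ofReal_le_ofReal (by linarith)
    _ ≤ _ := ENNReal.ofReal_add_le
    _ ≤ _ := by
      rw [ENNReal.ofReal_mul (by norm_num), ENNReal.ofReal_mul (by norm_num), ← h2]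
      gcongr
      · exact key w hw haw
      · exact key v hv hav

/-- The mean square of the position grows by a bounded amount over a turn. -/
theorem lintegral_norm_sq_le [IsProbabilityMeasure μ] (hμ : IsNoise μ) {ε L : ℝ} (hε : 0 ≤ ε)
    (hL : 0 ≤ L) {x v : ℂ} (hv : ‖v‖ ≤ ε) :
    2⁻¹ * ∫⁻ z, ENNReal.ofReal (‖x + pushBack k f f₁ L x v * tugFactor z‖ ^ 2) ∂μ +
      2⁻¹ * ∫⁻ z, ENNReal.ofReal (‖x + v * tugFactor z‖ ^ 2) ∂μ ≤
      ENNReal.ofReal (‖x‖ ^ 2) + ENNReal.ofReal (2 * L * ε + (ε * alpha μ) ^ 2) := by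
  have hα := one_le_alpha μ
  have hcont := continuous_tugFactor
  have key : ∀ u : ℂ, ‖u‖ ≤ ε →
      ∫⁻ z, ENNReal.ofReal (‖x + u * tugFactor z‖ ^ 2) ∂μ =
        ENNReal.ofReal (∫ z, ‖x + u * tugFactor z‖ ^ 2 ∂μ) ∧
      0 ≤ ∫ z, ‖x + u * tugFactor z‖ ^ 2 ∂μ ∧
      ∫ z, ‖x + u * tugFactor z‖ ^ 2 ∂μ ≤
        ‖x‖ ^ 2 + 2 * (starRingEnd ℂ x * u).re + (ε * alpha μ) ^ 2 := by
    intro u hu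
    have hi : Integrable (fun z => ‖x + u * tugFactor z‖ ^ 2) μ :=
      integrable_of_continuous hμ (by fun_prop)
    refine ⟨(ofReal_integral_eq_lintegral_ofReal hi (Filter.Eventually.of_forall fun z => by
      positivity)).symm, integral_nonneg fun z => by positivity, ?_⟩
    have hi2 : Integrable (fun z => starRingEnd ℂ x * u * tugFactor z) μ :=
      integrable_of_continuous hμ (by fun_prop)
    have hre : ∫ z, (starRingEnd ℂ x * u * tugFactor z).re ∂μ = (starRingEnd ℂ x * u).re := by
      have h1 := integral_re (𝕜 := ℂ) hi2
      simp only [RCLike.re_to_complex] at h1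
      rw [h1, integral_const_mul, integral_tugFactor hμ, mul_one]
    have hre_int : Integrable (fun z => (starRingEnd ℂ x * u * tugFactor z).re) μ := hi2.re
    calc ∫ z, ‖x + u * tugFactor z‖ ^ 2 ∂μ
        ≤ ∫ z, (‖x‖ ^ 2 + (ε * alpha μ) ^ 2 +
          2 * (starRingEnd ℂ x * u * tugFactor z).re) ∂μ := by
          refine integral_mono_ae hi ((integrable_const _).add (hre_int.const_mul 2)) ?_
          filter_upwards [ae_norm_tugFactor_le hμ] with z hz
          have h1 : ‖u * tugFactor z‖ ≤ ε * alpha μ := by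
            rw [norm_mul]
            gcongr
          have h2 : ‖u * tugFactor z‖ ^ 2 ≤ (ε * alpha μ) ^ 2 := by gcongr
          have h3 : ‖x + u * tugFactor z‖ ^ 2 = ‖x‖ ^ 2 + ‖u * tugFactor z‖ ^ 2 +
              2 * (starRingEnd ℂ x * u * tugFactor z).re := by
            rw [mul_assoc]
            generalize u * tugFactor z = y
            rw [← Complex.normSq_eq_norm_sq, ← Complex.normSq_eq_norm_sq,
              ← Complex.normSq_eq_norm_sq, Complex.normSq_apply, Complex.normSq_apply,
              Complex.normSq_apply]
            simp
            ring
          linarith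
      _ = _ := by
          rw [integral_add (integrable_const _) (hre_int.const_mul 2), integral_const_mul, hre]
          simp
          ring
  have hw : ‖pushBack k f f₁ L x v‖ ≤ ε := (norm_pushBack_le k f f₁ hL x v).trans hv
  obtain ⟨e1, n1, b1⟩ := key _ hw
  obtain ⟨e2, n2, b2⟩ := key _ hv
  have h2 : (2⁻¹ : ℝ≥0∞) = ENNReal.ofReal 2⁻¹ := by
    rw [ENNReal.ofReal_inv_of_pos two_pos, ENNReal.ofReal_ofNat]
  rw [e1, e2, h2, ← ENNReal.ofReal_mul (by norm_num), ← ENNReal.ofReal_mul (by norm_num),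
    ← ENNReal.ofReal_add (by positivity) (by positivity),
    ← ENNReal.ofReal_add (by positivity) (by positivity)]
  refine ENNReal.ofReal_le_ofReal ?_
  -- The linear terms in the expansion of the square combine into the inner product of `x` with the
  -- sum of the two tugs, which is of order `1 / ‖x‖`.
  have h3 : (starRingEnd ℂ x * pushBack k f f₁ L x v).re + (starRingEnd ℂ x * v).re ≤
      2 * L * ε := by
    rw [← Complex.add_re, ← mul_add, add_comm _ v]
    refine (Complex.re_le_norm _).trans ?_
    rw [norm_mul, RCLike.norm_conj]
    refine (norm_add_pushBack_le k f f₁ hL x v).trans ?_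
    gcongr
  linarith

end Escape

/-! ### Two-phase strategies and turns away from the boundary -/

section TwoPhases

variable {D : Set Plane} {a ε : ℝ} {μ : Measure Plane}

/-- The strategy that tugs by a fixed vector up to a time that depends on the starting point, and
responds afterwards to the tug that the strategy `S` would choose. -/
noncomputable def Strategy.twoPhase (S : Strategy D a ε) {N : Plane → ℕ} (hN : Measurable N)
    {v : Plane} (hv : ‖v‖ ≤ ε) {w : Plane × Plane → Plane} (hw : Measurable w)
    (hwn : ∀ x u, ‖w (x, u)‖ ≤ ‖u‖) : Strategy D a ε where
  tug n h := if n < N (h ⟨0, by simp⟩).2 then v else w (h.pos, S.tug n h)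
  measurable_tug n := by
    refine Measurable.ite (measurableSet_lt measurable_const
      (hN.comp (measurable_snd.comp (measurable_pi_apply _)))) measurable_const ?_
    exact hw.comp (Hist.measurable_pos.prodMk (S.measurable_tug n))
  norm_tug_le n h := by
    split_ifs
    · exact hv
    · exact (hwn _ _).trans (S.norm_tug_le n h)
  exit := S.exit
  measurable_exit := S.measurable_exit
  exit_mem := S.exit_mem

theorem lintegral_turn_deep [IsProbabilityMeasure μ] (S₁ S₂ : Strategy D (alpha μ) ε) (k : ℕ)
    (h : Hist k) (hf : h.pos ∉ frontier D)
    (hd : alpha μ * ε < Metric.infDist h.pos (frontier D)) {Φ : Plane → ℝ≥0∞}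
    (hΦ : Measurable Φ) :
    ∫⁻ y, Φ y.2 ∂(turn μ S₁ S₂ k h) =
      2⁻¹ * ∫⁻ z, Φ (toC.symm (toC h.pos + toC (S₁.tug k h) * tugFactor z)) ∂μ +
      2⁻¹ * ∫⁻ z, Φ (toC.symm (toC h.pos + toC (S₂.tug k h) * tugFactor z)) ∂μ := by
  rw [lintegral_turn S₁ S₂ k h (fun y => Φ y.2), lintegral_moveLaw_deep S₁ k h hf hd hΦ,
    lintegral_moveLaw_deep S₂ k h hf hd hΦ]

/-- Player I wins the toss with probability one half; the moves of player II are ignored. -/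
theorem le_turn_of_deep [IsProbabilityMeasure μ] (S₁ S₂ : Strategy D (alpha μ) ε) (k : ℕ)
    (h : Hist k) (hf : h.pos ∉ frontier D)
    (hd : alpha μ * ε < Metric.infDist h.pos (frontier D)) {A : Set Plane} (hA : MeasurableSet A)
    {s : Set Plane} (hs : MeasurableSet s)
    (hsA : ∀ z ∈ s, toC.symm (toC h.pos + toC (S₁.tug k h) * tugFactor z) ∈ A) :
    2⁻¹ * μ s ≤ turn μ S₁ S₂ k h {y | y.2 ∈ A} := by
  have h1 : turn μ S₁ S₂ k h {y | y.2 ∈ A} =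
      ∫⁻ y, A.indicator 1 y.2 ∂(turn μ S₁ S₂ k h) :=
    (lintegral_indicator_one (measurable_snd hA)).symm
  rw [h1, lintegral_turn_deep S₁ S₂ k h hf hd (measurable_one.indicator hA)]
  refine le_add_right ?_
  gcongr
  rw [← lintegral_indicator_one hs]
  refine lintegral_mono fun z => ?_
  by_cases hz : z ∈ s
  · rw [indicator_of_mem hz, indicator_of_mem (hsA z hz), Pi.one_apply, Pi.one_apply]
  · rw [indicator_of_notMem hz]
    exact zero_le

end TwoPhases

/-! ### Reaching the high region and comparing the excess with the square -/

section Wide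

variable {μ : Measure Plane} {η p ε k : ℝ} {f f₁ : ℝ → ℝ}

theorem measurable_pushBack (hf : Continuous f) (hf₁ : Continuous f₁) (L : ℝ) :
    Measurable fun q : ℂ × ℂ => pushBack k f f₁ L q.1 q.2 := by
  have h1 : Measurable fun q : ℂ × ℂ => gradDir k f f₁ q.1 :=
    (measurable_gradDir hf hf₁).comp measurable_fst
  unfold pushBack
  fun_prop

theorem continuousAt_homog (hf : Continuous f) {x : ℂ} (hx : x ∈ Complex.slitPlane) :
    ContinuousAt (homog k f) x := by
  have h1 : ContinuousAt Complex.log x := continuousAt_clog hx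
  unfold homog
  exact (Real.continuous_exp.continuousAt.comp
    ((Complex.continuous_re.continuousAt.comp h1).const_mul k)).mul
    (hf.continuousAt.comp (Complex.continuous_im.continuousAt.comp h1))

/-- Around a positive real number a profile that is positive on a sector is bounded below. -/
theorem exists_cone (hf : Continuous f) {h : ℝ} (h0 : 0 < h) (hpos : 0 < f 0) {c s : ℝ}
    (hc : 0 < c) (hs : 0 < s) :
    ∃ m > 0, ∃ δ > 0, δ < s ∧ ∀ x : ℂ, ‖x - c‖ ≤ 2 * δ →
      x ≠ 0 ∧ |x.arg| < h ∧ m ≤ homog k f x := by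
  have hslit : (c : ℂ) ∈ Complex.slitPlane := Complex.ofReal_mem_slitPlane.2 hc
  have harg : (c : ℂ).arg = 0 := Complex.arg_ofReal_of_nonneg hc.le
  have hhom : 0 < homog k f c := by
    rw [homog, Complex.log_im, harg]
    positivity
  have e1 : ∀ᶠ x in nhds (c : ℂ), x ∈ Complex.slitPlane :=
    Complex.isOpen_slitPlane.mem_nhds hslit
  have e2 : ∀ᶠ x in nhds (c : ℂ), |x.arg| < h := by
    have h1 := (Complex.continuousAt_arg hslit).abs
    refine h1.eventually_lt continuousAt_const ?_
    rw [harg, abs_zero]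
    exact h0
  have e3 : ∀ᶠ x in nhds (c : ℂ), homog k f c / 2 < homog k f x :=
    continuousAt_const.eventually_lt (continuousAt_homog hf hslit) (half_lt_self hhom)
  obtain ⟨ρ, hρ, H⟩ := Metric.eventually_nhds_iff.1 (e1.and (e2.and e3))
  refine ⟨homog k f c / 2, by positivity, min (ρ / 4) (s / 2), by positivity,
    (min_le_right _ _).trans_lt (half_lt_self hs), fun x hx => ?_⟩
  have h1 : dist x c < ρ := by
    rw [dist_eq_norm]
    linarith [min_le_left (ρ / 4) (s / 2)]
  obtain ⟨h2, h3, h4⟩ := H h1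
  exact ⟨Complex.slitPlane_ne_zero h2, h3, h4.le⟩

/-- Dilations by a large factor move the cone around the positive axis to the high region. -/
theorem mem_highRegion_of_cone (hk : 1 ≤ k) {h c m δ K : ℝ} (hm : 0 < m)
    (hcone : ∀ x : ℂ, ‖x - c‖ ≤ 2 * δ → x ≠ 0 ∧ |x.arg| < h ∧ m ≤ homog k f x)
    {n : ℝ} (hn : 1 ≤ n) (hnK : K < n * m) {x₀ x : ℂ} (hx₀ : ‖x₀‖ ≤ n * δ)
    (hx : ‖x - (x₀ + (n * c : ℝ))‖ ≤ n * δ) : x ∈ highRegion k f h K := by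
  have hn0 : 0 < n := by linarith
  have hn' : (n : ℂ) ≠ 0 := by exact_mod_cast hn0.ne'
  have hxe : x = n * (x / n) := by field_simp
  have h1 : ‖x / n - c‖ ≤ 2 * δ := by
    have h2 : x / n - c = (x - (x₀ + (n * c : ℝ)) + x₀) / n := by
      push_cast
      field_simp
      ring
    rw [h2, norm_div, Complex.norm_real, Real.norm_eq_abs, abs_of_pos hn0, div_le_iff₀ hn0]
    refine (norm_add_le _ _).trans ?_
    linarith
  obtain ⟨h2, h3, h4⟩ := hcone _ h1
  rw [hxe]
  refine ⟨by rwa [Complex.arg_real_mul _ hn0], ?_⟩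
  rw [homog_ofReal_mul _ _ hn0 h2]
  have h5 : n ≤ Real.exp (k * Real.log n) := by
    conv_lhs => rw [← Real.exp_log hn0]
    exact Real.exp_le_exp.2 (le_mul_of_one_le_left (Real.log_nonneg hn) hk)
  calc K < n * m := hnK
    _ ≤ _ := by gcongr

theorem excess_le_sq {B h K : ℝ} (hk0 : 0 ≤ k) (hk : k < 2) (hB0 : 0 < B)
    (hB : ∀ x : ℂ, |f x.arg| ≤ B) (hK : 0 ≤ K) {δ : ℝ≥0∞} (hδ : δ ≠ 0) :
    ∃ C : ℝ≥0∞, C ≠ ∞ ∧ ∀ x : ℂ, x ≠ 0 → excess k f h K x ≤ δ * ENNReal.ofReal (‖x‖ ^ 2) + C := by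
  -- `δ` may be infinite; truncation at `1` makes it a positive real number.
  have h1 : min δ 1 ≠ ∞ := ne_top_of_le_ne_top ENNReal.one_ne_top (min_le_right _ _)
  have h2 : 0 < (min δ 1).toReal :=
    ENNReal.toReal_pos (by simp [hδ]) h1
  obtain ⟨C, hC, H⟩ := exists_power_le hk0 hk hB0 h2
  refine ⟨ENNReal.ofReal C, ENNReal.ofReal_ne_top, fun x hx => ?_⟩
  refine (indicator_le_self _ _ x).trans ?_
  have h3 := H ‖x‖ (norm_pos_iff.2 hx)
  have h4 := homog_le (k := k) hB x
  calc ENNReal.ofReal (homog k f x - K)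
      ≤ ENNReal.ofReal ((min δ 1).toReal * ‖x‖ ^ 2 + C) :=
        ENNReal.ofReal_le_ofReal (by linarith)
    _ = min δ 1 * ENNReal.ofReal (‖x‖ ^ 2) + ENNReal.ofReal C := by
        rw [ENNReal.ofReal_add (by positivity) hC, ENNReal.ofReal_mul h2.le,
          ENNReal.ofReal_toReal h1]
    _ ≤ _ := by gcongr; exact min_le_left _ _

end Wide

/-- In a wedge wider than the critical angle, player I can make the expected time to end the game
infinite. -/
theorem exists_slow_strategy {μ : Measure Plane} [IsProbabilityMeasure μ] {η p ε : ℝ} (hp : 1 < p)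
    (hμ : IsNoise μ) (hpμ : exponent μ = p) (hη : 2 * criticalHalfAngle p < η)
    (hη2 : η < 2 * Real.pi) (hε : 0 < ε) (S₂ : Strategy (wedge η) (alpha μ) ε) :
    ∃ S₁ : Strategy (wedge η) (alpha μ) ε, ∀ x₀ ∈ wedge η,
      alpha μ * ε < Metric.infDist x₀ (frontier (wedge η)) → expectedTime μ S₁ S₂ x₀ = ⊤ := by
  have h0 : 0 < η := by linarith [criticalHalfAngle_pos hp]
  have hsin := sin_half_pos h0 hη2
  have hD := isOpen_wedge h0 hη2
  have hα := one_le_alpha μ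
  have hαε : 0 < alpha μ * ε := by positivity
  obtain ⟨k, f, f₁, f₂, hk1, hk2, hf, hf₁, hf₂, hpos, hG, h, h', hh0, hhh', hh', hfpos, hfneg⟩ :=
    exists_subprofile (h := η / 2) hp (by linarith)
  have hk0 : 0 ≤ k := by linarith
  have hfc : Continuous f := continuous_iff_continuousAt.2 fun θ => (hf θ).continuousAt
  have hfc₁ : Continuous f₁ := continuous_iff_continuousAt.2 fun θ => (hf₁ θ).continuousAt
  obtain ⟨R, hR, L, hL, hstep⟩ := subsolution_step hp hμ hpμ hf hf₁ hf₂ hpos hG (h := h)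
    (by linarith) hε
  obtain ⟨B, hB0, hB⟩ := exists_bound_arg hfc
  obtain ⟨δ₁, hδ₁, hstab⟩ := exists_sector_stable (h := h) (h' := h') (by linarith) hhh'
    (by linarith)
  obtain ⟨δ₂, hδ₂, hsec⟩ := exists_infDist_sector h0 hη2 (h := h) (by linarith)
  obtain ⟨v, c, hv, hc, hpush⟩ := exists_push hμ hε
  obtain ⟨m, hm, δ, hδ, hδs, hcone⟩ := exists_cone (k := k) hfc hh0
    (hfpos 0 (by rwa [abs_zero])) hc (mul_pos hc hsin)
  -- Beyond `R'` the subsolution estimate holds, one turn cannot leave the sector of half angle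
  -- `h'`, and the points of the sector of half angle `h` are deeper than `alpha μ * ε`.
  obtain ⟨R', hR'1, hR'R, hR'δ₁, hR'δ₂⟩ : ∃ R' : ℝ, 1 ≤ R' ∧ R ≤ R' ∧ alpha μ * ε < δ₁ * R' ∧
      alpha μ * ε < δ₂ * R' := by
    have e : ∀ᶠ R' : ℝ in Filter.atTop, 1 ≤ R' ∧ R ≤ R' ∧ alpha μ * ε / δ₁ < R' ∧
        alpha μ * ε / δ₂ < R' :=
      (Filter.eventually_ge_atTop _).and ((Filter.eventually_ge_atTop _).and
        ((Filter.eventually_gt_atTop _).and (Filter.eventually_gt_atTop _)))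
    obtain ⟨R', h1, h2, h3, h4⟩ := e.exists
    exact ⟨R', h1, h2, by rwa [div_lt_iff₀' hδ₁] at h3, by rwa [div_lt_iff₀' hδ₂] at h4⟩
  -- `K` bounds `homog k f` inside the disc of radius `R'`, so the high region lies outside that
  -- disc.
  set K := Real.exp (k * Real.log R') * B with hKdef
  have hK : 0 ≤ K := by positivity
  have hnorm : ∀ x ∈ highRegion k f h K, R' ≤ ‖x‖ := fun x hx =>
    le_norm_of_lt_homog hk0 hB hR'1 hx.2
  have hne : ∀ x ∈ highRegion k f h K, x ≠ 0 := fun x hx =>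
    norm_pos_iff.1 (by linarith [hnorm x hx])
  have hdeep : ∀ x : Plane, toC x ∈ highRegion k f h K →
      x ∈ wedge η ∧ alpha μ * ε < Metric.infDist x (frontier (wedge η)) := by
    intro x hx
    have h1 := hnorm _ hx
    refine ⟨(mem_wedge_iff hη2 x).2 ⟨fun h2 => hne _ hx (by rw [h2, map_zero]), ?_⟩, ?_⟩
    · linarith [hx.1]
    · refine hR'δ₂.trans_le (le_trans ?_ (hsec x hx.1.le))
      rw [LinearIsometryEquiv.norm_map] at h1
      gcongr
  -- Enough pushes to have `‖x‖ ≤ N * δ` and `K < N * m`, as `mem_highRegion_of_cone` requires. The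
  -- strategy reads `N` off the starting point in the history, so one strategy serves all starting
  -- points.
  set N : Plane → ℕ := fun x => ⌈‖x‖ / δ⌉₊ + (⌈K / m⌉₊ + 1) with hNdef
  have hNm : Measurable N := (Nat.measurable_ceil.comp (measurable_norm.div_const δ)).add_const _
  have hw : Measurable fun q : Plane × Plane =>
      toC.symm (pushBack k f f₁ L (toC q.1) (toC q.2)) :=
    toC.symm.continuous.measurable.comp ((measurable_pushBack hfc hfc₁ L).comp
      ((toC.continuous.measurable.comp measurable_fst).prodMk
        (toC.continuous.measurable.comp measurable_snd)))
  set S₁ : Strategy (wedge η) (alpha μ) ε := S₂.twoPhase hNm (v := toC.symm v)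
    (by rwa [LinearIsometryEquiv.norm_map]) hw (fun x u => by
      rw [LinearIsometryEquiv.norm_map, ← LinearIsometryEquiv.norm_map toC u]
      exact norm_pushBack_le k f f₁ hL.le _ _) with hS₁
  refine ⟨S₁, fun x₀ hx₀ hx₀d => ?_⟩
  -- While the pushes last, the position follows `n * c` along the axis up to an error `n * δ`; the
  -- ball is `{x₀}` at `n = 0`. As `δ < c * sin (η / 2)`, these balls lie in the translate by `x₀`
  -- of a cone whose translations do not decrease the distance to the boundary.
  set E : ℕ → Set Plane := fun n => if n ≤ N x₀ then Metric.closedBall (x₀ + (n * c) • e₁) (n * δ)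
    else toC ⁻¹' highRegion k f h K with hE
  have hE1 : ∀ n ≤ N x₀, E n = Metric.closedBall (x₀ + (n * c) • e₁) (n * δ) :=
      fun n hn => if_pos hn
  have hNK : K < N x₀ * m := by
    have h1 := Nat.le_ceil (K / m)
    rw [div_le_iff₀ hm] at h1
    simp only [hNdef]
    push_cast
    have h2 : 0 ≤ (⌈‖x₀‖ / δ⌉₊ : ℝ) * m := by positivity
    nlinarith
  have hNx : ‖x₀‖ ≤ N x₀ * δ := by
    have h1 := Nat.le_ceil (‖x₀‖ / δ)
    rw [div_le_iff₀ hδ] at h1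
    simp only [hNdef]
    push_cast
    have h2 : 0 ≤ ((⌈K / m⌉₊ : ℝ) + 1) * δ := by positivity
    nlinarith
  have hN1 : (1 : ℝ) ≤ N x₀ := by
    simp only [hNdef]
    push_cast
    have h2 : 0 ≤ (⌈‖x₀‖ / δ⌉₊ : ℝ) := by positivity
    have h3 : 0 ≤ (⌈K / m⌉₊ : ℝ) := by positivity
    linarith
  have hEN : E (N x₀) ⊆ toC ⁻¹' highRegion k f h K := by
    intro y hy
    rw [hE1 _ le_rfl, Metric.mem_closedBall, dist_eq_norm, ← LinearIsometryEquiv.norm_map toC,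
      map_sub, map_add, toC_smul_e₁] at hy
    exact mem_highRegion_of_cone hk1 hm hcone hN1 hNK
      (by rwa [LinearIsometryEquiv.norm_map]) hy
  have hE2 : ∀ n, N x₀ ≤ n → E n ⊆ toC ⁻¹' highRegion k f h K := by
    intro n hn
    rcases hn.eq_or_lt with rfl | hn
    · exact hEN
    · rw [hE]
      simp only [if_neg (not_le.2 hn), subset_refl]
  have hEdeep : ∀ n, ∀ y ∈ E n,
      y ∈ wedge η ∧ alpha μ * ε < Metric.infDist y (frontier (wedge η)) := by
    intro n y hy
    rcases le_or_gt (N x₀) n with hn | hn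
    · exact hdeep y (hE2 n hn hy)
    rw [hE1 n hn.le, Metric.mem_closedBall, dist_eq_norm] at hy
    rcases Nat.eq_zero_or_pos n with rfl | hn0
    · have : y = x₀ := by
        rw [Nat.cast_zero, zero_mul, zero_mul, zero_smul, add_zero] at hy
        exact sub_eq_zero.1 (norm_le_zero_iff.1 hy)
      rw [this]
      exact ⟨hx₀, hx₀d⟩
    · have hn1 : (0 : ℝ) < n := by exact_mod_cast hn0
      have hy2 : ‖y - (x₀ + (n * c) • e₁)‖ < n * c * Real.sin (η / 2) := by
        refine hy.trans_lt ?_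
        rw [mul_assoc]
        gcongr
      have hye : y = x₀ + ((n * c) • e₁ + (y - (x₀ + (n * c) • e₁))) := by abel
      rw [hye]
      exact ⟨add_mem_wedge h0 hη2 hx₀ hy2,
        hx₀d.trans_le (infDist_add_wedge h0 hη2 hx₀ hy2)⟩
  have hEfr : ∀ n, ∀ y ∈ E n, y ∉ frontier (wedge η) := fun n y hy hf =>
    notMem_of_mem_frontier hD hf (hEdeep n y hy).1
  have hstart : ∀ n (g : Hist n), (∀ j : Finset.Iic n, (g j).2 ∈ E j) →
      (g ⟨0, by simp⟩).2 = x₀ := by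
    intro n g hg
    have h1 := hg ⟨0, by simp⟩
    rw [hE1 0 (Nat.zero_le _), Metric.mem_closedBall, Nat.cast_zero, zero_mul, zero_mul, zero_smul,
      add_zero] at h1
    exact dist_le_zero.1 h1
  have hend : ∀ n (g : Hist n), (∀ j : Finset.Iic n, (g j).2 ∈ E j) → g.pos ∈ E n :=
    fun n g hg => hg ⟨n, by simp⟩
  have hrespond : ∀ n, N x₀ ≤ n → ∀ g : Hist n, (∀ j : Finset.Iic n, (g j).2 ∈ E j) →
      toC (S₁.tug n g) = pushBack k f f₁ L (toC g.pos) (toC (S₂.tug n g)) := by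
    intro n hn g hg
    have : S₁.tug n g = toC.symm (pushBack k f f₁ L (toC g.pos) (toC (S₂.tug n g))) :=
      if_neg (by rw [hstart n g hg]; exact not_lt.2 hn)
    rw [this, LinearIsometryEquiv.apply_symm_apply]
  have hpm := measurable_excess (k := k) hfc h K
  have htoC : Measurable toC := toC.continuous.measurable
  refine expectedTime_eq_top S₁ S₂ x₀ E (N x₀) ?_ ?_ hEfr
    (β := 2⁻¹ * μ {z | ‖v * tugFactor z - c‖ ≤ δ}) ?_ ?_
    (φ := fun y => excess k f h K (toC y)) (V := fun y => ENNReal.ofReal (‖toC y‖ ^ 2))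
    (hpm.comp htoC) ((htoC.norm.pow_const 2).ennreal_ofReal)
    (C := ENNReal.ofReal (2 * L * ε + (ε * alpha μ) ^ 2))
    (C₀ := ENNReal.ofReal ((‖x₀ + (N x₀ * c) • e₁‖ + N x₀ * δ) ^ 2))
    ENNReal.ofReal_ne_top ENNReal.ofReal_ne_top ?_ ?_ ?_ ?_ ?_ ?_
  · intro n
    rw [hE]
    simp only
    split_ifs
    · exact Metric.isClosed_closedBall.measurableSet
    · exact htoC (measurableSet_highRegion hfc h K)
  · rw [hE1 0 (Nat.zero_le _)]
    simp
  · exact mul_ne_zero (by simp) (hpush δ hδ)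
  · intro n hn g hg
    have h1 := hend n g hg
    obtain ⟨h2, h3⟩ := hEdeep n _ h1
    refine le_turn_of_deep S₁ S₂ n g (hEfr n _ h1) h3 ?_ ?_ fun z hz => ?_
    · rw [hE1 (n + 1) hn]
      exact Metric.isClosed_closedBall.measurableSet
    · have := continuous_tugFactor
      exact measurableSet_le (by fun_prop) measurable_const
    · have htug : toC (S₁.tug n g) = v := by
        have : S₁.tug n g = toC.symm v := if_pos (by rwa [hstart n g hg])
        rw [this, LinearIsometryEquiv.apply_symm_apply]
      rw [hE1 n hn.le, Metric.mem_closedBall, dist_eq_norm, ← LinearIsometryEquiv.norm_map toC,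
        map_sub, map_add, toC_smul_e₁] at h1
      rw [hE1 (n + 1) hn, Metric.mem_closedBall, dist_eq_norm, ← LinearIsometryEquiv.norm_map toC,
        map_sub, LinearIsometryEquiv.apply_symm_apply, map_add, toC_smul_e₁, htug]
      have h4 : toC g.pos + v * tugFactor z - (toC x₀ + (((n + 1 : ℕ) : ℝ) * c : ℝ)) =
          (toC g.pos - (toC x₀ + ((n : ℝ) * c : ℝ))) + (v * tugFactor z - c) := by
        push_cast
        ring
      rw [h4]
      refine (norm_add_le _ _).trans ?_
      have h5 : ‖v * tugFactor z - c‖ ≤ δ := hz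
      push_cast
      push_cast at h1
      linarith
  · intro n hn g hg
    have h1 := hend n g hg
    have hx := hE2 n hn h1
    rw [lintegral_turn_deep S₁ S₂ n g (hEfr n _ h1) (hEdeep n _ h1).2
      (Φ := fun y => excess k f h K (toC y)) (hpm.comp htoC),
      hrespond n hn g hg]
    simp only [LinearIsometryEquiv.apply_symm_apply]
    have hv₂ : ‖toC (S₂.tug n g)‖ ≤ ε := by
      rw [LinearIsometryEquiv.norm_map]
      exact S₂.norm_tug_le n g
    obtain ⟨i2, i1, hle⟩ := hstep _ (hR'R.trans (hnorm _ hx)) hx.1.le _ hv₂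
    have ha : ∀ u : ℂ, ‖u‖ ≤ ε → ∀ᵐ z ∂μ, |(toC g.pos + u * tugFactor z).arg| ≤ h' := by
      intro u hu
      filter_upwards [ae_norm_tugFactor_le hμ] with z hz
      refine (hstab _ _ hx.1.le ?_).le
      calc ‖u * tugFactor z‖ = ‖u‖ * ‖tugFactor z‖ := norm_mul _ _
        _ ≤ ε * alpha μ := by gcongr
        _ < δ₁ * R' := by rwa [mul_comm]
        _ ≤ δ₁ * ‖toC g.pos‖ := by gcongr; exact hnorm _ hx
    exact excess_le_average hK hfneg i1 i2 hle
      (ha _ ((norm_pushBack_le k f f₁ hL.le _ _).trans hv₂)) (ha _ hv₂)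
  · intro n hn y hy
    have : toC y ∉ highRegion k f h K := by
      rw [hE] at hy
      simp only [if_neg (show ¬ n + 1 ≤ N x₀ by omega)] at hy
      exact hy
    exact indicator_of_notMem this _
  · intro y hy
    have h1 := hEN hy
    change (highRegion k f h K).indicator _ (toC y) ≠ 0
    rw [indicator_of_mem (show toC y ∈ highRegion k f h K from h1)]
    exact (ENNReal.ofReal_pos.2 (sub_pos.2 h1.2)).ne'
  · intro n hn g hg
    have h1 := hend n g hg
    rw [lintegral_turn_deep S₁ S₂ n g (hEfr n _ h1) (hEdeep n _ h1).2
      ((htoC.norm.pow_const 2).ennreal_ofReal), hrespond n hn g hg]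
    simp only [LinearIsometryEquiv.apply_symm_apply]
    refine lintegral_norm_sq_le hμ hε.le hL.le ?_
    rw [LinearIsometryEquiv.norm_map]
    exact S₂.norm_tug_le n g
  · intro d hd
    obtain ⟨C, hC, H⟩ := excess_le_sq (h := h) hk0 hk2 hB0 hB hK hd
    exact ⟨C, hC, fun n hn y hy => H _ (hne _ (hE2 n hn hy))⟩
  · intro y hy
    rw [hE1 _ le_rfl, Metric.mem_closedBall, dist_eq_norm] at hy
    refine ENNReal.ofReal_le_ofReal ?_
    rw [LinearIsometryEquiv.norm_map]
    gcongr
    calc ‖y‖ = ‖(x₀ + (N x₀ * c) • e₁) + (y - (x₀ + (N x₀ * c) • e₁))‖ := by congr 1; abel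
      _ ≤ _ := norm_add_le _ _
      _ ≤ _ := by gcongr

end TugOfWar

/-! ### The supremum of the good angles -/

theorem theorem1p3
    (p : ℝ) (hp : 1 < p)
    (μ : MeasureTheory.Measure TugOfWar.Plane) [MeasureTheory.IsProbabilityMeasure μ]
    (hμ : TugOfWar.IsNoise μ) (hpμ : TugOfWar.exponent μ = p) :
    ∃ ηp : ℝ, 0 < ηp ∧ ηp < 2 * Real.pi ∧
      ∀ ε : ℝ, 0 < ε →
        (TugOfWar.goodAngles μ ε).Nonempty ∧
        IsLUB (TugOfWar.goodAngles μ ε) ηp ∧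
        (∀ η : ℝ, 0 < η → η < ηp →
          ∃ S₂ : TugOfWar.Strategy (TugOfWar.wedge η) (TugOfWar.alpha μ) ε,
            ∀ S₁ : TugOfWar.Strategy (TugOfWar.wedge η) (TugOfWar.alpha μ) ε,
              ∀ x₀ ∈ TugOfWar.wedge η, TugOfWar.expectedTime μ S₁ S₂ x₀ < ⊤) ∧
        (∀ η : ℝ, ηp < η → η < 2 * Real.pi →
          ∀ S₂ : TugOfWar.Strategy (TugOfWar.wedge η) (TugOfWar.alpha μ) ε,
            ∃ S₁ : TugOfWar.Strategy (TugOfWar.wedge η) (TugOfWar.alpha μ) ε,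
              ∀ x₀ ∈ TugOfWar.wedge η,
                TugOfWar.alpha μ * ε < Metric.infDist x₀ (frontier (TugOfWar.wedge η)) →
                TugOfWar.expectedTime μ S₁ S₂ x₀ = ⊤) := by
  have hπ := Real.pi_pos
  have hc0 := TugOfWar.criticalHalfAngle_pos hp
  have hcπ := TugOfWar.criticalHalfAngle_le hp
  refine ⟨2 * TugOfWar.criticalHalfAngle p, by linarith, by linarith, fun ε hε => ?_⟩
  have hgood : ∀ η, 0 < η → η < 2 * TugOfWar.criticalHalfAngle p →
      η ∈ TugOfWar.goodAngles μ ε := fun η h0 hη =>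
    ⟨h0, by linarith, TugOfWar.exists_fast_strategy hp hμ hpμ h0 hη hε⟩
  refine ⟨⟨_, hgood (TugOfWar.criticalHalfAngle p) hc0 (by linarith)⟩, ⟨fun η hη => ?_,
    fun b hb => ?_⟩, fun η h0 hη => (hgood η h0 hη).2.2,
    fun η hη hη2 S₂ => TugOfWar.exists_slow_strategy hp hμ hpμ hη hη2 hε S₂⟩
  · by_contra! hlt
    obtain ⟨h0, hη2, S₂, hS₂⟩ := hη
    obtain ⟨S₁, hS₁⟩ := TugOfWar.exists_slow_strategy hp hμ hpμ hlt hη2 hε S₂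
    have hsin := TugOfWar.sin_half_pos h0 hη2
    have hα := TugOfWar.one_le_alpha μ
    have hαε : 0 < TugOfWar.alpha μ * ε := by positivity
    -- A contradiction needs a starting point deeper than `alpha μ * ε`; the point `t • e₁` has
    -- depth at least twice that.
    set t := 2 * (TugOfWar.alpha μ * ε) / Real.sin (η / 2)
    have ht : t * Real.sin (η / 2) = 2 * (TugOfWar.alpha μ * ε) := div_mul_cancel₀ _ hsin.ne'
    have h1 := TugOfWar.smul_add_mem_wedge h0 hη2 (t := t) (y := 0) (by rw [norm_zero]; linarith)
    have h2 := TugOfWar.infDist_smul_add_wedge h0 hη2 t 0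
    rw [norm_zero] at h2
    exact (hS₂ S₁ _ h1).ne (hS₁ _ h1 (by linarith))
  · by_contra! hlt
    -- The midpoint between `b` and the critical angle would be a good angle above `b`; the maximum
    -- ensures that the angle is positive even if `b` is negative.
    have h1 := hb (hgood (max (TugOfWar.criticalHalfAngle p)
      ((b + 2 * TugOfWar.criticalHalfAngle p) / 2)) (by positivity)
      (max_lt (by linarith) (by linarith)))
    linarith [le_max_right (TugOfWar.criticalHalfAngle p)
      ((b + 2 * TugOfWar.criticalHalfAngle p) / 2)]
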